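/- For $n\ge 1$ and two words $P,Q$ of length $n$ in the letters $N$ (north) and $E$ (east), regarded as lattice paths from $(0,0)$ to a common endpoint $(m,r)$ with $P$ never going above $Q$, let $l_1<\dots<l_r$ and $u_1<\dots<u_r$ be the positions of the north steps of $Q$ and of $P$, and let $M[P,Q]$ be the transversal matroid on $[n]=\{1,\dots,n\}$ with presentation $([l_1,u_1],\dots,[l_r,u_r])$. The matroids of the form $M[P,Q]$ are the *lattice path matroids on $[n]$* (with the usual order; they are counted as matroids on $[n]$, not up to isomorphism). Two finite matroids $M,N$ *have the same configuration* if $|E(M)|=|E(N)|$ and there is an isomorphism between their lattices of cyclic flats (flats that are unions of circuits, ordered by inclusion) that preserves the size and the rank of each cyclic flat. A matroid $M$ is *configuration unique* if every finite matroid with the same configuration as $M$ is isomorphic to $M$. Corollary. Asymptotically, almost no lattice path matroids are configuration unique. More precisely: 1. for every $n\ge 2$, the number of configuration-unique connected lattice path matroids on $[n]$ is $(3^{n-2}+1)/2$; 2. for every $n\ge 2$, the number of connected lattice path matroids on $[n]$ is the Catalan number $C_{n-1}$; 3. the ratio of the number of configuration-unique connected lattice path matroids on $[n]$ to the number of connected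 lattice path matroids on $[n]$ tends to $0$ as $n\to\infty$; 4. likewise, the ratio of the number of configuration-unique lattice path matroids on $[n]$ to the number of all lattice path matroids on $[n]$, connected or not, tends to $0$ as $n\to\infty$. -/

import Mathlib

namespace LPM

/-! ### Transversal matroids -/

section Transversal

variable {α ι : Type*}

/-- `I` is a partial transversal of the set system `A`: its elements can be matched injectively
with indices `i` so that each element lies in the set matched to it. -/
def IsPartialTransversal (A : ι → Set α) (I : Set α) : Prop :=
  ∃ f : I → ι, Function.Injective f ∧ ∀ x : I, (x : α) ∈ A (f x)

theorem isPartialTransversal_empty (A : ι → Set α) : IsPartialTransversal A ∅ :=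
  ⟨fun x => x.2.elim, fun x => x.2.elim, fun x => x.2.elim⟩

theorem IsPartialTransversal.subset {A : ι → Set α} {I J : Set α}
    (hJ : IsPartialTransversal A J) (hIJ : I ⊆ J) : IsPartialTransversal A I := by
  obtain ⟨f, hf, hfA⟩ := hJ
  exact ⟨fun x => f (Set.inclusion hIJ x), hf.comp (Set.inclusion_injective hIJ),
    fun x => hfA (Set.inclusion hIJ x)⟩

theorem isPartialTransversal_iff [Nonempty ι] (A : ι → Set α) (I : Set α) :
    IsPartialTransversal A I ↔ ∃ f : α → ι, Set.InjOn f I ∧ ∀ x ∈ I, x ∈ A (f x) := by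
  classical
  constructor
  · rintro ⟨f, hf, hfA⟩
    refine ⟨fun x => if h : x ∈ I then f ⟨x, h⟩ else Classical.arbitrary ι, ?_, ?_⟩
    · intro x hx y hy hxy
      simp only [hx, hy, dif_pos] at hxy
      exact congrArg Subtype.val (hf hxy)
    · intro x hx
      simpa only [hx, dif_pos] using hfA ⟨x, hx⟩
  · rintro ⟨f, hf, hfA⟩
    exact ⟨fun x => f x, fun x y h => Subtype.ext (hf x.2 y.2 h), fun x => hfA x x.2⟩

/-- Augmentation for partial transversals on a finite set. -/
theorem IsPartialTransversal.augment [Finite α] {A : ι → Set α} {I J : Set α}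
    (hI : IsPartialTransversal A I) (hJ : IsPartialTransversal A J) (hIJ : I.ncard < J.ncard) :
    ∃ e ∈ J, e ∉ I ∧ IsPartialTransversal A (insert e I) := by
  classical
  have hJne : J.Nonempty := by
    rw [← Set.ncard_pos]; omega
  have : Nonempty ι := by
    obtain ⟨x, hx⟩ := hJne
    obtain ⟨g, -, -⟩ := hJ
    exact ⟨g ⟨x, hx⟩⟩
  simp only [isPartialTransversal_iff] at hI hJ ⊢
  obtain ⟨g, hg, hgA⟩ := hJ
  by_contra hcon
  have key : ∀ k : ℕ, ∃ f : α → ι, (Set.InjOn f I ∧ ∀ x ∈ I, x ∈ A (f x)) ∧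
      k ≤ {x | x ∈ I ∧ f x = g x}.ncard := by
    intro k
    induction k with
    | zero => obtain ⟨f, hf⟩ := hI; exact ⟨f, hf, Nat.zero_le _⟩
    | succ k ih =>
      obtain ⟨f, ⟨hf, hfA⟩, hk⟩ := ih
      have hlt : (f '' I).ncard < (g '' J).ncard := by
        rw [hf.ncard_image, hg.ncard_image]; exact hIJ
      obtain ⟨_, ⟨x, hxJ, rfl⟩, hx⟩ := Set.exists_mem_notMem_of_ncard_lt_ncard hlt
      have hne : ∀ y ∈ I, f y ≠ g x := fun y hy h => hx ⟨y, hy, h⟩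
      have hinj : Set.InjOn (Function.update f x (g x)) (insert x I) := by
        intro y hy z hz hyz
        by_cases hyx : y = x <;> by_cases hzx : z = x
        · rw [hyx, hzx]
        · subst hyx
          rw [Function.update_self, Function.update_of_ne hzx] at hyz
          exact absurd hyz.symm (hne z (hz.resolve_left hzx))
        · subst hzx
          rw [Function.update_self, Function.update_of_ne hyx] at hyz
          exact absurd hyz (hne y (hy.resolve_left hyx))
        · rw [Function.update_of_ne hyx, Function.update_of_ne hzx] at hyz
          exact hf (hy.resolve_left hyx) (hz.resolve_left hzx) hyz
      have hmem : ∀ y ∈ insert x I, y ∈ A (Function.update f x (g x) y) := by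
        intro y hy
        by_cases hyx : y = x
        · subst hyx; rw [Function.update_self]; exact hgA y hxJ
        · rw [Function.update_of_ne hyx]; exact hfA y (hy.resolve_left hyx)
      by_cases hxI : x ∈ I
      · refine ⟨Function.update f x (g x), ⟨hinj.mono (Set.subset_insert x I),
          fun y hy => hmem y (Set.mem_insert_of_mem x hy)⟩, ?_⟩
        refine Nat.succ_le_of_lt (hk.trans_lt (Set.ncard_lt_ncard ?_ (Set.toFinite _)))
        refine (Set.ssubset_iff_of_subset ?_).2 ⟨x, ⟨hxI, Function.update_self ..⟩,
          fun h => hne x hxI h.2⟩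
        rintro y ⟨hy, hyg⟩
        refine ⟨hy, ?_⟩
        by_cases hyx : y = x
        · subst hyx; exact Function.update_self ..
        · rw [Function.update_of_ne hyx]; exact hyg
      · exact absurd ⟨x, hxJ, hxI, _, hinj, hmem⟩ hcon
  obtain ⟨f, -, hk⟩ := key (I.ncard + 1)
  have : {x | x ∈ I ∧ f x = g x}.ncard ≤ I.ncard :=
    Set.ncard_le_ncard (fun x hx => hx.1) (Set.toFinite _)
  omega

/-- The transversal matroid with presentation `A`, on a finite type: the independent sets are
the partial transversals of `A`. -/
def transversalMatroid [Finite α] (A : ι → Set α) : Matroid α :=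
  (IndepMatroid.ofFinite (E := Set.univ) Set.finite_univ (IsPartialTransversal A)
    (isPartialTransversal_empty A) (fun _ _ hJ hIJ => hJ.subset hIJ)
    (fun _ _ hI hJ hIJ => hI.augment hJ hIJ) (fun _ _ => Set.subset_univ _)).matroid

@[simp] theorem transversalMatroid_ground [Finite α] (A : ι → Set α) :
    (transversalMatroid A).E = Set.univ := rfl

@[simp] theorem transversalMatroid_indep [Finite α] (A : ι → Set α) (I : Set α) :
    (transversalMatroid A).Indep I ↔ IsPartialTransversal A I := Iff.rfl

end Transversal

/-! ### Lattice paths and lattice path matroids -/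

/-- A unit step, north or east. -/
inductive Step
  | north
  | east
  deriving DecidableEq

/-- A lattice path of length `n` starting at `(0,0)`, as a word in the steps. The steps are
indexed by `Fin n`, so `[n] = {1, …, n}` is modelled by `Fin n` in its usual order. -/
abbrev LatticePath (n : ℕ) : Type := Fin n → Step

/-- The positions of the north steps. -/
def northSteps {n : ℕ} (P : LatticePath n) : Finset (Fin n) :=
  Finset.univ.filter fun i => P i = Step.north

/-- The height (second coordinate) of the path after its first `k` steps. -/
def height {n : ℕ} (P : LatticePath n) (k : ℕ) : ℕ :=
  ((northSteps P).filter fun i : Fin n => (i : ℕ) < k).card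

/-- `P` and `Q` have the same endpoint and `P` never goes above `Q`. (After `k` steps both paths
are on the line `x + y = k`, so it suffices to compare heights.) -/
structure NeverAbove {n : ℕ} (P Q : LatticePath n) : Prop where
  same_end : (northSteps Q).card = (northSteps P).card
  height_le : ∀ k ≤ n, height P k ≤ height Q k

/-- The path presentation: the `i`-th set is the interval from the position of the `i`-th north
step of `Q` to the position of the `i`-th north step of `P`. -/
def pathPresentation {n : ℕ} (P Q : LatticePath n) (h : NeverAbove P Q)
    (i : Fin (northSteps P).card) : Set (Fin n) :=
  Set.Icc ((northSteps Q).orderEmbOfFin h.same_end i) ((northSteps P).orderEmbOfFin rfl i)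

/-- The matroid `M[P,Q]` on `[n]`. -/
def pathMatroid {n : ℕ} (P Q : LatticePath n) (h : NeverAbove P Q) : Matroid (Fin n) :=
  transversalMatroid (pathPresentation P Q h)

/-- `M` is a lattice path matroid on `[n]` (with the usual order): it equals some `M[P,Q]`. -/
def IsLatticePathMatroid {n : ℕ} (M : Matroid (Fin n)) : Prop :=
  ∃ (P Q : LatticePath n) (h : NeverAbove P Q), M = pathMatroid P Q h

/-! ### Connectedness, isomorphism, configurations -/

/-- A matroid is connected if any two distinct elements lie in a common circuit. -/
def IsConnected {α : Type*} (M : Matroid α) : Prop :=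
  ∀ e ∈ M.E, ∀ f ∈ M.E, e ≠ f → ∃ C, M.IsCircuit C ∧ e ∈ C ∧ f ∈ C

/-- Matroid isomorphism: a bijection of the ground sets that preserves independence both ways. -/
def Isomorphic {α β : Type*} (M : Matroid α) (N : Matroid β) : Prop :=
  ∃ e : M.E ≃ N.E, ∀ I : Set M.E,
    M.Indep (Subtype.val '' I) ↔ N.Indep (Subtype.val '' (e '' I))

/-- A cyclic flat: a flat that is a (possibly empty) union of circuits. -/
def IsCyclicFlat {α : Type*} (M : Matroid α) (F : Set α) : Prop :=
  M.IsFlat F ∧ ∃ S : Set (Set α), (∀ C ∈ S, M.IsCircuit C) ∧ F = ⋃₀ S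

/-- The set of cyclic flats; as a subtype it is ordered by inclusion. -/
def cyclicFlats {α : Type*} (M : Matroid α) : Set (Set α) := {F | IsCyclicFlat M F}

/-- `M` and `N` have the same configuration: equally large ground sets, and an isomorphism between
their lattices of cyclic flats that preserves the size and the rank of each cyclic flat. -/
def SameConfiguration {α β : Type*} (M : Matroid α) (N : Matroid β) : Prop :=
  M.E.encard = N.E.encard ∧
  ∃ φ : cyclicFlats M ≃o cyclicFlats N, ∀ F : cyclicFlats M,
    (F : Set α).encard = (φ F : Set β).encard ∧ M.eRk (F : Set α) = N.eRk (φ F : Set β)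

/-- `M` is configuration unique: every finite matroid, on any ground set, with the same
configuration as `M` is isomorphic to `M`. -/
def ConfigurationUnique {α : Type*} (M : Matroid α) : Prop :=
  ∀ (β : Type) (N : Matroid β), N.Finite → SameConfiguration M N → Isomorphic M N

/-! ### The classes that are counted -/

/-- The lattice path matroids on `[n]`. -/
def lpms (n : ℕ) : Set (Matroid (Fin n)) := {M | IsLatticePathMatroid M}

/-- The configuration-unique lattice path matroids on `[n]`. -/
def uniqueLpms (n : ℕ) : Set (Matroid (Fin n)) :=
  {M | IsLatticePathMatroid M ∧ ConfigurationUnique M}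

/-- The connected lattice path matroids on `[n]`. -/
def connectedLpms (n : ℕ) : Set (Matroid (Fin n)) :=
  {M | IsLatticePathMatroid M ∧ IsConnected M}

/-- The configuration-unique connected lattice path matroids on `[n]`. -/
def uniqueConnectedLpms (n : ℕ) : Set (Matroid (Fin n)) :=
  {M | IsLatticePathMatroid M ∧ IsConnected M ∧ ConfigurationUnique M}

end LPM

/-! For `n ≥ 2`, the matroid `M[P,Q]` is connected exactly when the two paths meet only at their
ends (`StrictlyBelow`), and the ranks of initial and final segments recover `Q` and `P`. So
connected lattice path matroids correspond to strictly separated pairs. The last step of `P` and the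
first step of `Q` are then north; deleting them and interleaving the other letters gives the Dyck
words of semilength `n - 1`, whence the Catalan number.

The cyclic flats of a connected `M[P,Q]` are governed by two chains: the initial segments that end
at the east-north corners of `Q`, and the final segments that start at the north-east corners of
`P`. A pair of such corners is flexible if the corner of `Q` is strictly north-west of that of `P`.
Configuration uniqueness means that there is no flexible pair
(`StrictlyBelow.configurationUnique_iff`).

Without flexible pairs, each initial segment forms a modular pair with each final one. Modularity
bounds the size of the corresponding intersection in any matroid of the same configuration
(`ncard_inter_le_of_modular`), and since the two segments are disjoint or cover the ground set, this
size is determined. The Venn diagram of the two chains, and with it every cyclic flat, follows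
(`configurationUnique_of_chains`).

With a flexible pair, there are elements `e` and `f` such that a cyclic flat containing only `e` and
one containing only `f` never form a modular pair. The slack allows `f` to be replaced by `e` in all
cyclic flats (`shift`) without violating the axioms for ranked cyclic flats. The configuration stays
the same, but the pairwise intersections grow in total, so the new matroid is not isomorphic to the
old one.

Separated pairs without flexible corners are characterised by comparability of corners alone
(`RigidPair`). Removal of steps near the origin gives linear recursions solved by powers of three
(`two_mul_ncard_rigidPairs`), and `3 ^ n` is negligible against `catalan (n - 1)`, which is at least
`4 ^ n / (8 n ^ 2)`. For matroids that may be disconnected, four consecutive pairs of steps of a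
certain kind already force flexibility. Hence at most `64 * 255 ^ (n / 4)` of them are configuration
unique, and `255 < 4 ^ 4`. -/

namespace LPM

open Set

/-! ### Rank, closure and cyclic flats of finite matroids -/

section Rank

variable {α : Type*} {M : Matroid α} {X Y F G : Set α} {e f x : α}

/-- The rank of a set as a natural number (a junk value for sets of infinite rank). -/
noncomputable def rk (M : Matroid α) (X : Set α) : ℕ := (M.eRk X).toNat

theorem cast_rk (M : Matroid α) [M.Finite] (X : Set α) : (rk M X : ℕ∞) = M.eRk X :=
  ENat.natCast_toNat (Matroid.eRk_lt_top_iff.2 (M.isRkFinite_set X)).ne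

theorem rk_mono (M : Matroid α) [M.Finite] (h : X ⊆ Y) : rk M X ≤ rk M Y := by
  have := M.eRk_mono h
  rw [← cast_rk, ← cast_rk] at this
  exact_mod_cast this

theorem rk_submod (M : Matroid α) [M.Finite] (X Y : Set α) :
    rk M (X ∩ Y) + rk M (X ∪ Y) ≤ rk M X + rk M Y := by
  have := M.eRk_inter_add_eRk_union_le X Y
  simp only [← cast_rk] at this
  exact_mod_cast this

theorem rk_closure (M : Matroid α) (X : Set α) : rk M (M.closure X) = rk M X := by
  simp [rk, Matroid.eRk_closure_eq]

theorem rk_le_ncard (M : Matroid α) [M.Finite] (hX : X.Finite) : rk M X ≤ X.ncard := by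
  have := M.eRk_le_encard X
  rw [← cast_rk, ← hX.cast_ncard_eq] at this
  exact_mod_cast this

theorem rk_union_le (M : Matroid α) [M.Finite] (X Y : Set α) :
    rk M (X ∪ Y) ≤ rk M X + rk M Y := by
  have := rk_submod M X Y; omega

theorem rk_indep [M.Finite] (h : M.Indep X) : rk M X = X.ncard := by
  rw [rk, h.eRk_eq_encard]; rfl

theorem ncard_le_rk [M.Finite] (hX : M.Indep X) (h : X ⊆ Y) : X.ncard ≤ rk M Y := by
  rw [← rk_indep hX]; exact rk_mono M h

theorem exists_indep_ncard (M : Matroid α) [M.Finite] (X : Set α) :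
    ∃ I, I ⊆ X ∧ M.Indep I ∧ I.ncard = rk M X := by
  obtain ⟨I, hI⟩ := M.exists_isBasis' X
  refine ⟨I, hI.subset, hI.indep, ?_⟩
  rw [rk, ← hI.encard_eq_eRk]; rfl

theorem indep_of_ncard_le_rk [M.Finite] (hX : X.Finite) (h : X.ncard ≤ rk M X) : M.Indep X := by
  rw [Matroid.indep_iff_eRk_eq_encard_of_finite hX]
  apply le_antisymm (M.eRk_le_encard X)
  rw [← cast_rk, ← hX.cast_ncard_eq]
  exact_mod_cast h

theorem mem_closure_iff_rk [M.Finite] (hx : x ∈ M.E) :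
    x ∈ M.closure X ↔ rk M (insert x X) = rk M X := by
  constructor
  · intro h
    rw [← rk_closure, Matroid.closure_insert_eq_of_mem_closure h, rk_closure]
  · intro h
    by_contra hcon
    have := M.eRk_insert_eq_add_one (X := X) ⟨hx, hcon⟩
    rw [← cast_rk, ← cast_rk, h] at this
    have : rk M X = rk M X + 1 := by exact_mod_cast this
    omega

theorem isFlat_iff_rk [M.Finite] (hF : F ⊆ M.E) :
    M.IsFlat F ↔ ∀ x ∈ M.E, x ∉ F → rk M F < rk M (insert x F) := by
  rw [Matroid.isFlat_iff_closure_eq]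
  constructor
  · intro h x hx hxF
    refine lt_of_le_of_ne (rk_mono M (subset_insert _ _)) fun h' => hxF ?_
    rw [← h]; exact (mem_closure_iff_rk hx).2 h'.symm
  · intro h
    refine subset_antisymm (fun x hx => ?_) (M.subset_closure F)
    by_contra hxF
    have hxE := M.closure_subset_ground F hx
    have := h x hxE hxF
    rw [(mem_closure_iff_rk hxE).1 hx] at this
    exact lt_irrefl _ this

/-- A set is cyclic if it is a union of circuits. -/
def IsCyclic (M : Matroid α) (X : Set α) : Prop := ∀ x ∈ X, ∃ C ⊆ X, M.IsCircuit C ∧ x ∈ C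

theorem IsCyclic.subset_ground (h : IsCyclic M X) : X ⊆ M.E := fun x hx => by
  obtain ⟨C, -, hC, hxC⟩ := h x hx
  exact hC.subset_ground hxC

theorem mem_cyclicFlats : F ∈ cyclicFlats M ↔ M.IsFlat F ∧ IsCyclic M F := by
  refine and_congr_right fun _ => ⟨?_, fun h => ⟨{C | C ⊆ F ∧ M.IsCircuit C}, fun C hC => hC.2, ?_⟩⟩
  · rintro ⟨S, hS, rfl⟩ x ⟨C, hC, hx⟩
    exact ⟨C, subset_sUnion_of_mem hC, hS C hC, hx⟩
  · refine subset_antisymm (fun x hx => ?_) (sUnion_subset fun C hC => hC.1)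
    obtain ⟨C, hCF, hC, hxC⟩ := h x hx
    exact ⟨C, ⟨hCF, hC⟩, hxC⟩

theorem isCyclic_iff_rk [M.Finite] (hX : X ⊆ M.E) :
    IsCyclic M X ↔ ∀ x ∈ X, rk M (X \ {x}) = rk M X := by
  refine forall₂_congr fun x hx => ?_
  have h1 : rk M (X \ {x}) = rk M X ↔ x ∈ M.closure (X \ {x}) := by
    rw [mem_closure_iff_rk (hX hx), insert_sdiff_singleton, insert_eq_of_mem hx, eq_comm]
  rw [h1, Matroid.mem_closure_iff_exists_isCircuit (by simp), insert_sdiff_singleton,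
    insert_eq_of_mem hx]

/-- The union of the circuits contained in `X`. -/
def cyclicPart (M : Matroid α) (X : Set α) : Set α := {x | ∃ C ⊆ X, M.IsCircuit C ∧ x ∈ C}

theorem cyclicPart_subset (M : Matroid α) (X : Set α) : cyclicPart M X ⊆ X := by
  rintro x ⟨C, hC, -, hx⟩; exact hC hx

theorem isCyclic_cyclicPart (M : Matroid α) (X : Set α) : IsCyclic M (cyclicPart M X) := by
  rintro x ⟨C, hCX, hC, hx⟩
  exact ⟨C, fun y hy => ⟨C, hCX, hC, hy⟩, hC, hx⟩

theorem IsCyclic.subset_cyclicPart (h : IsCyclic M Y) (hYX : Y ⊆ X) : Y ⊆ cyclicPart M X := by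
  intro y hy
  obtain ⟨C, hC, hC', hyC⟩ := h y hy
  exact ⟨C, hC.trans hYX, hC', hyC⟩

/-- A basis of the cyclic part extends to a basis of `X`, and an element of `X` on no circuit inside
`X` belongs to every basis of `X`. -/
theorem rk_cyclicPart [M.Finite] (hX : X ⊆ M.E) :
    rk M X = rk M (cyclicPart M X) + (X \ cyclicPart M X).ncard := by
  have hfin : X.Finite := M.ground_finite.subset hX
  obtain ⟨B, hB⟩ := M.exists_isBasis (cyclicPart M X) ((cyclicPart_subset M X).trans hX)
  obtain ⟨B', hB', hBB'⟩ := hB.exists_isBasis_inter_eq_of_superset (cyclicPart_subset M X) hX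
  have h1 : rk M X = B'.ncard := by rw [rk, ← hB'.encard_eq_eRk]; rfl
  have h2 : rk M (cyclicPart M X) = B.ncard := by rw [rk, ← hB.encard_eq_eRk]; rfl
  have h3 : X \ cyclicPart M X = B' \ cyclicPart M X := by
    refine subset_antisymm (fun x hx => ⟨?_, hx.2⟩) (sdiff_subset_sdiff_left hB'.subset)
    by_contra hxB
    obtain ⟨C, hC, hC', hxC⟩ :=
      Matroid.exists_isCircuit_of_mem_closure (hB'.subset_closure hx.1) hxB
    exact hx.2 ⟨C, hC.trans (insert_subset hx.1 hB'.subset), hC', hxC⟩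
  rw [h1, h2, h3, ← hBB', ncard_inter_add_ncard_sdiff_eq_ncard _ _ (hfin.subset hB'.subset)]

/-- An element of the closure of the cyclic part that lay outside it would complete a circuit inside
the flat `F`, and so belong to the cyclic part. This provides the meets of cyclic flats; closures of
unions provide the joins. -/
theorem cyclicPart_mem_cyclicFlats (hF : M.IsFlat F) : cyclicPart M F ∈ cyclicFlats M := by
  refine mem_cyclicFlats.2 ⟨?_, isCyclic_cyclicPart M F⟩
  rw [Matroid.isFlat_iff_closure_eq]
  refine subset_antisymm (fun x hx => ?_)
    (M.subset_closure _ ((cyclicPart_subset M F).trans hF.subset_ground))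
  by_contra hxF
  obtain ⟨C, hC, hC', hxC⟩ := Matroid.exists_isCircuit_of_mem_closure hx hxF
  have hxF' : x ∈ F := by
    rw [← hF.closure]; exact M.closure_subset_closure (cyclicPart_subset M F) hx
  exact hxF ⟨C, hC.trans (insert_subset hxF' (cyclicPart_subset M F)), hC', hxC⟩

theorem closure_mem_cyclicFlats (hX : IsCyclic M X) : M.closure X ∈ cyclicFlats M := by
  refine mem_cyclicFlats.2 ⟨M.isFlat_closure X, fun x hx => ?_⟩
  have hsub := M.subset_closure X hX.subset_ground
  by_cases hxX : x ∈ X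
  · obtain ⟨C, hC, hC', hxC⟩ := hX x hxX
    exact ⟨C, hC.trans hsub, hC', hxC⟩
  · obtain ⟨C, hC, hC', hxC⟩ := Matroid.exists_isCircuit_of_mem_closure hx hxX
    exact ⟨C, hC.trans (insert_subset hx hsub), hC', hxC⟩

theorem IsCyclic.union (hX : IsCyclic M X) (hY : IsCyclic M Y) : IsCyclic M (X ∪ Y) := by
  rintro x (hx | hx)
  · obtain ⟨C, hC, h⟩ := hX x hx; exact ⟨C, hC.trans subset_union_left, h⟩
  · obtain ⟨C, hC, h⟩ := hY x hx; exact ⟨C, hC.trans subset_union_right, h⟩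

theorem isCyclic_of_isCircuit {C : Set α} (hC : M.IsCircuit C) : IsCyclic M C :=
  fun _ hx => ⟨C, subset_rfl, hC, hx⟩

theorem subset_ground_of_mem_cyclicFlats (hF : F ∈ cyclicFlats M) : F ⊆ M.E :=
  (mem_cyclicFlats.1 hF).1.subset_ground

theorem join_mem_cyclicFlats (hF : F ∈ cyclicFlats M) (hG : G ∈ cyclicFlats M) :
    M.closure (F ∪ G) ∈ cyclicFlats M :=
  closure_mem_cyclicFlats ((mem_cyclicFlats.1 hF).2.union (mem_cyclicFlats.1 hG).2)

theorem isFlat_inter (hF : M.IsFlat F) (hG : M.IsFlat G) : M.IsFlat (F ∩ G) := by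
  rw [Matroid.isFlat_iff_closure_eq]
  refine subset_antisymm (subset_inter ?_ ?_)
    (M.subset_closure _ (inter_subset_left.trans hF.subset_ground))
  · exact (M.closure_subset_closure inter_subset_left).trans_eq hF.closure
  · exact (M.closure_subset_closure inter_subset_right).trans_eq hG.closure

theorem meet_mem_cyclicFlats (hF : F ∈ cyclicFlats M) (hG : G ∈ cyclicFlats M) :
    cyclicPart M (F ∩ G) ∈ cyclicFlats M :=
  cyclicPart_mem_cyclicFlats (isFlat_inter (mem_cyclicFlats.1 hF).1 (mem_cyclicFlats.1 hG).1)

/-- A set is independent iff it meets no cyclic flat in more elements than the rank allows. -/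
theorem indep_iff_cyclicFlats [M.Finite] (hX : X ⊆ M.E) :
    M.Indep X ↔ ∀ F ∈ cyclicFlats M, (X ∩ F).ncard ≤ rk M F := by
  constructor
  · intro h F _
    exact ncard_le_rk (h.inter_right F) inter_subset_right
  · intro h
    by_contra hcon
    -- The closure of a circuit `C ⊆ X` is a cyclic flat of rank `|C| - 1` that meets `X` in at
    -- least `|C|` elements.
    obtain ⟨C, hCX, hC⟩ := Matroid.Dep.exists_isCircuit_subset ⟨hcon, hX⟩
    have hfin : C.Finite := M.ground_finite.subset hC.subset_ground
    have h1 := h _ (closure_mem_cyclicFlats (isCyclic_of_isCircuit hC))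
    have h2 := hC.eRk_add_one_eq
    rw [← cast_rk, ← hfin.cast_ncard_eq] at h2
    have h3 : rk M C + 1 = C.ncard := by exact_mod_cast h2
    rw [rk_closure] at h1
    have h4 : C.ncard ≤ (X ∩ M.closure C).ncard :=
      ncard_le_ncard (subset_inter hCX (M.subset_closure C))
        ((M.ground_finite.subset hX).subset inter_subset_left)
    omega

/-- The flat is the closure of a circuit through `x` inside `Y`; it stays within the closure of `Y`,
which misses `f`. -/
theorem exists_cyclicFlat_separating {Y : Set α} (hxY : x ∈ Y)
    (hx : x ∈ M.closure (Y \ {x})) (hf : f ∉ M.closure Y) :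
    ∃ F ∈ cyclicFlats M, x ∈ F ∧ f ∉ F := by
  obtain ⟨C, hC, hC', hxC⟩ := Matroid.exists_isCircuit_of_mem_closure hx (by simp)
  rw [insert_sdiff_singleton, insert_eq_of_mem hxY] at hC
  exact ⟨M.closure C, closure_mem_cyclicFlats (isCyclic_of_isCircuit hC'),
    M.subset_closure C hC'.subset_ground hxC, fun h => hf (M.closure_subset_closure hC h)⟩

/-- Cyclic flats are exactly the sets with no element of the ground set that can be added without
raising, or removed with lowering, the rank. -/
theorem mem_cyclicFlats_iff_rk [M.Finite] (hF : F ⊆ M.E) : F ∈ cyclicFlats M ↔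
    (∀ x ∈ M.E, x ∉ F → rk M F < rk M (insert x F)) ∧ ∀ x ∈ F, rk M (F \ {x}) = rk M F := by
  rw [mem_cyclicFlats, isFlat_iff_rk hF, isCyclic_iff_rk hF]

theorem rk_lt_of_isFlat [M.Finite] (hF : M.IsFlat F) (hG : G ⊆ M.E) (h : F ⊂ G) :
    rk M F < rk M G := by
  obtain ⟨x, hxG, hxF⟩ := exists_of_ssubset h
  exact ((isFlat_iff_rk hF.subset_ground).1 hF x (hG hxG) hxF).trans_le
    (rk_mono M (insert_subset hxG h.1))

/-- Nullity grows strictly towards a cyclic set: one element of `F \ G` can be deleted from `F`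
without loss of rank, and the others contribute at most one each. -/
theorem rk_add_lt_of_isCyclic [M.Finite] (hF : IsCyclic M F) (h : G ⊂ F) :
    rk M F + G.ncard < rk M G + F.ncard := by
  have hfin : F.Finite := M.ground_finite.subset hF.subset_ground
  obtain ⟨x, hxF, hxG⟩ := exists_of_ssubset h
  have h1 := (isCyclic_iff_rk hF.subset_ground).1 hF x hxF
  have h2 : F \ {x} = G ∪ (F \ {x}) \ G := by
    rw [union_sdiff_cancel]; exact fun y hy => ⟨h.1 hy, fun hyx => hxG (hyx ▸ hy)⟩
  have h3 := rk_union_le M G ((F \ {x}) \ G)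
  rw [← h2, h1] at h3
  have h4 := rk_le_ncard M (X := (F \ {x}) \ G) (hfin.subset (sdiff_subset.trans sdiff_subset))
  have h5 : G ⊆ F \ {x} := fun y hy => ⟨h.1 hy, fun hyx => hxG (hyx ▸ hy)⟩
  have h6 := ncard_sdiff_add_ncard_of_subset h5 (hfin.subset sdiff_subset)
  have h7 := ncard_sdiff_singleton_add_one hxF hfin
  omega

end Rank

end LPM

namespace LPM

open Set

/-! ### Matroids with prescribed ranked cyclic flats -/

section CyclicFlatFamily

variable {α ζ : Type*} {F : ζ → Set α} {r : ζ → ℕ} {I J X : Set α}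

/-- The axioms for a family of sets with prescribed ranks to be the cyclic flats of a matroid. -/
structure CyclicFlatAxioms (F : ζ → Set α) (r : ζ → ℕ) : Prop where
  inj : Function.Injective F
  zero : ∃ a, r a = 0
  strict : ∀ a t, F t ⊂ F a → r t < r a ∧ r a + (F t).ncard < r t + (F a).ncard
  submod : ∀ a b, ∃ s t, F a ∪ F b ⊆ F s ∧ F t ⊆ F a ∩ F b ∧
    r s + r t + ((F a ∩ F b) \ F t).ncard ≤ r a + r b

/-- Independence with respect to a ranked family of sets. -/
def FamilyIndep (F : ζ → Set α) (r : ζ → ℕ) (I : Set α) : Prop := ∀ a, (I ∩ F a).ncard ≤ r a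

theorem CyclicFlatAxioms.le_of_subset (h : CyclicFlatAxioms F r) {a t : ζ} (hs : F t ⊆ F a) :
    r t ≤ r a ∧ r a + (F t).ncard ≤ r t + (F a).ncard := by
  rcases hs.eq_or_ssubset with he | hlt
  · rw [h.inj he]; exact ⟨le_rfl, le_rfl⟩
  · have := h.strict a t hlt; omega

variable [Finite α]

theorem FamilyIndep.subset (hJ : FamilyIndep F r J) (h : I ⊆ J) : FamilyIndep F r I :=
  fun a => (ncard_le_ncard (inter_subset_inter_left _ h)).trans (hJ a)

/-- At most `r t + |(F a ∩ F b) \ F t|` elements of `I` lie in `F a ∩ F b`, so inclusion-exclusion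
leaves at least `r s` of them in `F s`. An upper bound `s` and a lower bound `t` suffice here,
without a lattice structure. -/
theorem CyclicFlatAxioms.tight_join (h : CyclicFlatAxioms F r) (hI : FamilyIndep F r I) {a b : ζ}
    (ha : (I ∩ F a).ncard = r a) (hb : (I ∩ F b).ncard = r b) :
    ∃ s, F a ∪ F b ⊆ F s ∧ (I ∩ F s).ncard = r s := by
  obtain ⟨s, t, hs, ht, hst⟩ := h.submod a b
  refine ⟨s, hs, le_antisymm (hI s) ?_⟩
  have h1 := ncard_union_add_ncard_inter (I ∩ F a) (I ∩ F b)
  have h2 : (I ∩ F a ∪ I ∩ F b).ncard ≤ (I ∩ F s).ncard :=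
    ncard_le_ncard (by rw [← inter_union_distrib_left]; exact inter_subset_inter_right _ hs)
  have h3 : (I ∩ F a ∩ (I ∩ F b)).ncard ≤ (I ∩ F t).ncard + ((F a ∩ F b) \ F t).ncard := by
    refine (ncard_le_ncard ?_).trans (ncard_union_le _ _)
    rintro x ⟨⟨hxI, hxa⟩, -, hxb⟩
    by_cases hxt : x ∈ F t
    · exact Or.inl ⟨hxI, hxt⟩
    · exact Or.inr ⟨⟨hxa, hxb⟩, hxt⟩
  have h4 := hI t
  omega

/-- If no element of a nonempty set `D` can be added to the independent set `I`, then `D` lies in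
a single tight member of the family. -/
theorem CyclicFlatAxioms.exists_tight (h : CyclicFlatAxioms F r) (hI : FamilyIndep F r I)
    {D : Set α} (hD : D.Nonempty) (hDI : ∀ x ∈ D, ¬ FamilyIndep F r (insert x I)) :
    ∃ a, D ⊆ F a ∧ (I ∩ F a).ncard = r a := by
  have h1 : ∀ x ∈ D, ∃ a, x ∈ F a ∧ (I ∩ F a).ncard = r a := by
    intro x hx
    have := hDI x hx
    simp only [FamilyIndep, not_forall, not_le] at this
    obtain ⟨a, ha⟩ := this
    have hxa : x ∈ F a := by
      by_contra hxa
      rw [insert_inter_of_notMem hxa] at ha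
      exact absurd (hI a) (not_le.2 ha)
    rw [insert_inter_of_mem hxa] at ha
    have := ncard_insert_le x (I ∩ F a)
    exact ⟨a, hxa, le_antisymm (hI a) (by omega)⟩
  suffices hs : ∀ S : Set α, S.Finite → S.Nonempty → S ⊆ D →
      ∃ a, S ⊆ F a ∧ (I ∩ F a).ncard = r a from hs D D.toFinite hD subset_rfl
  intro S hS
  induction S, hS using Set.Finite.induction_on with
  | empty => intro hne; exact absurd hne (by simp)
  | @insert x S _ _ ih =>
    intro _ hsub
    obtain ⟨a, hxa, ha⟩ := h1 x (hsub (mem_insert _ _))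
    rcases S.eq_empty_or_nonempty with rfl | hne
    · exact ⟨a, by simpa using hxa, ha⟩
    · obtain ⟨b, hSb, hb⟩ := ih hne ((subset_insert _ _).trans hsub)
      obtain ⟨s, hs, hs'⟩ := h.tight_join hI ha hb
      exact ⟨s, insert_subset (hs (Or.inl hxa)) (hSb.trans (subset_union_right.trans hs)), hs'⟩

/-- If nothing could be added, one tight `F a` would contain `J \ I`. Then `J` would have at most `r
a = |I ∩ F a|` elements in `F a`, and no more than `I` outside it. -/
theorem CyclicFlatAxioms.augment (h : CyclicFlatAxioms F r) (hI : FamilyIndep F r I)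
    (hJ : FamilyIndep F r J) (hIJ : I.ncard < J.ncard) :
    ∃ e ∈ J, e ∉ I ∧ FamilyIndep F r (insert e I) := by
  by_contra hcon
  have hne : (J \ I).Nonempty := by
    obtain ⟨x, hx, hx'⟩ := exists_mem_notMem_of_ncard_lt_ncard hIJ
    exact ⟨x, hx, hx'⟩
  obtain ⟨a, ha, hIa⟩ := h.exists_tight hI hne fun x hx hxI => hcon ⟨x, hx.1, hx.2, hxI⟩
  have h1 := ncard_inter_add_ncard_sdiff_eq_ncard J (F a)
  have h2 := ncard_inter_add_ncard_sdiff_eq_ncard I (F a)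
  have h3 : (J \ F a).ncard ≤ (I \ F a).ncard := by
    refine ncard_le_ncard fun x hx => ⟨?_, hx.2⟩
    by_contra hxI
    exact hx.2 (ha ⟨hx.1, hxI⟩)
  have h4 := hJ a
  omega

/-- The matroid with a prescribed ranked family of cyclic flats. -/
def CyclicFlatAxioms.matroid (h : CyclicFlatAxioms F r) : Matroid α :=
  (IndepMatroid.ofFinite (E := univ) finite_univ (FamilyIndep F r)
    (fun a => by simp) (fun _ _ hJ hIJ => hJ.subset hIJ)
    (fun _ _ hI hJ hIJ => h.augment hI hJ hIJ) (fun _ _ => subset_univ _)).matroid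

instance (h : CyclicFlatAxioms F r) : h.matroid.Finite := ⟨toFinite _⟩

theorem CyclicFlatAxioms.rk_le (h : CyclicFlatAxioms F r) (a : ζ) (X : Set α) :
    rk h.matroid X ≤ r a + (X \ F a).ncard := by
  obtain ⟨I, hIX, hI, hIc⟩ := exists_indep_ncard h.matroid X
  rw [← hIc, ← ncard_inter_add_ncard_sdiff_eq_ncard I (F a)]
  exact add_le_add (hI a) (ncard_le_ncard (sdiff_subset_sdiff_left hIX))

/-- For an independent `I ⊆ X` of full rank, a single tight member contains `X \ I` and attains the
bound `rk_le`. If `X` is itself independent, the member of rank zero serves. So the rank is the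
minimum of `r a + |X \ F a|`. -/
theorem CyclicFlatAxioms.exists_rk_eq (h : CyclicFlatAxioms F r) (X : Set α) :
    ∃ a, rk h.matroid X = r a + (X \ F a).ncard := by
  suffices hs : ∃ a, r a + (X \ F a).ncard ≤ rk h.matroid X by
    obtain ⟨a, ha⟩ := hs; exact ⟨a, le_antisymm (h.rk_le a X) ha⟩
  obtain ⟨I, hIX, hI, hIc⟩ := exists_indep_ncard h.matroid X
  rcases (X \ I).eq_empty_or_nonempty with he | hne
  · have hXI : I = X := subset_antisymm hIX (sdiff_eq_empty.1 he)
    obtain ⟨a, ha⟩ := h.zero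
    refine ⟨a, ?_⟩
    rw [← hIc, hXI, ha, zero_add]
    exact ncard_le_ncard sdiff_subset
  · obtain ⟨a, ha, hIa⟩ := h.exists_tight hI hne fun x hx hxI => by
      have h1 := ncard_le_rk (M := h.matroid) (X := insert x I) hxI (insert_subset hx.1 hIX)
      rw [ncard_insert_of_notMem hx.2] at h1
      omega
    refine ⟨a, ?_⟩
    rw [← hIc, ← ncard_inter_add_ncard_sdiff_eq_ncard I (F a), hIa]
    have hsub : X \ F a ⊆ I \ F a := by
      refine fun x hx => ⟨?_, hx.2⟩
      by_contra hxI
      exact hx.2 (ha ⟨hx.1, hxI⟩)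
    have := ncard_le_ncard hsub
    omega

/-- The excess of the bound on the rank of `F a` given by `F b`. -/
theorem CyclicFlatAxioms.exists_excess (h : CyclicFlatAxioms F r) (a b : ζ) : ∃ s t, F a ∪ F b ⊆ F s ∧ F t ⊆ F a ∩ F b ∧
    r s + r t + (F a).ncard ≤ r a + r b + (F a \ F b).ncard + (F t).ncard := by
  obtain ⟨s, t, hs, ht, hst⟩ := h.submod a b
  refine ⟨s, t, hs, ht, ?_⟩
  have h1 := ncard_inter_add_ncard_sdiff_eq_ncard (F a) (F b)
  have h2 := ncard_sdiff_add_ncard_of_subset ht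
  omega

/-- The bound coming from any other `F b` is no better than `r a`: in `exists_excess`, the rank of
`F s` is at least that of `F a`, and the nullity of `F t` is at most that of `F a`. -/
theorem CyclicFlatAxioms.rk_eq (h : CyclicFlatAxioms F r) (a : ζ) : rk h.matroid (F a) = r a := by
  refine le_antisymm (by simpa using h.rk_le a (F a)) ?_
  obtain ⟨b, hb⟩ := h.exists_rk_eq (F a)
  obtain ⟨s, t, hs, ht, hst⟩ := h.exists_excess a b
  have h1 := h.le_of_subset (subset_union_left.trans hs)
  have h2 := h.le_of_subset (ht.trans inter_subset_left)
  omega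

/-- The estimate behind `rk_eq` gains one. If an added `x` lies in `F b`, then `F s` properly
contains `F a`; if a deleted `x` lies outside `F b`, then `F t` is properly contained in `F a`. In
both cases the strict axiom applies, and in the remaining cases `x` itself accounts for the
difference in the count. -/
theorem CyclicFlatAxioms.mem_cyclicFlats (h : CyclicFlatAxioms F r) (a : ζ) : F a ∈ cyclicFlats h.matroid := by
  rw [mem_cyclicFlats_iff_rk (subset_univ _)]
  constructor
  · intro x _ hx
    rw [h.rk_eq]
    obtain ⟨b, hb⟩ := h.exists_rk_eq (insert x (F a))
    obtain ⟨s, t, hs, ht, hst⟩ := h.exists_excess a b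
    have h1 := h.le_of_subset (subset_union_left.trans hs)
    have h2 := h.le_of_subset (ht.trans inter_subset_left)
    by_cases hxb : x ∈ F b
    · have h3 := h.strict s a ⟨subset_union_left.trans hs, fun hsa => hx (hsa (hs (Or.inr hxb)))⟩
      rw [insert_sdiff_of_mem _ hxb] at hb
      omega
    · rw [insert_sdiff_of_notMem _ hxb, ncard_insert_of_notMem (fun h' => hx h'.1)] at hb
      omega
  · intro x hx
    refine le_antisymm (rk_mono _ sdiff_subset) ?_
    rw [h.rk_eq]
    obtain ⟨b, hb⟩ := h.exists_rk_eq (F a \ {x})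
    obtain ⟨s, t, hs, ht, hst⟩ := h.exists_excess a b
    have h1 := h.le_of_subset (subset_union_left.trans hs)
    have h2 := h.le_of_subset (ht.trans inter_subset_left)
    rw [sdiff_sdiff_comm] at hb
    by_cases hxb : x ∈ F b
    · rw [sdiff_singleton_eq_self (s := F a \ F b) (fun h' => h'.2 hxb)] at hb
      omega
    · have h3 := h.strict a t ⟨ht.trans inter_subset_left, fun hat => hxb (ht (hat hx)).2⟩
      have h4 := ncard_sdiff_singleton_add_one (s := F a \ F b) ⟨hx, hxb⟩
      omega

/-- The member that attains the rank of `X` is `X`: an element of `X` outside it could be deleted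
only with loss of rank, and an element of it outside `X` could be added without gain. -/
theorem CyclicFlatAxioms.exists_eq (h : CyclicFlatAxioms F r) (hX : X ∈ cyclicFlats h.matroid) : ∃ a, F a = X := by
  obtain ⟨a, ha⟩ := h.exists_rk_eq X
  rw [mem_cyclicFlats_iff_rk (subset_univ _)] at hX
  have hXa : X ⊆ F a := by
    intro x hx
    by_contra hxa
    have h1 := h.rk_le a (X \ {x})
    rw [hX.2 x hx, ha, sdiff_sdiff_comm] at h1
    have h2 := ncard_sdiff_singleton_add_one (s := X \ F a) ⟨hx, hxa⟩
    omega
  refine ⟨a, subset_antisymm (fun x hx => ?_) hXa⟩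
  by_contra hxX
  have h1 := hX.1 x (mem_univ x) hxX
  have h2 := rk_mono h.matroid (insert_subset hx hXa)
  rw [h.rk_eq] at h2
  omega

end CyclicFlatFamily

end LPM

namespace LPM

open Set

/-! ### Replacing one element by another in a set -/

section Shift

variable {α : Type*} {e f x : α} {F G : Set α}

/-- The shift of a set from `f` to `e`: if `F` contains `f` but not `e`, then `f` is replaced
by `e`. -/
def shift (e f : α) (F : Set α) : Set α :=
  {x | (x = e ∧ (e ∈ F ∨ f ∈ F)) ∨ (x ≠ e ∧ x = f ∧ e ∈ F ∧ f ∈ F) ∨ (x ≠ e ∧ x ≠ f ∧ x ∈ F)}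

theorem left_mem_shift : e ∈ shift e f F ↔ e ∈ F ∨ f ∈ F := by simp [shift]

theorem right_mem_shift (hef : e ≠ f) : f ∈ shift e f F ↔ e ∈ F ∧ f ∈ F := by
  simp [shift, hef.symm]

theorem mem_shift_of_ne (he : x ≠ e) (hf : x ≠ f) : x ∈ shift e f F ↔ x ∈ F := by
  simp [shift, he, hf]

theorem shift_mono (h : F ⊆ G) : shift e f F ⊆ shift e f G := by
  rintro x (⟨h1, h2⟩ | ⟨h1, h2, h3⟩ | ⟨h1, h2, h3⟩)
  · exact Or.inl ⟨h1, h2.imp (@h _) (@h _)⟩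
  · exact Or.inr (Or.inl ⟨h1, h2, h h3.1, h h3.2⟩)
  · exact Or.inr (Or.inr ⟨h1, h2, h h3⟩)

open Classical in
theorem ncard_eq_add_ite [Finite α] (hef : e ≠ f) (X : Set α) : X.ncard =
    (X \ {e, f}).ncard + (if e ∈ X then 1 else 0) + (if f ∈ X then 1 else 0) := by
  have h1 := ncard_inter_add_ncard_sdiff_eq_ncard X {e, f}
  by_cases he : e ∈ X <;> by_cases hf : f ∈ X
  · have : X ∩ {e, f} = {e, f} := inter_eq_right.2 (by rintro x (rfl | rfl) <;> assumption)
    rw [this, ncard_pair hef] at h1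
    simp [he, hf]; omega
  · have : X ∩ {e, f} = {e} := by ext x; simp; grind
    rw [this, ncard_singleton] at h1
    simp [he, hf]; omega
  · have : X ∩ {e, f} = {f} := by ext x; simp; grind
    rw [this, ncard_singleton] at h1
    simp [he, hf]; omega
  · have : X ∩ {e, f} = ∅ := by ext x; simp; grind
    rw [this, ncard_empty] at h1
    simp [he, hf]; omega

theorem shift_sdiff : shift e f F \ {e, f} = F \ {e, f} := by
  ext x
  simp only [mem_sdiff, mem_insert_iff, mem_singleton_iff, not_or]
  refine and_congr_left fun h => mem_shift_of_ne h.1 h.2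

theorem shift_inter_sdiff : (shift e f F ∩ shift e f G) \ {e, f} = (F ∩ G) \ {e, f} := by
  ext x
  simp only [mem_sdiff, mem_inter_iff, mem_insert_iff, mem_singleton_iff, not_or]
  refine and_congr_left fun h => ?_
  rw [mem_shift_of_ne h.1 h.2, mem_shift_of_ne h.1 h.2]

theorem ncard_shift [Finite α] (hef : e ≠ f) : (shift e f F).ncard = F.ncard := by
  rw [ncard_eq_add_ite hef, ncard_eq_add_ite hef F, shift_sdiff]
  by_cases he : e ∈ F <;> by_cases hf : f ∈ F <;>
    simp [left_mem_shift, right_mem_shift hef, he, hf]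

/-- The case in which an intersection grows: both shifted sets contain `e`, whereas `F ∩ G` contains
neither `e` nor `f`. -/
theorem ncard_shift_inter_of_separated [Finite α] (hef : e ≠ f) (h1 : e ∈ F) (h2 : f ∉ F)
    (h3 : e ∉ G) (h4 : f ∈ G) :
    (shift e f F ∩ shift e f G).ncard = (F ∩ G).ncard + 1 := by
  rw [ncard_eq_add_ite hef, ncard_eq_add_ite hef (F ∩ G), shift_inter_sdiff]
  simp [left_mem_shift, right_mem_shift hef, h1, h2, h3, h4]

theorem ncard_shift_inter_of_not_separated [Finite α] (hef : e ≠ f)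
    (h1 : ¬ (e ∈ F ∧ f ∉ F ∧ e ∉ G ∧ f ∈ G)) (h2 : ¬ (e ∈ G ∧ f ∉ G ∧ e ∉ F ∧ f ∈ F)) :
    (shift e f F ∩ shift e f G).ncard = (F ∩ G).ncard := by
  rw [ncard_eq_add_ite hef, ncard_eq_add_ite hef (F ∩ G), shift_inter_sdiff]
  by_cases he : e ∈ F <;> by_cases hf : f ∈ F <;> by_cases he' : e ∈ G <;>
    by_cases hf' : f ∈ G <;>
    simp [left_mem_shift, right_mem_shift hef, he, hf, he', hf'] at h1 h2 ⊢

theorem ncard_inter_le_shift [Finite α] (hef : e ≠ f) :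
    (F ∩ G).ncard ≤ (shift e f F ∩ shift e f G).ncard := by
  by_cases h1 : e ∈ F ∧ f ∉ F ∧ e ∉ G ∧ f ∈ G
  · rw [ncard_shift_inter_of_separated hef h1.1 h1.2.1 h1.2.2.1 h1.2.2.2]; omega
  by_cases h2 : e ∈ G ∧ f ∉ G ∧ e ∉ F ∧ f ∈ F
  · rw [inter_comm (shift e f F), inter_comm F,
      ncard_shift_inter_of_separated hef h2.1 h2.2.1 h2.2.2.1 h2.2.2.2]; omega
  · rw [ncard_shift_inter_of_not_separated hef h1 h2]

end Shift

/-! ### A second matroid with the same configuration -/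

section NonUnique

variable {α : Type} {M : Matroid α} {e f : α}

theorem Isomorphic.exists_equiv {N : Matroid α} (hM : M.E = univ) (hN : N.E = univ)
    (h : Isomorphic M N) : ∃ π : α ≃ α, ∀ I, M.Indep I ↔ N.Indep (π '' I) := by
  obtain ⟨g, hg⟩ := h
  let a : α ≃ M.E := (Equiv.Set.univ α).symm.trans (Equiv.setCongr hM.symm)
  let b : N.E ≃ α := (Equiv.setCongr hN).trans (Equiv.Set.univ α)
  refine ⟨a.trans (g.trans b), fun I => ?_⟩
  have h1 : Subtype.val '' (a '' I) = I := by
    rw [← image_comp]; exact image_id I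
  have h2 : (a.trans (g.trans b)) '' I = Subtype.val '' (g '' (a '' I)) := by
    rw [← image_comp, ← image_comp]; rfl
  rw [h2, ← hg, h1]

variable [Finite α]

/-- Every pair of cyclic flats of which one contains just `e`, the other just `f`, fails to be
modular. -/
def SeparatedNonmodular (M : Matroid α) (e f : α) : Prop :=
  ∀ F ∈ cyclicFlats M, ∀ G ∈ cyclicFlats M, e ∈ F → f ∉ F → e ∉ G → f ∈ G →
    rk M (F ∪ G) + rk M (F ∩ G) < rk M F + rk M G

/-- If the inclusion failed, `F` and `G` would be separated by `e` and `f`, and `F ∩ G` would be `F`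
without one point. This intersection has the rank of the cyclic set `F`, so the pair could not be
nonmodular. -/
theorem SeparatedNonmodular.subset_of_shift_subset (h : SeparatedNonmodular M e f) (hef : e ≠ f)
    {F G : Set α} (hF : F ∈ cyclicFlats M) (hG : G ∈ cyclicFlats M)
    (hs : shift e f F ⊆ shift e f G) : F ⊆ G := by
  have : M.Finite := ⟨toFinite _⟩
  have hFc := ((mem_cyclicFlats_iff_rk (subset_ground_of_mem_cyclicFlats hF)).1 hF).2
  have hsub : ∀ x ∈ F, x ≠ e → x ≠ f → x ∈ G := fun x hx he hf =>
    (mem_shift_of_ne he hf).1 (hs ((mem_shift_of_ne he hf).2 hx))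
  have hE : e ∈ F ∨ f ∈ F → e ∈ G ∨ f ∈ G := fun h' => left_mem_shift.1 (hs (left_mem_shift.2 h'))
  have hEF : e ∈ F ∧ f ∈ F → e ∈ G ∧ f ∈ G := fun h' =>
    (right_mem_shift hef).1 (hs ((right_mem_shift hef).2 h'))
  have hcon : ∀ z ∈ F, F ∩ G = F \ {z} →
      rk M (F ∪ G) + rk M (F ∩ G) < rk M F + rk M G → False := by
    intro z hz hFG hlt
    rw [hFG, hFc z hz] at hlt
    have := rk_mono M (subset_union_right (s := F) (t := G))
    omega
  by_cases h1 : e ∈ F ∧ f ∉ F ∧ e ∉ G ∧ f ∈ G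
  · refine (hcon e h1.1 ?_ (h F hF G hG h1.1 h1.2.1 h1.2.2.1 h1.2.2.2)).elim
    ext x; simp only [mem_inter_iff, mem_sdiff, mem_singleton_iff]; grind
  by_cases h2 : e ∈ G ∧ f ∉ G ∧ e ∉ F ∧ f ∈ F
  · have h3 := h G hG F hF h2.1 h2.2.1 h2.2.2.1 h2.2.2.2
    rw [union_comm, inter_comm, add_comm (rk M G)] at h3
    refine (hcon f h2.2.2.2 ?_ h3).elim
    ext x; simp only [mem_inter_iff, mem_sdiff, mem_singleton_iff]; grind
  · intro x hx
    by_cases hxe : x = e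
    · subst hxe; grind
    by_cases hxf : x = f
    · subst hxf; grind
    · exact hsub x hx hxe hxf

/-- Sizes and ranks are kept and inclusions are reflected, so only submodularity is at stake. The
one element that a separated pair gains in its intersection is paid for by nonmodularity. -/
theorem SeparatedNonmodular.cyclicFlatAxioms (h : SeparatedNonmodular M e f) (hef : e ≠ f) :
    CyclicFlatAxioms (fun F : cyclicFlats M => shift e f F) (fun F => rk M (F : Set α)) where
  inj F G hFG := Subtype.ext (subset_antisymm
    (h.subset_of_shift_subset hef F.2 G.2 hFG.subset)
    (h.subset_of_shift_subset hef G.2 F.2 hFG.symm.subset))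
  zero := by
    have : M.Finite := ⟨toFinite _⟩
    refine ⟨⟨M.closure ∅, closure_mem_cyclicFlats fun x hx => hx.elim⟩, ?_⟩
    change rk M (M.closure ∅) = 0
    rw [rk_closure, rk, Matroid.eRk_empty]; rfl
  strict F G hGF := by
    have : M.Finite := ⟨toFinite _⟩
    have hlt : (G : Set α) ⊂ F := ⟨h.subset_of_shift_subset hef G.2 F.2 hGF.1,
      fun hFG => hGF.2 (shift_mono hFG)⟩
    simp only [ncard_shift hef]
    exact ⟨rk_lt_of_isFlat (mem_cyclicFlats.1 G.2).1 (subset_ground_of_mem_cyclicFlats F.2) hlt,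
      rk_add_lt_of_isCyclic (mem_cyclicFlats.1 F.2).2 hlt⟩
  submod := by
    have : M.Finite := ⟨toFinite _⟩
    rintro ⟨F, hF⟩ ⟨G, hG⟩
    have hFE := subset_ground_of_mem_cyclicFlats hF
    have hGE := subset_ground_of_mem_cyclicFlats hG
    refine ⟨⟨_, join_mem_cyclicFlats hF hG⟩, ⟨_, meet_mem_cyclicFlats hF hG⟩,
      union_subset (shift_mono ?_) (shift_mono ?_), subset_inter (shift_mono ?_) (shift_mono ?_),
      ?_⟩
    · exact subset_union_left.trans (M.subset_closure _ (union_subset hFE hGE))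
    · exact subset_union_right.trans (M.subset_closure _ (union_subset hFE hGE))
    · exact (cyclicPart_subset _ _).trans inter_subset_left
    · exact (cyclicPart_subset _ _).trans inter_subset_right
    · simp only [rk_closure]
      have h1 := rk_cyclicPart (M := M) (X := F ∩ G) (inter_subset_left.trans hFE)
      have h2 := ncard_sdiff_add_ncard_of_subset (cyclicPart_subset M (F ∩ G))
      have h3 := ncard_sdiff_add_ncard_of_subset (s := shift e f (cyclicPart M (F ∩ G)))
        (t := shift e f F ∩ shift e f G) (subset_inter
          (shift_mono ((cyclicPart_subset _ _).trans inter_subset_left))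
          (shift_mono ((cyclicPart_subset _ _).trans inter_subset_right)))
      rw [ncard_shift hef] at h3
      have h4 := rk_submod M F G
      by_cases hb : e ∈ F ∧ f ∉ F ∧ e ∉ G ∧ f ∈ G
      · have h5 := ncard_shift_inter_of_separated hef hb.1 hb.2.1 hb.2.2.1 hb.2.2.2
        have h6 := h F hF G hG hb.1 hb.2.1 hb.2.2.1 hb.2.2.2
        omega
      by_cases hb' : e ∈ G ∧ f ∉ G ∧ e ∉ F ∧ f ∈ F
      · have h5 := ncard_shift_inter_of_separated hef hb'.1 hb'.2.1 hb'.2.2.1 hb'.2.2.2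
        have h6 := h G hG F hF hb'.1 hb'.2.1 hb'.2.2.1 hb'.2.2.2
        rw [inter_comm, inter_comm G] at h5
        rw [union_comm, inter_comm G] at h6
        omega
      · have h5 := ncard_shift_inter_of_not_separated hef hb hb'
        omega

theorem rk_image_of_indep_iff {N : Matroid α} (π : α ≃ α)
    (h : ∀ I, M.Indep I ↔ N.Indep (π '' I)) (X : Set α) : rk N (π '' X) = rk M X := by
  have : M.Finite := ⟨toFinite _⟩
  have : N.Finite := ⟨toFinite _⟩
  apply le_antisymm
  · obtain ⟨I, hIX, hI, hIc⟩ := exists_indep_ncard N (π '' X)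
    obtain ⟨J, hJX, rfl⟩ := subset_image_iff.1 hIX
    rw [← hIc, ncard_image_of_injective _ π.injective]
    exact ncard_le_rk ((h J).2 hI) hJX
  · obtain ⟨I, hIX, hI, hIc⟩ := exists_indep_ncard M X
    rw [← hIc, ← ncard_image_of_injective I π.injective]
    exact ncard_le_rk ((h I).1 hI) (image_mono hIX)

theorem image_mem_cyclicFlats_iff {N : Matroid α} (hM : M.E = univ) (hN : N.E = univ) (π : α ≃ α)
    (h : ∀ I, M.Indep I ↔ N.Indep (π '' I)) (F : Set α) :
    π '' F ∈ cyclicFlats N ↔ F ∈ cyclicFlats M := by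
  have : M.Finite := ⟨toFinite _⟩
  have : N.Finite := ⟨toFinite _⟩
  rw [mem_cyclicFlats_iff_rk (by rw [hN]; exact subset_univ _),
    mem_cyclicFlats_iff_rk (by rw [hM]; exact subset_univ _), hM, hN]
  refine and_congr ⟨fun h1 x _ hx => ?_, fun h1 y _ hy => ?_⟩
    ⟨fun h1 x hx => ?_, ?_⟩
  · have := h1 (π x) (mem_univ _) (by simpa using hx)
    rwa [← image_insert_eq, rk_image_of_indep_iff π h, rk_image_of_indep_iff π h] at this
  · obtain ⟨x, rfl⟩ := π.surjective y
    rw [← image_insert_eq, rk_image_of_indep_iff π h, rk_image_of_indep_iff π h]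
    exact h1 x (mem_univ _) (by simpa using hy)
  · have := h1 (π x) (mem_image_of_mem _ hx)
    rwa [← image_singleton, ← image_sdiff π.injective, rk_image_of_indep_iff π h,
      rk_image_of_indep_iff π h] at this
  · rintro h1 _ ⟨x, hx, rfl⟩
    rw [← image_singleton, ← image_sdiff π.injective, rk_image_of_indep_iff π h,
      rk_image_of_indep_iff π h]
    exact h1 x hx

theorem not_configurationUnique_of_separatedNonmodular (hM : M.E = univ) (hef : e ≠ f)
    (h : SeparatedNonmodular M e f)
    (hex : ∃ F ∈ cyclicFlats M, e ∈ F ∧ f ∉ F) (hex' : ∃ G ∈ cyclicFlats M, e ∉ G ∧ f ∈ G) :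
    ¬ ConfigurationUnique M := by
  classical
  intro hu
  have : M.Finite := ⟨toFinite _⟩
  have hax := h.cyclicFlatAxioms hef
  have hN : hax.matroid.E = univ := rfl
  let φ : cyclicFlats M ≃o cyclicFlats hax.matroid :=
    { toEquiv := Equiv.ofBijective (fun F => ⟨shift e f F, hax.mem_cyclicFlats F⟩)
        ⟨fun F G hFG => hax.inj (congrArg Subtype.val hFG), fun G => by
          obtain ⟨F, hF⟩ := hax.exists_eq G.2
          exact ⟨F, Subtype.ext hF⟩⟩
      map_rel_iff' := by
        intro F G
        exact ⟨h.subset_of_shift_subset hef F.2 G.2, fun h' => shift_mono h'⟩ }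
  have hφ : ∀ F, (φ F : Set α) = shift e f F := fun F => rfl
  have hconf : SameConfiguration M hax.matroid := by
    refine ⟨by rw [hM, hN], φ, fun F => ⟨?_, ?_⟩⟩
    · rw [hφ, ← (toFinite _).cast_ncard_eq, ← (toFinite _).cast_ncard_eq, ncard_shift hef]
    · rw [← cast_rk, ← cast_rk, hφ]
      congr 1
      exact (hax.rk_eq F).symm
  obtain ⟨π, hπ⟩ := (hu α hax.matroid inferInstance hconf).exists_equiv hM hN
  let ψ : cyclicFlats M ≃ cyclicFlats hax.matroid := Equiv.ofBijective
    (fun F => ⟨π '' F, (image_mem_cyclicFlats_iff hM hN π hπ F).2 F.2⟩)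
    ⟨fun F G hFG => Subtype.ext (π.injective.image_injective (congrArg Subtype.val hFG)),
      fun G => ⟨⟨π ⁻¹' G, (image_mem_cyclicFlats_iff hM hN π hπ _).1
        (by rw [image_preimage_eq _ π.surjective]; exact G.2)⟩,
        Subtype.ext (image_preimage_eq _ π.surjective)⟩⟩
  have hψ : ∀ F, (ψ F : Set α) = π '' F := fun F => rfl
  have := Fintype.ofFinite (cyclicFlats M)
  have := Fintype.ofFinite (cyclicFlats hax.matroid)
  -- The sum of `|F ∩ G|` over all pairs of cyclic flats is an isomorphism invariant, but the shift
  -- lowers no summand and raises the one of a separated pair.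
  have h1 : ∑ F : cyclicFlats hax.matroid, ∑ G : cyclicFlats hax.matroid,
      ((F : Set α) ∩ G).ncard = ∑ F : cyclicFlats M, ∑ G : cyclicFlats M,
      ((F : Set α) ∩ G).ncard := by
    rw [← ψ.sum_comp]
    refine Finset.sum_congr rfl fun F _ => ?_
    rw [← ψ.sum_comp]
    refine Finset.sum_congr rfl fun G _ => ?_
    rw [hψ, hψ, ← image_inter π.injective, ncard_image_of_injective _ π.injective]
  have h2 : ∑ F : cyclicFlats M, ∑ G : cyclicFlats M, ((F : Set α) ∩ G).ncard <
      ∑ F : cyclicFlats hax.matroid, ∑ G : cyclicFlats hax.matroid, ((F : Set α) ∩ G).ncard := by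
    rw [← φ.toEquiv.sum_comp]
    obtain ⟨F₀, hF₀, h3, h4⟩ := hex
    obtain ⟨G₀, hG₀, h5, h6⟩ := hex'
    have hle : ∀ F G : cyclicFlats M, ((F : Set α) ∩ G).ncard ≤
        ((φ.toEquiv F : Set α) ∩ φ.toEquiv G).ncard := fun F G => ncard_inter_le_shift hef
    refine Finset.sum_lt_sum (fun F _ => ?_) ⟨⟨F₀, hF₀⟩, Finset.mem_univ _, ?_⟩
    · rw [← φ.toEquiv.sum_comp]
      exact Finset.sum_le_sum fun G _ => hle F G
    · rw [← φ.toEquiv.sum_comp]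
      refine Finset.sum_lt_sum (fun G _ => hle _ G) ⟨⟨G₀, hG₀⟩, Finset.mem_univ _, ?_⟩
      have := ncard_shift_inter_of_separated hef h3 h4 h5 h6
      change (F₀ ∩ G₀).ncard < (shift e f F₀ ∩ shift e f G₀).ncard
      omega
  omega

end NonUnique

end LPM

namespace LPM

open Set

/-! ### Set systems with equal intersection sizes -/

section Venn

variable {α β : Type} {κ : Type*} [Finite α] [Finite β]

/-- Two families of finite sets with equally large intersections differ by a bijection. -/
theorem exists_equiv_of_ncard_iInter_eq [Finite κ] (A : κ → Set α) (B : κ → Set β)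
    (h : ∀ S : Set κ, {x | ∀ i ∈ S, x ∈ A i}.ncard = {y | ∀ i ∈ S, y ∈ B i}.ncard) :
    ∃ g : α ≃ β, ∀ i x, x ∈ A i ↔ g x ∈ B i := by
  classical
  -- Excluded sets are introduced one at a time: the points outside `D t` are all points minus those
  -- inside.
  have key : ∀ T : Set κ, T.Finite → ∀ S : Set κ,
      {x | (∀ i ∈ S, x ∈ A i) ∧ ∀ i ∈ T, x ∉ A i}.ncard =
        {y | (∀ i ∈ S, y ∈ B i) ∧ ∀ i ∈ T, y ∉ B i}.ncard := by
    intro T hT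
    induction T, hT using Set.Finite.induction_on with
    | empty => simpa using h
    | @insert t T _ _ ih =>
      intro S
      have e : ∀ {γ : Type} [Finite γ] (D : κ → Set γ),
          {x | (∀ i ∈ S, x ∈ D i) ∧ ∀ i ∈ insert t T, x ∉ D i}.ncard +
            {x | (∀ i ∈ insert t S, x ∈ D i) ∧ ∀ i ∈ T, x ∉ D i}.ncard =
            {x | (∀ i ∈ S, x ∈ D i) ∧ ∀ i ∈ T, x ∉ D i}.ncard := by
        intro γ _ D
        rw [← ncard_inter_add_ncard_sdiff_eq_ncard
          {x | (∀ i ∈ S, x ∈ D i) ∧ ∀ i ∈ T, x ∉ D i} (D t), add_comm]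
        congr 2
        · ext x; simp; tauto
        · ext x; simp; tauto
      have e1 := e A
      have e2 := e B
      have e3 := ih S
      have e4 := ih (insert t S)
      omega
  -- The cells of the two Venn diagrams, indexed by the set `c` of members through a point, have
  -- equal sizes; bijections of the cells glue together.
  have hfib : ∀ c : Set κ, Nonempty ({x : α // {i | x ∈ A i} = c} ≃ {y : β // {i | y ∈ B i} = c}) := by
    intro c
    have h1 := key cᶜ (toFinite _) c
    have e : ∀ {γ : Type} (D : κ → Set γ),
        {x | (∀ i ∈ c, x ∈ D i) ∧ ∀ i ∈ cᶜ, x ∉ D i} = {x | {i | x ∈ D i} = c} := by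
      intro γ D
      ext x
      constructor
      · rintro ⟨h2, h3⟩
        ext i
        exact ⟨fun hi => by_contra fun hc => h3 i hc hi, fun hi => h2 i hi⟩
      · intro h2
        have h2' : {i | x ∈ D i} = c := h2
        rw [← h2']
        exact ⟨fun i hi => hi, fun i hi => hi⟩
    rw [e, e] at h1
    exact (Finite.card_eq.1 h1)
  let g := Equiv.ofFiberEquiv fun c => (hfib c).some
  refine ⟨g, fun i x => ?_⟩
  have : {i | g x ∈ B i} = {i | x ∈ A i} :=
    Equiv.ofFiberEquiv_map (f := fun x => {i | x ∈ A i}) (g := fun y => {i | y ∈ B i}) _ x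
  have h2 := congrArg (i ∈ ·) this
  exact (iff_of_eq h2).symm

end Venn

/-! ### Configurations that determine the matroid -/

section Unique

variable {α β : Type} [Finite α] {M : Matroid α} {N : Matroid β}

/-- The isomorphism respects meets and joins, and `rk (F ∩ G)` is the rank of the meet plus the
number of remaining elements of `F ∩ G`. Submodularity in `N` therefore bounds `|φ F ∩ φ G|`, and
modularity in `M` turns the bound into `|F ∩ G|`. -/
theorem ncard_inter_le_of_modular [N.Finite] (φ : cyclicFlats M ≃o cyclicFlats N)
    (hsz : ∀ F, (φ F : Set β).ncard = (F : Set α).ncard)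
    (hrk : ∀ F, rk N (φ F : Set β) = rk M (F : Set α)) (F G : cyclicFlats M)
    (hmod : rk M F + rk M G ≤ rk M (F ∪ G : Set α) + rk M (F ∩ G : Set α)) :
    ((φ F : Set β) ∩ φ G).ncard ≤ ((F : Set α) ∩ G).ncard := by
  have : M.Finite := ⟨toFinite _⟩
  have hFE := subset_ground_of_mem_cyclicFlats F.2
  have hGE := subset_ground_of_mem_cyclicFlats G.2
  have hFE' := subset_ground_of_mem_cyclicFlats (φ F).2
  have hGE' := subset_ground_of_mem_cyclicFlats (φ G).2
  let K : cyclicFlats M := ⟨_, meet_mem_cyclicFlats F.2 G.2⟩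
  let L : cyclicFlats M := ⟨_, join_mem_cyclicFlats F.2 G.2⟩
  let K' : cyclicFlats N := ⟨_, meet_mem_cyclicFlats (φ F).2 (φ G).2⟩
  let L' : cyclicFlats N := ⟨_, join_mem_cyclicFlats (φ F).2 (φ G).2⟩
  have hKF : K ≤ F := (cyclicPart_subset _ _).trans inter_subset_left
  have hKG : K ≤ G := (cyclicPart_subset _ _).trans inter_subset_right
  have hKF' : K' ≤ φ F := (cyclicPart_subset _ _).trans inter_subset_left
  have hKG' : K' ≤ φ G := (cyclicPart_subset _ _).trans inter_subset_right
  have hFL : F ≤ L := subset_union_left.trans (M.subset_closure _ (union_subset hFE hGE))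
  have hGL : G ≤ L := subset_union_right.trans (M.subset_closure _ (union_subset hFE hGE))
  have hFL' : φ F ≤ L' := subset_union_left.trans (N.subset_closure _ (union_subset hFE' hGE'))
  have hGL' : φ G ≤ L' := subset_union_right.trans (N.subset_closure _ (union_subset hFE' hGE'))
  have hK : φ K = K' := by
    apply le_antisymm
    · exact (mem_cyclicFlats.1 (φ K).2).2.subset_cyclicPart
        (subset_inter (φ.monotone hKF) (φ.monotone hKG))
    · rw [← φ.symm_apply_le]
      exact (mem_cyclicFlats.1 (φ.symm K').2).2.subset_cyclicPart
        (subset_inter (φ.symm_apply_le.2 hKF') (φ.symm_apply_le.2 hKG'))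
  have hL : φ L = L' := by
    apply le_antisymm
    · rw [← φ.le_symm_apply]
      change M.closure _ ⊆ _
      refine (M.closure_subset_closure (union_subset (φ.le_symm_apply.2 hFL')
        (φ.le_symm_apply.2 hGL'))).trans_eq ?_
      exact (mem_cyclicFlats.1 (φ.symm L').2).1.closure
    · change N.closure _ ⊆ _
      exact (N.closure_subset_closure (union_subset (φ.monotone hFL)
        (φ.monotone hGL))).trans_eq (mem_cyclicFlats.1 (φ L).2).1.closure
  have h1 : rk N (K' : Set β) = rk M (K : Set α) := by rw [← hK, hrk]
  have h2 : (K' : Set β).ncard = (K : Set α).ncard := by rw [← hK, hsz]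
  have h3 : rk N (φ F ∪ φ G : Set β) = rk M (F ∪ G : Set α) := by
    rw [← rk_closure N, ← rk_closure M]
    exact (congrArg (fun Z : cyclicFlats N => rk N (Z : Set β)) hL.symm).trans (hrk L)
  have h4 := rk_cyclicPart (M := M) (X := F ∩ G) (inter_subset_left.trans hFE)
  have h5 := rk_cyclicPart (M := N) (X := φ F ∩ φ G) (inter_subset_left.trans hFE')
  have h6 := rk_submod N (φ F) (φ G)
  have h7 := ncard_sdiff_add_ncard_of_subset (cyclicPart_subset M (F ∩ G))
  have h8 := ncard_sdiff_add_ncard_of_subset (cyclicPart_subset N (φ F ∩ φ G))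
    (N.ground_finite.subset (inter_subset_left.trans hFE'))
  have h9 := rk_le_ncard M (X := F ∩ G) (toFinite _)
  have h10 := hrk F
  have h11 := hrk G
  change rk N (cyclicPart N _) = rk M (cyclicPart M _) at h1
  change (cyclicPart N _).ncard = (cyclicPart M _).ncard at h2
  omega

/-- A matroid whose cyclic flats are controlled by two chains of cyclic flats, the pairs of which
are modular and either disjoint or covering, is determined by its configuration. -/
theorem configurationUnique_of_chains (hM : M.E = univ) (𝓘 𝓙 : Set (Set α))
    (h𝓘 : 𝓘 ⊆ cyclicFlats M) (h𝓙 : 𝓙 ⊆ cyclicFlats M)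
    (hc : IsChain (· ⊆ ·) 𝓘) (hc' : IsChain (· ⊆ ·) 𝓙)
    (hmod : ∀ I ∈ 𝓘, ∀ J ∈ 𝓙, rk M I + rk M J ≤ rk M (I ∪ J) + rk M (I ∩ J))
    (hdisj : ∀ I ∈ 𝓘, ∀ J ∈ 𝓙, Disjoint I J ∨ I ∪ J = univ)
    (hinter : ∀ F ∈ cyclicFlats M, ∀ x ∉ F, ∃ I ∈ 𝓘, ∃ J ∈ 𝓙,
      I ∪ J ∈ cyclicFlats M ∧ F ⊆ I ∪ J ∧ x ∉ I ∪ J) :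
    ConfigurationUnique M := by
  classical
  rintro β N hN ⟨hE, φ, hφ⟩
  have : M.Finite := ⟨toFinite _⟩
  have : Finite N.E := N.ground_finite
  have hsub : ∀ F, (φ F : Set β) ⊆ N.E := fun F => subset_ground_of_mem_cyclicFlats (φ F).2
  have hfin : ∀ F, (φ F : Set β).Finite := fun F => N.ground_finite.subset (hsub F)
  have hsz : ∀ F, (φ F : Set β).ncard = (F : Set α).ncard := fun F => by
    rw [ncard_def, ncard_def, (hφ F).1]
  have hrk : ∀ F, rk N (φ F : Set β) = rk M (F : Set α) := fun F => by
    rw [rk, rk, (hφ F).2]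
  have hEn : N.E.ncard = Nat.card α := by
    rw [ncard_def, ← hE, hM, ← ncard_def, ncard_univ]
  have hIJ : ∀ F G : cyclicFlats M, (F : Set α) ∈ 𝓘 → (G : Set α) ∈ 𝓙 →
      ((φ F : Set β) ∩ φ G).ncard = ((F : Set α) ∩ G).ncard := by
    intro F G hF hG
    refine le_antisymm (ncard_inter_le_of_modular φ hsz hrk F G (hmod _ hF _ hG)) ?_
    -- The lower bound is trivial for a disjoint pair. For a covering pair it holds because `φ F ∪ φ
    -- G` cannot exceed the ground set of `N`, which has the size of `α`.
    rcases hdisj _ hF _ hG with hd | hu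
    · rw [hd.inter_eq]; simp
    · have h1 := ncard_union_add_ncard_inter (F : Set α) G
      have h2 := ncard_union_add_ncard_inter (φ F : Set β) (φ G) (hfin F) (hfin G)
      have h3 := ncard_le_ncard (union_subset (hsub F) (hsub G)) N.ground_finite
      rw [hu, ncard_univ] at h1
      rw [hsz, hsz] at h2
      omega
  have hleast : ∀ 𝓒 : Set (Set α), IsChain (· ⊆ ·) 𝓒 → ∀ P : cyclicFlats M → Prop,
      (∀ F, P F → (F : Set α) ∈ 𝓒) → (∀ F, ¬ P F) ∨ ∃ F, P F ∧ ∀ G, P G → F ≤ G := by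
    intro 𝓒 h𝓒 P hS
    rcases {F | P F}.eq_empty_or_nonempty with h | h
    · exact Or.inl (eq_empty_iff_forall_notMem.1 h)
    · obtain ⟨F, hF⟩ := (toFinite {F | P F}).exists_minimal h
      refine Or.inr ⟨F, hF.1, fun G hG => ?_⟩
      rcases h𝓒.total (hS F hF.1) (hS G hG) with h1 | h1
      · exact h1
      · exact hF.2 hG h1
  let κ := {F : cyclicFlats M // (F : Set α) ∈ 𝓘 ∨ (F : Set α) ∈ 𝓙}
  have hpre : ∀ X : Set β, X ⊆ N.E → (Subtype.val ⁻¹' X : Set N.E).ncard = X.ncard := by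
    intro X hX
    rw [← ncard_image_of_injective _ Subtype.val_injective, Subtype.image_preimage_coe,
      inter_eq_right.2 hX]
  -- In a chain a nonempty subfamily intersects in its least member. So every intersection of
  -- members of the two chains is the whole set, a single flat or some `F ∩ G`, and all these sizes
  -- agree.
  obtain ⟨g, hg⟩ := exists_equiv_of_ncard_iInter_eq (κ := κ) (fun F => (F.1 : Set α))
    (fun F => (Subtype.val ⁻¹' (φ F.1 : Set β) : Set N.E)) (by
      intro S
      have hS : ∀ (γ : Type) (D : cyclicFlats M → Set γ), {x | ∀ F ∈ S, x ∈ D F.1} =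
          {x | ∀ F : cyclicFlats M, ((F : Set α) ∈ 𝓘 ∧ ∃ h, (⟨F, h⟩ : κ) ∈ S) → x ∈ D F} ∩
          {x | ∀ F : cyclicFlats M, ((F : Set α) ∈ 𝓙 ∧ ∃ h, (⟨F, h⟩ : κ) ∈ S) → x ∈ D F} := by
        intro γ D
        ext x
        constructor
        · exact fun h => ⟨fun F hF => h _ hF.2.2, fun F hF => h _ hF.2.2⟩
        · rintro ⟨h1, h2⟩ ⟨F, hF⟩ hFS
          rcases hF with hF' | hF'
          · exact h1 F ⟨hF', _, hFS⟩
          · exact h2 F ⟨hF', _, hFS⟩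
      have hmin : ∀ (γ : Type) (D : cyclicFlats M → Set γ) (P : cyclicFlats M → Prop)
          (F : cyclicFlats M), P F → (∀ G, P G → D F ⊆ D G) → {x | ∀ G, P G → x ∈ D G} = D F :=
        fun γ D P F hF h => subset_antisymm (fun x hx => hx F hF) fun x hx G hG => h G hG hx
      rw [hS α (fun F => (F : Set α)),
        hS N.E (fun F => (Subtype.val ⁻¹' (φ F : Set β) : Set N.E))]
      have hmono : ∀ F G : cyclicFlats M, F ≤ G →
          (Subtype.val ⁻¹' (φ F : Set β) : Set N.E) ⊆ Subtype.val ⁻¹' (φ G : Set β) :=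
        fun F G h => preimage_mono (φ.monotone h)
      rcases hleast 𝓘 hc (fun F => (F : Set α) ∈ 𝓘 ∧ ∃ h, (⟨F, h⟩ : κ) ∈ S) (fun F h => h.1)
        with h1 | ⟨F, hF, hFl⟩ <;>
      rcases hleast 𝓙 hc' (fun F => (F : Set α) ∈ 𝓙 ∧ ∃ h, (⟨F, h⟩ : κ) ∈ S) (fun F h => h.1)
        with h2 | ⟨G, hG, hGl⟩
      · simp only [h1, h2, false_imp_iff, implies_true, ofPred_true, univ_inter, ncard_univ]
        rw [← hEn]; rfl
      · simp only [h1, false_imp_iff, implies_true, ofPred_true, univ_inter]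
        rw [hmin α _ _ G hG hGl, hmin N.E _ _ G hG (fun H hH => hmono _ _ (hGl H hH)),
          hpre _ (hsub G), hsz]
      · simp only [h2, false_imp_iff, implies_true, ofPred_true, inter_univ]
        rw [hmin α _ _ F hF hFl, hmin N.E _ _ F hF (fun H hH => hmono _ _ (hFl H hH)),
          hpre _ (hsub F), hsz]
      · rw [hmin α _ _ F hF hFl, hmin N.E _ _ F hF (fun H hH => hmono _ _ (hFl H hH)),
          hmin α _ _ G hG hGl, hmin N.E _ _ G hG (fun H hH => hmono _ _ (hGl H hH)),
          ← preimage_inter, hpre _ (inter_subset_left.trans (hsub F)), hIJ F G hF.1 hG.1])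
  have hinj : Function.Injective (fun x => (g x : β)) := Subtype.val_injective.comp g.injective
  have hchain : ∀ F : cyclicFlats M, (F : Set α) ∈ 𝓘 ∨ (F : Set α) ∈ 𝓙 →
      (fun x => (g x : β)) '' F = φ F := by
    intro F hF
    ext y
    constructor
    · rintro ⟨x, hx, rfl⟩
      exact (hg ⟨F, hF⟩ x).1 hx
    · intro hy
      refine ⟨g.symm ⟨y, hsub F hy⟩, (hg ⟨F, hF⟩ _).2 ?_, by simp⟩
      simpa using hy
  have hunion : ∀ (I J : Set α), I ∈ 𝓘 → J ∈ 𝓙 → ∀ h : I ∪ J ∈ cyclicFlats M,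
      (fun x => (g x : β)) '' (I ∪ J) = φ ⟨I ∪ J, h⟩ := by
    intro I J hI hJ h
    refine eq_of_subset_of_ncard_le ?_ ?_ (hfin _)
    · rw [image_union, hchain ⟨I, h𝓘 hI⟩ (Or.inl hI), hchain ⟨J, h𝓙 hJ⟩ (Or.inr hJ)]
      refine union_subset (φ.monotone ?_) (φ.monotone ?_)
      · exact (subset_union_left : I ⊆ I ∪ J)
      · exact (subset_union_right : J ⊆ I ∪ J)
    · rw [hsz, ncard_image_of_injective _ hinj]
  -- A cyclic flat is an intersection of unions `I ∪ J` on which `g` is known to induce `φ`. This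
  -- puts `φ F` inside the image of `F`, and the sizes give equality.
  have hall : ∀ F : cyclicFlats M, (fun x => (g x : β)) '' F = φ F := by
    intro F
    refine (eq_of_subset_of_ncard_le ?_ ?_ ((toFinite _).image _)).symm
    · intro y hy
      refine ⟨g.symm ⟨y, hsub F hy⟩, ?_, by simp⟩
      by_contra hx
      obtain ⟨I, hI, J, hJ, hIJ, hF, hxIJ⟩ := hinter F F.2 _ hx
      have h1 : (φ F : Set β) ⊆ φ ⟨I ∪ J, hIJ⟩ := φ.monotone hF
      obtain ⟨z, hz, hzy⟩ := (hunion I J hI hJ hIJ).symm ▸ h1 hy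
      have : g z = ⟨y, hsub F hy⟩ := Subtype.ext hzy
      rw [← this, g.symm_apply_apply] at hxIJ
      exact hxIJ hz
    · rw [hsz, ncard_image_of_injective _ hinj]
  refine ⟨(Equiv.setCongr hM).trans ((Equiv.Set.univ α).trans g), fun I => ?_⟩
  have h1 : Subtype.val '' (((Equiv.setCongr hM).trans ((Equiv.Set.univ α).trans g)) '' I) =
      (fun x => (g x : β)) '' (Subtype.val '' I) := by
    rw [← image_comp, ← image_comp]; rfl
  rw [h1, indep_iff_cyclicFlats (by simp), indep_iff_cyclicFlats
    (by rintro _ ⟨x, -, rfl⟩; exact (g x).2)]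
  have h2 : ∀ F : cyclicFlats M, (((fun x => (g x : β)) '' (Subtype.val '' I)) ∩ φ F).ncard =
      ((Subtype.val '' I) ∩ (F : Set α)).ncard := by
    intro F
    rw [← hall, ← image_inter hinj, ncard_image_of_injective _ hinj]
  constructor
  · intro h F hF
    obtain ⟨F', hF'⟩ := φ.surjective ⟨F, hF⟩
    have h3 := h F' F'.2
    rwa [← hrk, ← h2, hF'] at h3
  · intro h F hF
    have h3 := h _ (φ ⟨F, hF⟩).2
    rw [hrk, h2] at h3
    exact h3

end Unique

end LPM

namespace LPM

open Set

/-! ### Rank and cyclic flats of transversal matroids -/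

section TransversalRank

variable {α ι : Type*} {A : ι → Set α} {X Y I J : Set α} {x y : α}

/-- The indices of the members of a set system that meet `X`. -/
def nbr (A : ι → Set α) (X : Set α) : Set ι := {k | (A k ∩ X).Nonempty}

theorem nbr_mono (h : X ⊆ Y) : nbr A X ⊆ nbr A Y :=
  fun _ hk => hk.mono (inter_subset_inter_right _ h)

theorem nbr_union (A : ι → Set α) (X Y : Set α) : nbr A (X ∪ Y) = nbr A X ∪ nbr A Y := by
  ext k
  simp only [nbr, inter_union_distrib_left, union_nonempty]
  rfl

variable [Finite α]

instance (A : ι → Set α) : (transversalMatroid A).Finite := ⟨toFinite _⟩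

theorem rk_le_ncard_nbr [Finite ι] (A : ι → Set α) (X : Set α) :
    rk (transversalMatroid A) X ≤ (nbr A X).ncard := by
  obtain ⟨I, hIX, hI, hIc⟩ := exists_indep_ncard (transversalMatroid A) X
  rw [← hIc]
  obtain ⟨f, hf, hfA⟩ := hI
  rw [← Nat.card_coe_set_eq, ← Nat.card_coe_set_eq]
  exact Nat.card_le_card_of_injective (fun x : I => (⟨f x, x, hfA x, hIX x.2⟩ : nbr A X))
    fun x y hxy => hf (congrArg Subtype.val hxy)

/-- The rank formula for transversal matroids. -/
theorem exists_nbr_add_le_rk [Finite ι] (A : ι → Set α) (X : Set α) :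
    ∃ Y ⊆ X, (nbr A Y).ncard + (X \ Y).ncard ≤ rk (transversalMatroid A) X := by
  classical
  have := Fintype.ofFinite ι
  -- `Y` has the greatest deficiency `d`. After `d` dummy members containing every element are
  -- added, Hall's condition holds on `X`; the elements matched to genuine members are independent,
  -- and at most `d` are left out.
  obtain ⟨Y, hYX, hY⟩ := Set.exists_max_image (𝒫 X)
    (fun Y => (Y.ncard : ℤ) - (nbr A Y).ncard) (toFinite _) ⟨∅, empty_subset X⟩
  have hY : ∀ Z ⊆ X, (Z.ncard : ℤ) - (nbr A Z).ncard ≤ Y.ncard - (nbr A Y).ncard :=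
    fun Z hZ => hY Z hZ
  have hd : ∃ d : ℕ, Y.ncard = (nbr A Y).ncard + d := by
    have := hY ∅ (empty_subset X)
    have h0 : nbr A ∅ = ∅ := by ext; simp [nbr]
    rw [h0] at this
    simp only [ncard_empty] at this
    exact ⟨Y.ncard - (nbr A Y).ncard, by omega⟩
  obtain ⟨d, hd⟩ := hd
  let t : X → Finset (ι ⊕ Fin d) := fun x =>
    (Finset.univ.filter fun k => (x : α) ∈ A k).disjSum Finset.univ
  have hall : ∀ s : Finset X, s.card ≤ (s.biUnion t).card := by
    intro s
    rcases s.eq_empty_or_nonempty with rfl | ⟨x₀, hx₀⟩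
    · simp
    have h1 : (nbr A (Subtype.val '' (s : Set X))).toFinset.disjSum Finset.univ ⊆ s.biUnion t := by
      rintro (k | j) hz
      · rw [Finset.inl_mem_disjSum, mem_toFinset] at hz
        obtain ⟨_, hx, ⟨x, hxs, rfl⟩⟩ := hz
        exact Finset.mem_biUnion.2 ⟨x, hxs, by simpa [t] using hx⟩
      · exact Finset.mem_biUnion.2 ⟨x₀, hx₀, by simp [t]⟩
    have h2 := Finset.card_le_card h1
    rw [Finset.card_disjSum, Finset.card_univ, Fintype.card_fin, ← ncard_eq_toFinset_card'] at h2
    have h3 := hY (Subtype.val '' (s : Set X)) (by rintro _ ⟨x, -, rfl⟩; exact x.2)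
    rw [ncard_image_of_injective _ Subtype.val_injective, ncard_coe_finset] at h3
    omega
  obtain ⟨f, hf, hft⟩ := (Finset.all_card_le_biUnion_card_iff_exists_injective t).1 hall
  refine ⟨Y, hYX, ?_⟩
  let I : Set α := {x | ∃ (h : x ∈ X) (k : ι), f ⟨x, h⟩ = Sum.inl k}
  have hIX : I ⊆ X := fun x hx => hx.1
  have hI : (transversalMatroid A).Indep I := by
    have hk : ∀ x : I, ∃ k, f ⟨x, x.2.1⟩ = Sum.inl k := fun x => x.2.2
    choose g hg using hk
    refine ⟨g, fun x y hxy => ?_, fun x => ?_⟩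
    · have := hf ((hg x).trans ((congrArg Sum.inl hxy).trans (hg y).symm))
      exact Subtype.ext (Subtype.mk.inj this)
    · have := hft ⟨x, x.2.1⟩
      rw [hg] at this
      simpa [t] using this
  have h1 := ncard_le_rk hI hIX
  have h2 : (X \ I).ncard ≤ d := by
    have hk : ∀ x : (X \ I : Set α), ∃ j, f ⟨x, x.2.1⟩ = Sum.inr j := by
      intro x
      rcases hz : f ⟨x, x.2.1⟩ with k | j
      · exact (x.2.2 ⟨x.2.1, k, hz⟩).elim
      · exact ⟨j, rfl⟩
    choose g hg using hk
    rw [← Nat.card_coe_set_eq, ← Nat.card_fin d]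
    refine Nat.card_le_card_of_injective g fun x y hxy => ?_
    have := hf ((hg x).trans ((congrArg Sum.inr hxy).trans (hg y).symm))
    exact Subtype.ext (Subtype.mk.inj this)
  have h3 := ncard_sdiff_add_ncard_of_subset hIX
  have h4 := ncard_sdiff_add_ncard_of_subset hYX
  omega

/-- In the rank formula no element of a cyclic `X` can remain outside `Y`, since its deletion would
lower the rank. -/
theorem rk_eq_ncard_nbr [Finite ι] (hX : IsCyclic (transversalMatroid A) X) :
    rk (transversalMatroid A) X = (nbr A X).ncard := by
  refine le_antisymm (rk_le_ncard_nbr A X) ?_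
  obtain ⟨Y, hYX, hY⟩ := exists_nbr_add_le_rk A X
  have hXY : X ⊆ Y := by
    intro x hx
    by_contra hxY
    have h1 := (isCyclic_iff_rk (subset_univ X)).1 hX x hx
    have h2 := ncard_sdiff_singleton_add_one (s := X \ Y) ⟨hx, hxY⟩
    have h3 : X \ {x} = Y ∪ (X \ Y) \ {x} := by
      ext z; simp only [mem_union, mem_sdiff, mem_singleton_iff]
      constructor
      · rintro ⟨h4, h5⟩
        by_cases hz : z ∈ Y
        · exact Or.inl hz
        · exact Or.inr ⟨⟨h4, hz⟩, h5⟩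
      · rintro (h4 | ⟨⟨h4, -⟩, h5⟩)
        · exact ⟨hYX h4, fun h => hxY (h ▸ h4)⟩
        · exact ⟨h4, h5⟩
    have h4 := rk_union_le (transversalMatroid A) Y ((X \ Y) \ {x})
    have h5 := rk_le_ncard_nbr A Y
    have h6 := rk_le_ncard (transversalMatroid A) (X := (X \ Y) \ {x}) (toFinite _)
    rw [← h3] at h4
    omega
  rw [subset_antisymm hYX hXY, sdiff_self] at hY
  simpa [subset_antisymm hYX hXY] using hY

/-- If `x` were the only element of `X` in `A k`, its deletion would lose the neighbour `k`, and
with it rank. -/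
theorem IsCyclic.exists_ne_mem [Finite ι] (hX : IsCyclic (transversalMatroid A) X) {k : ι}
    (hx : x ∈ A k) (hxX : x ∈ X) : ∃ y ∈ A k, y ∈ X ∧ y ≠ x := by
  by_contra! hcon
  have h1 := (isCyclic_iff_rk (subset_univ X)).1 hX x hxX
  have h2 := rk_le_ncard_nbr A (X \ {x})
  have h3 : nbr A (X \ {x}) ⊂ nbr A X := by
    refine (ssubset_iff_of_subset (nbr_mono sdiff_subset)).2 ⟨k, ⟨x, hx, hxX⟩, ?_⟩
    rintro ⟨y, hy, hyX, hyx⟩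
    exact hyx (hcon y hy hyX)
  have h4 := ncard_lt_ncard h3
  rw [rk_eq_ncard_nbr hX] at h1
  omega

/-- Adding `y` raises the rank above the number of neighbours of `I`, so `y` brings a new neighbour.
-/
theorem exists_mem_disjoint_of_mem_cyclicFlats [Finite ι]
    (hI : I ∈ cyclicFlats (transversalMatroid A)) (hy : y ∉ I) :
    ∃ m, y ∈ A m ∧ Disjoint (A m) I := by
  have h1 := ((mem_cyclicFlats_iff_rk (subset_univ I)).1 hI).1 y (mem_univ y) hy
  rw [rk_eq_ncard_nbr (mem_cyclicFlats.1 hI).2] at h1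
  obtain ⟨m, hm, hmI⟩ := exists_mem_notMem_of_ncard_lt_ncard
    (h1.trans_le (rk_le_ncard_nbr A (insert y I)))
  have hd : Disjoint (A m) I := by
    rw [disjoint_iff_inter_eq_empty]; exact not_nonempty_iff_eq_empty.1 hmI
  obtain ⟨z, hz, rfl | hzI⟩ := hm
  · exact ⟨m, hz, hd⟩
  · exact (disjoint_left.1 hd hz hzI).elim

theorem rk_union_add_rk_inter_lt [Finite ι] (hI : IsCyclic (transversalMatroid A) I)
    (hJ : IsCyclic (transversalMatroid A) J)
    (h : rk (transversalMatroid A) (I ∩ J) < (nbr A I ∩ nbr A J).ncard) :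
    rk (transversalMatroid A) (I ∪ J) + rk (transversalMatroid A) (I ∩ J) <
      rk (transversalMatroid A) I + rk (transversalMatroid A) J := by
  have h1 := rk_le_ncard_nbr A (I ∪ J)
  have h2 := ncard_union_add_ncard_inter (nbr A I) (nbr A J)
  rw [rk_eq_ncard_nbr hI, rk_eq_ncard_nbr hJ]
  rw [nbr_union] at h1
  omega

end TransversalRank

end LPM

namespace LPM

open Set

/-! ### Ranks and flats from explicit matchings -/

section Matching

variable {α ι : Type*} [Finite α] {A : ι → Set α} {X : Set α} {S : Set ι} {w : ι → α}

theorem ncard_le_rk_of_injOn (hw : InjOn w S) (hA : ∀ k ∈ S, w k ∈ A k) (hX : ∀ k ∈ S, w k ∈ X) :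
    S.ncard ≤ rk (transversalMatroid A) X := by
  have hi : (transversalMatroid A).Indep (w '' S) := by
    have h : ∀ x : (w '' S : Set α), ∃ k ∈ S, w k = x := fun x => x.2
    choose f hf hfw using h
    refine ⟨f, fun x y hxy => Subtype.ext ?_, fun x => ?_⟩
    · rw [← hfw x, ← hfw y, hxy]
    · have := hA (f x) (hf x)
      rwa [hfw] at this
  rw [← hw.ncard_image]
  refine ncard_le_rk hi ?_
  rintro _ ⟨k, hk, rfl⟩
  exact hX k hk

variable [Finite ι]

theorem rk_lt_rk_insert_of_matching {z : α} {k : ι} (hw : InjOn w S) (hA : ∀ k ∈ S, w k ∈ A k)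
    (hX : ∀ k ∈ S, w k ∈ X) (hS : nbr A X ⊆ S) (hz : z ∉ X) (hk : k ∉ S) (hzk : z ∈ A k) :
    rk (transversalMatroid A) X < rk (transversalMatroid A) (insert z X) := by
  classical
  have h1 := (rk_le_ncard_nbr A X).trans (ncard_le_ncard hS)
  have hne : ∀ j ∈ S, j ≠ k := fun j hj h => hk (h ▸ hj)
  have h2 : (insert k S).ncard ≤ rk (transversalMatroid A) (insert z X) := by
    refine ncard_le_rk_of_injOn (w := Function.update w k z) ?_ ?_ ?_
    · rw [injOn_insert hk]
      refine ⟨fun i hi j hj hij => ?_, ?_⟩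
      · rw [Function.update_of_ne (hne i hi), Function.update_of_ne (hne j hj)] at hij
        exact hw hi hj hij
      · rintro ⟨j, hj, hjz⟩
        rw [Function.update_of_ne (hne j hj), Function.update_self] at hjz
        exact hz (hjz ▸ hX j hj)
    · rintro j (rfl | hj)
      · rwa [Function.update_self]
      · rw [Function.update_of_ne (hne j hj)]; exact hA j hj
    · rintro j (rfl | hj)
      · rw [Function.update_self]; exact mem_insert _ _
      · rw [Function.update_of_ne (hne j hj)]; exact mem_insert_of_mem _ (hX j hj)
  rw [ncard_insert_of_notMem hk] at h2
  omega

theorem isFlat_of_matching (hw : InjOn w S) (hA : ∀ k ∈ S, w k ∈ A k) (hX : ∀ k ∈ S, w k ∈ X)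
    (hS : nbr A X ⊆ S) (hz : ∀ z ∉ X, ∃ k ∉ S, z ∈ A k) : (transversalMatroid A).IsFlat X := by
  rw [isFlat_iff_rk (subset_univ _)]
  intro z _ hzX
  obtain ⟨k, hk, hzk⟩ := hz z hzX
  exact rk_lt_rk_insert_of_matching hw hA hX hS hzX hk hzk

end Matching

/-! ### Interval presentations and their cyclic flats -/

section Interval

variable {α ι : Type*} [LinearOrder α] [LinearOrder ι]

/-- A presentation by intervals with strictly increasing left and right ends. -/
structure IntervalPresentation (A : ι → Set α) (l u : ι → α) : Prop where
  left_mono : StrictMono l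
  right_mono : StrictMono u
  left_le_right : ∀ k, l k ≤ u k
  mem_iff : ∀ k x, x ∈ A k ↔ l k ≤ x ∧ x ≤ u k

/-- An interval presentation in which every element is covered and consecutive intervals
overlap. -/
structure OverlappingPresentation (A : ι → Set α) (l u : ι → α) : Prop
    extends IntervalPresentation A l u where
  cover : ∀ x, ∃ k, x ∈ A k
  overlap : ∀ j k, j ⋖ k → l k ≤ u j

variable {A : ι → Set α} {l u : ι → α} {x y : α} {F : Set α} {m m' : ι}

/-- Reversal of both orders exchanges left and right ends, so that statements on final segments
follow from those on initial segments. -/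
theorem IntervalPresentation.dual (h : IntervalPresentation A l u) :
    IntervalPresentation (α := αᵒᵈ) (ι := ιᵒᵈ) A u l where
  left_mono := fun _ _ hij => h.right_mono hij
  right_mono := fun _ _ hij => h.left_mono hij
  left_le_right := h.left_le_right
  mem_iff := fun k x => (h.mem_iff k x).trans and_comm

theorem OverlappingPresentation.dual (h : OverlappingPresentation A l u) :
    OverlappingPresentation (α := αᵒᵈ) (ι := ιᵒᵈ) A u l where
  toIntervalPresentation := h.toIntervalPresentation.dual
  cover := h.cover
  overlap := fun j k hjk => h.overlap k j (ofDual_covBy_ofDual_iff.2 hjk)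

theorem exists_covBy_mem_notMem [Finite α] {a b : α} (hab : a < b) (ha : a ∈ F) (hb : b ∉ F) :
    ∃ x y, x ⋖ y ∧ a ≤ x ∧ y ≤ b ∧ x ∈ F ∧ y ∉ F := by
  obtain ⟨x, ⟨hxF, hxb⟩, hx⟩ := Set.exists_max_image {z | z ∈ F ∧ z < b} id (toFinite _)
    ⟨a, ha, hab⟩
  obtain ⟨y, hxy, hy⟩ := Set.exists_min_image {z | x < z} id (toFinite _) ⟨b, hxb⟩
  have hyb : y ≤ b := hy b hxb
  refine ⟨x, y, ⟨hxy, fun z hxz hzy => not_lt.2 (hy z hxz) hzy⟩, hx a ⟨ha, hab⟩, hyb, hxF, ?_⟩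
  intro hyF
  have hne : y ≠ b := fun h => hb (h ▸ hyF)
  exact not_lt.2 (hx y ⟨hyF, lt_of_le_of_ne hyb hne⟩) hxy

theorem IntervalPresentation.nbr_Iio (h : IntervalPresentation A l u) (m : ι) :
    nbr A (Iio (l m)) ⊆ Iio m := by
  rintro k ⟨x, hx, hxm⟩
  exact h.left_mono.lt_iff_lt.1 (((h.mem_iff k x).1 hx).1.trans_lt hxm)

theorem IntervalPresentation.nbr_Ioi (h : IntervalPresentation A l u) (m : ι) :
    nbr A (Ioi (u m)) ⊆ Ioi m := h.dual.nbr_Iio (α := αᵒᵈ) (ι := ιᵒᵈ) m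

theorem IntervalPresentation.left_mem (h : IntervalPresentation A l u) (k : ι) : l k ∈ A k :=
  (h.mem_iff k _).2 ⟨le_rfl, h.left_le_right k⟩

theorem IntervalPresentation.right_mem (h : IntervalPresentation A l u) (k : ι) : u k ∈ A k :=
  (h.mem_iff k _).2 ⟨h.left_le_right k, le_rfl⟩

/-- Indices below `m` are matched with left ends, those above `m'` with right ends. These never
collide, since `l j < l k ≤ u k` when `j < m ≤ k`. -/
theorem IntervalPresentation.exists_matching_union (h : IntervalPresentation A l u)
    (hd : Disjoint (Iio m) (Ioi m')) : ∃ w : ι → α, InjOn w (Iio m ∪ Ioi m') ∧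
      (∀ k ∈ Iio m ∪ Ioi m', w k ∈ A k) ∧
      ∀ k ∈ Iio m ∪ Ioi m', w k ∈ Iio (l m) ∪ Ioi (u m') := by
  classical
  have hw1 : ∀ k < m, (if k < m then l k else u k) = l k := fun k hk => if_pos hk
  have hw2 : ∀ k, m' < k → (if k < m then l k else u k) = u k :=
    fun k hk => if_neg fun hk' => disjoint_left.1 hd hk' hk
  refine ⟨fun k => if k < m then l k else u k, ?_, ?_, ?_⟩
  · rintro j (hj | hj) k (hk | hk) hjk
    · simp only [hw1 j hj, hw1 k hk] at hjk
      exact h.left_mono.injective hjk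
    · simp only [hw1 j hj, hw2 k hk] at hjk
      have hmk : m ≤ k := not_lt.1 fun h' => disjoint_left.1 hd h' hk
      exact absurd hjk ((h.left_mono (lt_of_lt_of_le hj hmk)).trans_le (h.left_le_right k)).ne
    · simp only [hw2 j hj, hw1 k hk] at hjk
      have hmj : m ≤ j := not_lt.1 fun h' => disjoint_left.1 hd h' hj
      exact absurd hjk ((h.left_mono (lt_of_lt_of_le hk hmj)).trans_le (h.left_le_right j)).ne'
    · simp only [hw2 j hj, hw2 k hk] at hjk
      exact h.right_mono.injective hjk
  · rintro k (hk | hk)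
    · simp only [hw1 k hk]; exact h.left_mem k
    · simp only [hw2 k hk]; exact h.right_mem k
  · rintro k (hk | hk)
    · simp only [hw1 k hk]; exact Or.inl (h.left_mono hk)
    · simp only [hw2 k hk]; exact Or.inr (h.right_mono hk)

variable [Finite α] [Finite ι]

/-- A cyclic flat ends just before the left end of an interval that it does not meet. -/
theorem IntervalPresentation.exists_left_eq (h : IntervalPresentation A l u)
    (hF : F ∈ cyclicFlats (transversalMatroid A)) (hxy : x ⋖ y) (hx : x ∈ F) (hy : y ∉ F) :
    ∃ m, l m = y ∧ Disjoint (A m) F ∧ x ∉ range l := by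
  obtain ⟨m, hym, hm⟩ := exists_mem_disjoint_of_mem_cyclicFlats hF hy
  have hym' := (h.mem_iff m y).1 hym
  -- An interval through `y` that avoids `F` cannot reach the predecessor `x ∈ F`, so it starts at
  -- `y`.
  have hl : l m = y := by
    refine le_antisymm hym'.1 (not_lt.1 fun hlt => disjoint_left.1 hm ?_ hx)
    exact (h.mem_iff m x).2 ⟨not_lt.1 fun hlt' => hxy.2 hlt' hlt, hxy.1.le.trans hym'.2⟩
  refine ⟨m, hl, hm, ?_⟩
  -- If `x` were the left end of `A k`, cyclicity would give a second element of `F` in `A k`. It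
  -- would be at least `l m` and at most `u k < u m`, hence in `A m`, which avoids `F`.
  rintro ⟨k, rfl⟩
  have hkm : k < m := h.left_mono.lt_iff_lt.1 (hl ▸ hxy.1)
  obtain ⟨z, hz, hzF, hzx⟩ := (mem_cyclicFlats.1 hF).2.exists_ne_mem
    ((h.mem_iff k (l k)).2 ⟨le_rfl, h.left_le_right k⟩) hx
  have hz' := (h.mem_iff k z).1 hz
  refine disjoint_left.1 hm ((h.mem_iff m z).2 ⟨?_, hz'.2.trans (h.right_mono hkm).le⟩) hzF
  rw [hl]
  exact not_lt.1 (hxy.2 (lt_of_le_of_ne hz'.1 hzx.symm))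

/-- A cyclic flat starts just after the right end of an interval that it does not meet. -/
theorem IntervalPresentation.exists_right_eq (h : IntervalPresentation A l u)
    (hF : F ∈ cyclicFlats (transversalMatroid A)) (hxy : x ⋖ y) (hx : x ∉ F) (hy : y ∈ F) :
    ∃ m, u m = x ∧ Disjoint (A m) F ∧ y ∉ range u :=
  h.dual.exists_left_eq (α := αᵒᵈ) (ι := ιᵒᵈ) hF (toDual_covBy_toDual_iff.2 hxy) hy hx

/-- If `x` is not a left end, but its successor is, then some cyclic flat contains only the first
of these two elements. -/
theorem IntervalPresentation.exists_cyclicFlat_left (h : IntervalPresentation A l u)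
    (hxy : x ⋖ l m) (hx : x ∉ range l) :
    ∃ F ∈ cyclicFlats (transversalMatroid A), x ∈ F ∧ l m ∉ F := by
  have hsub : ∀ k ∈ Iio m, l k ∈ Iio (l m) := fun k hk => h.left_mono hk
  -- The left ends before `l m` represent all intervals that meet `Iio (l m)`, and `x` is not among
  -- them; hence `x` is in the closure of the other elements, while `l m` raises the rank.
  refine exists_cyclicFlat_separating (Y := Iio (l m)) hxy.1 ?_ ?_
  · rw [mem_closure_iff_rk (mem_univ x), insert_sdiff_singleton, insert_eq_of_mem (mem_Iio.2 hxy.1)]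
    refine le_antisymm (((rk_le_ncard_nbr A _).trans (ncard_le_ncard (h.nbr_Iio m))).trans ?_)
      (rk_mono _ sdiff_subset)
    exact ncard_le_rk_of_injOn h.left_mono.injective.injOn (fun k _ => h.left_mem k)
      fun k hk => ⟨hsub k hk, fun hkx => hx ⟨k, hkx⟩⟩
  · rw [mem_closure_iff_rk (mem_univ _)]
    exact (rk_lt_rk_insert_of_matching h.left_mono.injective.injOn (fun k _ => h.left_mem k)
      hsub (h.nbr_Iio m) (lt_irrefl _) (lt_irrefl m) (h.left_mem m)).ne'

theorem IntervalPresentation.exists_cyclicFlat_right (h : IntervalPresentation A l u)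
    (hxy : u m ⋖ y) (hy : y ∉ range u) :
    ∃ F ∈ cyclicFlats (transversalMatroid A), u m ∉ F ∧ y ∈ F := by
  obtain ⟨F, hF, h1, h2⟩ := h.dual.exists_cyclicFlat_left (α := αᵒᵈ) (ι := ιᵒᵈ)
    (toDual_covBy_toDual_iff.2 hxy) hy
  exact ⟨F, hF, h2, h1⟩

theorem OverlappingPresentation.empty_mem_cyclicFlats (h : OverlappingPresentation A l u) :
    ∅ ∈ cyclicFlats (transversalMatroid A) := by
  refine mem_cyclicFlats.2 ⟨?_, fun x hx => hx.elim⟩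
  refine isFlat_of_matching (S := ∅) (w := l) (injOn_empty _) (by simp) (by simp) ?_ ?_
  · rintro k ⟨x, -, hx⟩; exact hx
  · exact fun z _ => (h.cover z).imp fun k hk => ⟨notMem_empty k, hk⟩

theorem OverlappingPresentation.isFlat_Iio (h : OverlappingPresentation A l u) (m : ι) :
    (transversalMatroid A).IsFlat (Iio (l m)) := by
  refine isFlat_of_matching h.left_mono.injective.injOn (fun k _ => h.left_mem k)
    (fun k hk => h.left_mono hk) (h.nbr_Iio m) fun z hz => ?_
  obtain ⟨k, hk⟩ := h.cover z
  rcases lt_or_ge k m with hkm | hkm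
  · exact ⟨m, lt_irrefl m, (h.mem_iff m z).2 ⟨not_lt.1 hz,
      ((h.mem_iff k z).1 hk).2.trans (h.right_mono hkm).le⟩⟩
  · exact ⟨k, not_lt.2 hkm, hk⟩

/-- After deletion of `e` the indices below `m` can still be matched inside the segment. If `e = l
k₀`, each index from `k₀` on moves to the next left end, which overlap permits, and the last one
moves to the corner element `x`. -/
theorem OverlappingPresentation.isCyclic_Iio [SuccOrder ι] (h : OverlappingPresentation A l u)
    (hxy : x ⋖ l m) (hx : x ∉ range l) : IsCyclic (transversalMatroid A) (Iio (l m)) := by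
  classical
  rw [isCyclic_iff_rk (subset_univ _)]
  intro e he
  refine le_antisymm (rk_mono _ sdiff_subset)
    (((rk_le_ncard_nbr A _).trans (ncard_le_ncard (h.nbr_Iio m))).trans ?_)
  by_cases hel : e ∈ range l
  · obtain ⟨k₀, rfl⟩ := hel
    have hlx : ∀ k < m, l k < x := fun k hk => lt_of_le_of_ne
      (not_lt.1 fun hlt => hxy.2 hlt (h.left_mono hk)) fun hkx => hx ⟨k, hkx⟩
    have hcov : ∀ k < m, k ⋖ Order.succ k := fun k hk =>
      Order.covBy_succ_of_not_isMax (not_isMax_of_lt hk)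
    let w : ι → α := fun k => if k < k₀ then l k else if Order.succ k = m then x else
      l (Order.succ k)
    have hw : ∀ k < m, (k < k₀ ∧ w k = l k) ∨ (k₀ ≤ k ∧ Order.succ k = m ∧ w k = x) ∨
        (k₀ ≤ k ∧ Order.succ k < m ∧ w k = l (Order.succ k)) := by
      intro k hk
      by_cases h1 : k < k₀
      · exact Or.inl ⟨h1, by simp [w, h1]⟩
      by_cases h2 : Order.succ k = m
      · exact Or.inr (Or.inl ⟨not_lt.1 h1, h2, by simp [w, h1, h2]⟩)
      · exact Or.inr (Or.inr ⟨not_lt.1 h1, lt_of_le_of_ne (Order.succ_le_of_lt hk) h2,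
          by simp [w, h1, h2]⟩)
    have hmono : StrictMonoOn w (Iio m) := by
      intro j hj k hk hjk
      have hsj : Order.succ j ≤ k := Order.succ_le_of_lt hjk
      rcases hw j hj with ⟨h1, h2⟩ | ⟨h1, h1', h2⟩ | ⟨h1, h1', h2⟩ <;>
        rcases hw k hk with ⟨h3, h4⟩ | ⟨h3, h3', h4⟩ | ⟨h3, h3', h4⟩ <;> rw [h2, h4]
      · exact h.left_mono hjk
      · exact hlx j hj
      · exact h.left_mono (hjk.trans (hcov k hk).1)
      · exact absurd (h1.trans_lt hjk) h3.asymm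
      · exact absurd hk (not_lt.2 (h1' ▸ hsj))
      · exact absurd hk (not_lt.2 (h1' ▸ hsj))
      · exact absurd (h1.trans_lt hjk) h3.asymm
      · exact hlx _ h1'
      · exact h.left_mono (hsj.trans_lt (hcov k hk).1)
    refine ncard_le_rk_of_injOn hmono.injOn (fun k hk => ?_) (fun k hk => ⟨?_, ?_⟩)
    · rw [h.mem_iff]
      rcases hw k hk with ⟨h1, h2⟩ | ⟨h1, h1', h2⟩ | ⟨h1, h1', h2⟩ <;> rw [h2]
      · exact ⟨le_rfl, h.left_le_right k⟩
      · exact ⟨(hlx k hk).le, hxy.1.le.trans (h1' ▸ h.overlap k _ (hcov k hk))⟩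
      · exact ⟨(h.left_mono (hcov k hk).1).le, h.overlap k _ (hcov k hk)⟩
    · rcases hw k hk with ⟨h1, h2⟩ | ⟨h1, h1', h2⟩ | ⟨h1, h1', h2⟩ <;> rw [h2]
      · exact h.left_mono hk
      · exact hxy.1
      · exact h.left_mono h1'
    · rcases hw k hk with ⟨h1, h2⟩ | ⟨h1, h1', h2⟩ | ⟨h1, h1', h2⟩ <;> rw [h2]
      · exact (h.left_mono h1).ne
      · exact fun hxk => hx ⟨k₀, hxk.symm⟩
      · exact (h.left_mono (h1.trans_lt (hcov k hk).1)).ne'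
  · exact ncard_le_rk_of_injOn h.left_mono.injective.injOn (fun k _ => h.left_mem k)
      fun k hk => ⟨h.left_mono hk, fun hke => hel ⟨k, hke⟩⟩

theorem OverlappingPresentation.Iio_mem_cyclicFlats [SuccOrder ι]
    (h : OverlappingPresentation A l u) (hxy : x ⋖ l m) (hx : x ∉ range l) :
    Iio (l m) ∈ cyclicFlats (transversalMatroid A) :=
  mem_cyclicFlats.2 ⟨h.isFlat_Iio m, h.isCyclic_Iio hxy hx⟩

theorem OverlappingPresentation.Ioi_mem_cyclicFlats [PredOrder ι]
    (h : OverlappingPresentation A l u) (hxy : u m ⋖ y) (hy : y ∉ range u) :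
    Ioi (u m) ∈ cyclicFlats (transversalMatroid A) :=
  h.dual.Iio_mem_cyclicFlats (α := αᵒᵈ) (ι := ιᵒᵈ) (toDual_covBy_toDual_iff.2 hxy) hy

/-- An element of the gap from `l m` to `u m'` lies in some `A k`. If `k` is not between `m` and
`m'`, monotonicity of the ends puts the element into `A m` or `A m'` as well. -/
theorem OverlappingPresentation.isFlat_Iio_union_Ioi (h : OverlappingPresentation A l u)
    (hmm : m ≤ m') : (transversalMatroid A).IsFlat (Iio (l m) ∪ Ioi (u m')) := by
  have hd : Disjoint (Iio m) (Ioi m') :=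
    disjoint_left.2 fun k hk hk' => lt_irrefl k (hk.trans_le (hmm.trans (le_of_lt hk')))
  obtain ⟨w, hw, hA, hX⟩ := h.exists_matching_union hd
  refine isFlat_of_matching hw hA hX ?_ fun z hz => ?_
  · rw [nbr_union]; exact union_subset_union (h.nbr_Iio m) (h.nbr_Ioi m')
  · simp only [mem_union, mem_Iio, mem_Ioi, not_or, not_lt] at hz
    obtain ⟨k, hk⟩ := h.cover z
    have hk' := (h.mem_iff k z).1 hk
    rcases lt_or_ge k m with hkm | hkm
    · exact ⟨m, by simp [hmm], (h.mem_iff m z).2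
        ⟨hz.1, hk'.2.trans (h.right_mono hkm).le⟩⟩
    rcases lt_or_ge m' k with hkm' | hkm'
    · exact ⟨m', by simp [hmm], (h.mem_iff m' z).2
        ⟨(h.left_mono hkm').le.trans hk'.1, hz.2⟩⟩
    · exact ⟨k, by simp [hkm, hkm'], hk⟩

end Interval

end LPM

namespace LPM

open Set

/-! ### Corners and the gaps of a cyclic flat -/

section Corners

variable {α ι : Type*} [LinearOrder α] [LinearOrder ι] {A : ι → Set α} {l u : ι → α} {m m' : ι}

/-- The left end with index `m` directly follows an element that is not a left end. -/
def IsLeftCorner (l : ι → α) (m : ι) : Prop := ∃ x, x ⋖ l m ∧ x ∉ range l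

/-- The right end with index `m` directly precedes an element that is not a right end. -/
def IsRightCorner (u : ι → α) (m : ι) : Prop := ∃ y, u m ⋖ y ∧ y ∉ range u

/-- The last element of `F` before `x` is followed by an element outside `F`, where an interval
avoiding `F` begins; this is the corner. -/
theorem OverlappingPresentation.exists_leftSegment [Finite α] [Finite ι]
    (h : OverlappingPresentation A l u) {F : Set α}
    (hF : F ∈ cyclicFlats (transversalMatroid A)) {x : α} (hx : x ∉ F) :
    ∃ I, x ∉ I ∧ F ∩ Iio x ⊆ I ∧ (I = ∅ ∨
      ∃ m, IsLeftCorner l m ∧ I = Iio (l m) ∧ l m ≤ x ∧ Disjoint (A m) F ∧ ∃ a ∈ F, a ⋖ l m) := by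
  rcases (F ∩ Iio x).eq_empty_or_nonempty with he | hne
  · exact ⟨∅, notMem_empty x, he.subset, Or.inl rfl⟩
  obtain ⟨z, ⟨hzF, hzx⟩, hz⟩ := Set.exists_max_image (F ∩ Iio x) id (toFinite _) hne
  obtain ⟨a, b, hab, hza, hbx, ha, hb⟩ := exists_covBy_mem_notMem hzx hzF hx
  obtain ⟨m, rfl, hd, har⟩ := h.exists_left_eq hF hab ha hb
  exact ⟨Iio (l m), fun hxm => not_lt.2 hbx hxm,
    fun y hy => ((hz y hy).trans hza).trans_lt hab.1,
    Or.inr ⟨m, ⟨a, hab, har⟩, rfl, hbx, hd, a, ha, hab⟩⟩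

theorem OverlappingPresentation.exists_rightSegment [Finite α] [Finite ι]
    (h : OverlappingPresentation A l u) {F : Set α}
    (hF : F ∈ cyclicFlats (transversalMatroid A)) {x : α} (hx : x ∉ F) :
    ∃ J, x ∉ J ∧ F ∩ Ioi x ⊆ J ∧ (J = ∅ ∨
      ∃ m, IsRightCorner u m ∧ J = Ioi (u m) ∧ x ≤ u m ∧ Disjoint (A m) F ∧ ∃ b ∈ F, u m ⋖ b) := by
  obtain ⟨J, h1, h2, h3⟩ := h.dual.exists_leftSegment (α := αᵒᵈ) (ι := ιᵒᵈ) hF hx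
  refine ⟨J, h1, h2, h3.imp_right ?_⟩
  rintro ⟨m, ⟨y, hy, hyu⟩, h4, h5, h6, b, hb, hbm⟩
  exact ⟨m, ⟨y, toDual_covBy_toDual_iff.1 hy, hyu⟩, h4, h5, h6, b, hb,
    toDual_covBy_toDual_iff.1 hbm⟩

end Corners

/-! ### Flexible pairs decide configuration uniqueness -/

section Fin

variable {n r : ℕ} {A : Fin r → Set (Fin n)} {l u : Fin r → Fin n} {m m' : Fin r}

theorem covBy_iff_val {x y : Fin n} : x ⋖ y ↔ (x : ℕ) + 1 = y := by
  rw [← Nat.covBy_iff_add_one_eq]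
  constructor
  · intro hxy
    refine ⟨hxy.1, fun c hc hc' => hxy.2 (c := ⟨c, hc'.trans y.2⟩) hc hc'⟩
  · intro hxy
    exact ⟨hxy.1, fun c hc hc' => hxy.2 (c := c) hc hc'⟩

/-- `w k - k` is monotone; for the north steps of a path it is the number of east steps before the
step `w k`. -/
theorem add_le_of_strictMono {w : Fin r → Fin n} (hw : StrictMono w) {j k : Fin r} (hjk : j ≤ k) :
    (w j : ℕ) + k ≤ w k + j := by
  obtain ⟨k, hk⟩ := k
  obtain ⟨j, hj⟩ := j
  have hjk' : j ≤ k := hjk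
  induction k, hjk' using Nat.le_induction with
  | base => exact le_rfl
  | succ k hjk' ih =>
    have h1 := ih (by omega) (Fin.le_def.2 hjk')
    have h2 : (w ⟨k, by omega⟩ : ℕ) < w ⟨k + 1, hk⟩ := hw (Nat.lt_succ_self k)
    simp only at h1 ⊢
    omega

/-- A corner of the upper path that is strictly north-west of a corner of the lower path. -/
structure IsFlexiblePair (l u : Fin r → Fin n) (m m' : Fin r) : Prop where
  left_corner : IsLeftCorner l m
  right_corner : IsRightCorner u m'
  lt : (m' : ℕ) + 1 < m
  add_lt : (l m : ℕ) + m' < u m' + m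

/-- With indices from zero the corners are `(l m - m, m)` and `(u m' - m', m' + 1)`, and `hl`, `hu`
exclude other corners between `e` and `f`. So a cyclic flat `F` with only `e` must stop at `l m` and
avoid `A m`, and a cyclic flat `G` with only `f` must start after `u m'` and avoid `A m'`. From `l
m'` to `u m`, this leaves to `F ∩ G` only elements strictly between `u m'` and `l m`. By `hm` and
`hlu` they are fewer than the common neighbours strictly between `m'` and `m`. -/
theorem IntervalPresentation.separatedNonmodular (h : IntervalPresentation A l u)
    (hm : (m' : ℕ) + 1 < m) (hlu : (l m : ℕ) + m' < u m' + m) {e f : Fin n}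
    (hef : ((e : ℕ) + 1 = l m ∧ (f : ℕ) = u m' + 1 ∧ (l m : ℕ) ≤ u m' + 1) ∨
      (e = u m' ∧ f = l m ∧ (u m' : ℕ) + 1 < l m))
    (hl : ∀ k, IsLeftCorner l k → e < l k → l k ≤ f → k = m)
    (hu : ∀ k, IsRightCorner u k → e ≤ u k → u k < f → k = m') :
    SeparatedNonmodular (transversalMatroid A) e f := by
  intro F hF G hG heF hfF heG hfG
  have hmm : m' < m := Fin.lt_def.2 (by omega)
  have hlm : l m' < l m := h.left_mono hmm
  have hum : u m' < u m := h.right_mono hmm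
  have hem : (e : ℕ) < l m ∧ (e : ℕ) ≤ u m' ∧ (l m : ℕ) ≤ f ∧ (u m' : ℕ) < f := by
    rcases hef with ⟨h1, h2, h3⟩ | ⟨h1, h2, h3⟩
    · omega
    · subst h1 h2; omega
  have hF' : ∀ a b, e ≤ a → b ≤ f → a < b → a ∈ F → b ∉ F →
      a < l m ∧ l m ≤ b ∧ Disjoint (A m) F := by
    intro a b hea hbf hab ha hb
    obtain ⟨x, y, hxy, hax, hyb, hx, hy⟩ := exists_covBy_mem_notMem hab ha hb
    obtain ⟨k, rfl, hd, hxr⟩ := h.exists_left_eq hF hxy hx hy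
    obtain rfl := hl k ⟨x, hxy, hxr⟩ ((hea.trans hax).trans_lt hxy.1) (hyb.trans hbf)
    exact ⟨hax.trans_lt hxy.1, hyb, hd⟩
  have hG' : ∀ a b, e ≤ a → b ≤ f → a < b → a ∉ G → b ∈ G →
      a ≤ u m' ∧ u m' < b ∧ Disjoint (A m') G := by
    intro a b hea hbf hab ha hb
    obtain ⟨x, y, hxy, hax, hyb, hx, hy⟩ := exists_covBy_mem_notMem (F := Gᶜ) hab ha
      (fun hb' => hb' hb)
    obtain ⟨k, rfl, hd, hxr⟩ := h.exists_right_eq hG hxy hx (not_notMem.1 hy)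
    obtain rfl := hu k ⟨y, hxy, hxr⟩ (hea.trans hax) (hxy.1.trans_le (hyb.trans hbf))
    exact ⟨hax, hxy.1.trans_le hyb, hd⟩
  have hlt : e < f := Fin.lt_def.2 (by omega)
  have hdF := (hF' e f le_rfl le_rfl hlt heF hfF).2.2
  have hdG := (hG' e f le_rfl le_rfl hlt heG hfG).2.2
  have hFm : ∀ z, e ≤ z → z < l m → z ∈ F := by
    intro z hez hz
    by_contra hzF
    have hne : e ≠ z := fun h' => hzF (h' ▸ heF)
    exact not_lt.2 (hF' e z le_rfl (hz.le.trans (Fin.le_def.2 hem.2.2.1))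
      (lt_of_le_of_ne hez hne) heF hzF).2.1 hz
  have hGm : ∀ z, z ≤ f → u m' < z → z ∈ G := by
    intro z hzf hz
    by_contra hzG
    have hne : z ≠ f := fun h' => hzG (h' ▸ hfG)
    exact not_lt.2 (hG' z f ((Fin.le_def.2 hem.2.1).trans hz.le) le_rfl
      (lt_of_le_of_ne hzf hne) hzG hfG).1 hz
  refine rk_union_add_rk_inter_lt (mem_cyclicFlats.1 hF).2 (mem_cyclicFlats.1 hG).2 ?_
  set W := F ∩ G with hW
  have hsub : W ⊆ (W ∩ Iio (l m') ∪ Ioo (u m') (l m)) ∪ W ∩ Ioi (u m) := by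
    intro w hw
    have h1 : w ∉ A m := fun h' => disjoint_left.1 hdF h' hw.1
    have h2 : w ∉ A m' := fun h' => disjoint_left.1 hdG h' hw.2
    rw [h.mem_iff, not_and_or, not_le, not_le] at h1 h2
    rcases h2 with h2 | h2
    · exact Or.inl (Or.inl ⟨hw, h2⟩)
    · rcases h1 with h1 | h1
      · exact Or.inl (Or.inr ⟨h2, h1⟩)
      · exact Or.inr ⟨hw, h1⟩
  have hr : rk (transversalMatroid A) W ≤ (nbr A (W ∩ Iio (l m'))).ncard + (Ioo (u m') (l m)).ncard
      + (nbr A (W ∩ Ioi (u m))).ncard :=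
    calc rk (transversalMatroid A) W ≤ _ := rk_mono _ hsub
      _ ≤ _ := rk_union_le _ _ _
      _ ≤ _ := Nat.add_le_add ((rk_union_le _ _ _).trans
        (Nat.add_le_add (rk_le_ncard_nbr A _) (rk_le_ncard _ (toFinite _)))) (rk_le_ncard_nbr A _)
  -- Such an `A k` meets both flats: in the first case it contains `e` and `f`, in the second a
  -- point `z` common to `[e, l m)` and `(u m', f]`.
  have hmid : ∀ k ∈ Ioo m' m, k ∈ nbr A F ∧ k ∈ nbr A G := by
    rintro k ⟨hk1, hk2⟩
    have hlk : l k < l m := h.left_mono hk2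
    have huk : u m' < u k := h.right_mono hk1
    rw [Fin.lt_def] at hlk huk
    rcases hef with ⟨h1, h2, h3⟩ | ⟨h1, h2, h3⟩
    · refine ⟨⟨e, (h.mem_iff k e).2 ⟨Fin.le_def.2 ?_, Fin.le_def.2 ?_⟩, heF⟩,
        ⟨f, (h.mem_iff k f).2 ⟨Fin.le_def.2 ?_, Fin.le_def.2 ?_⟩, hfG⟩⟩ <;> omega
    · have hlu := Fin.le_def.1 (h.left_le_right k)
      rw [Fin.ext_iff] at h1 h2
      have hn := (u k).2
      let z : Fin n := ⟨max (l k) (u m' + 1), by omega⟩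
      have hz : (z : ℕ) = max (l k : ℕ) (u m' + 1) := rfl
      have hzk : z ∈ A k := (h.mem_iff k z).2 ⟨Fin.le_def.2 (by omega), Fin.le_def.2 (by omega)⟩
      refine ⟨⟨z, hzk, hFm z (Fin.le_def.2 ?_) (Fin.lt_def.2 ?_)⟩,
        ⟨z, hzk, hGm z (Fin.le_def.2 ?_) (Fin.lt_def.2 ?_)⟩⟩ <;> omega
  have h1 : nbr A (W ∩ Iio (l m')) ⊆ Iio m' := (nbr_mono inter_subset_right).trans (h.nbr_Iio m')
  have h3 : nbr A (W ∩ Ioi (u m)) ⊆ Ioi m := (nbr_mono inter_subset_right).trans (h.nbr_Ioi m)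
  have hd1 : Disjoint (nbr A (W ∩ Iio (l m'))) (Ioo m' m) :=
    disjoint_left.2 fun k hk hk' => lt_asymm (h1 hk) hk'.1
  have hd2 : Disjoint (nbr A (W ∩ Iio (l m')) ∪ Ioo m' m) (nbr A (W ∩ Ioi (u m))) := by
    refine disjoint_left.2 fun k hk hk' => ?_
    rcases hk with hk | hk
    · exact lt_asymm (lt_trans (h1 hk) hmm) (h3 hk')
    · exact lt_asymm hk.2 (h3 hk')
  have hN : (nbr A (W ∩ Iio (l m'))).ncard + (Ioo m' m).ncard + (nbr A (W ∩ Ioi (u m))).ncard ≤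
      (nbr A F ∩ nbr A G).ncard := by
    rw [← ncard_union_eq hd1, ← ncard_union_eq hd2]
    refine ncard_le_ncard ?_
    rintro k ((hk | hk) | hk)
    · exact ⟨nbr_mono (inter_subset_left.trans inter_subset_left) hk,
        nbr_mono (inter_subset_left.trans inter_subset_right) hk⟩
    · exact hmid k hk
    · exact ⟨nbr_mono (inter_subset_left.trans inter_subset_left) hk,
        nbr_mono (inter_subset_left.trans inter_subset_right) hk⟩
  have hc1 : (Ioo m' m).ncard = m - m' - 1 := by
    rw [← Fin.card_Ioo, ← Finset.coe_Ioo, ncard_coe_finset]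
  have hc2 : (Ioo (u m') (l m)).ncard = l m - u m' - 1 := by
    rw [← Fin.card_Ioo, ← Finset.coe_Ioo, ncard_coe_finset]
  omega

/-- The elements to exchange are `u m'` and `l m` themselves. They are adjacent, so no other corner
interferes and no overlap of intervals is required; this version serves disconnected matroids. -/
theorem IntervalPresentation.not_configurationUnique (h : IntervalPresentation A l u)
    (hf : IsFlexiblePair l u m m') (hlu : (l m : ℕ) = u m' + 1) :
    ¬ ConfigurationUnique (transversalMatroid A) := by
  have hcov : u m' ⋖ l m := covBy_iff_val.2 hlu.symm
  obtain ⟨x, hx, hxr⟩ := hf.left_corner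
  obtain ⟨y, hy, hyr⟩ := hf.right_corner
  obtain rfl : x = u m' := by
    rw [covBy_iff_val] at hx; ext; omega
  obtain rfl : y = l m := by
    rw [covBy_iff_val] at hy; ext; omega
  refine not_configurationUnique_of_separatedNonmodular rfl hcov.1.ne
    (h.separatedNonmodular hf.lt hf.add_lt (Or.inl ⟨hlu.symm, hlu, hlu.le⟩) ?_ ?_)
    (h.exists_cyclicFlat_left hx hxr) (h.exists_cyclicFlat_right hy hyr)
  · intro k _ h1 h2
    rw [Fin.lt_def] at h1
    rw [Fin.le_def] at h2
    exact h.left_mono.injective (Fin.ext (by omega))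
  · intro k _ h1 h2
    rw [Fin.lt_def] at h2
    rw [Fin.le_def] at h1
    exact h.right_mono.injective (Fin.ext (by omega))

theorem OverlappingPresentation.not_configurationUnique (h : OverlappingPresentation A l u)
    (hf : IsFlexiblePair l u m m') : ¬ ConfigurationUnique (transversalMatroid A) := by
  -- A flexible pair with `l m` as close as possible to `u m' + 1`: a further corner between `e` and
  -- `f` would give a closer flexible pair.
  obtain ⟨⟨m, m'⟩, hf, hmin⟩ := Set.exists_min_image
    {q : Fin r × Fin r | IsFlexiblePair l u q.1 q.2} (fun q => Nat.dist (l q.1) (u q.2 + 1))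
    (toFinite _) ⟨(m, m'), hf⟩
  simp only [mem_ofPred_eq, Prod.forall, Nat.dist] at hf hmin
  obtain ⟨x, hx, hxr⟩ := hf.left_corner
  obtain ⟨y, hy, hyr⟩ := hf.right_corner
  have hIio := h.Iio_mem_cyclicFlats hx hxr
  have hIoi := h.Ioi_mem_cyclicFlats hy hyr
  rw [covBy_iff_val] at hx hy
  have hlt := hf.lt
  have hadd := hf.add_lt
  have hl : ∀ j k, j < k → (l j : ℕ) + k ≤ l k + j := fun j k hjk =>
    add_le_of_strictMono h.left_mono hjk.le
  have hu : ∀ j k, j < k → (u j : ℕ) + k ≤ u k + j := fun j k hjk =>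
    add_le_of_strictMono h.right_mono hjk.le
  have key : ∀ e f : Fin n, ((e : ℕ) + 1 = l m ∧ (f : ℕ) = u m' + 1 ∧ (l m : ℕ) ≤ u m' + 1) ∨
      (e = u m' ∧ f = l m ∧ (u m' : ℕ) + 1 < l m) →
      ¬ ConfigurationUnique (transversalMatroid A) := by
    intro e f hef
    have hef' : ((e : ℕ) + 1 = l m ∧ (f : ℕ) = u m' + 1 ∧ (l m : ℕ) ≤ u m' + 1) ∨
      ((e : ℕ) = u m' ∧ (f : ℕ) = l m ∧ (u m' : ℕ) + 1 < l m) := by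
      simpa only [← Fin.ext_iff] using hef
    refine not_configurationUnique_of_separatedNonmodular (e := e) (f := f) rfl (fun h' => ?_)
      (h.separatedNonmodular hf.lt hf.add_lt hef ?_ ?_)
      ⟨_, hIio, Fin.lt_def.2 (by omega), fun h' => ?_⟩
      ⟨_, hIoi, fun h' => ?_, Fin.lt_def.2 (by omega)⟩
    · subst h'; omega
    · intro k hk h1 h2
      rw [Fin.lt_def] at h1
      rw [Fin.le_def] at h2
      rcases lt_trichotomy k m with hkm | hkm | hkm
      · have h3 := hl k m hkm
        rw [Fin.lt_def] at hkm
        have := hmin k m' ⟨hk, hf.right_corner, by omega, by omega⟩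
        omega
      · exact hkm
      · have h3 := hl m k hkm
        rw [Fin.lt_def] at hkm
        have := hmin k m' ⟨hk, hf.right_corner, by omega, by omega⟩
        omega
    · intro k hk h1 h2
      rw [Fin.lt_def] at h2
      rw [Fin.le_def] at h1
      rcases lt_trichotomy k m' with hkm | hkm | hkm
      · have h3 := hu k m' hkm
        rw [Fin.lt_def] at hkm
        have := hmin m k ⟨hf.left_corner, hk, by omega, by omega⟩
        omega
      · exact hkm
      · have h3 := hu m' k hkm
        rw [Fin.lt_def] at hkm
        have := hmin m k ⟨hf.left_corner, hk, by omega, by omega⟩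
        omega
    · have := Fin.lt_def.1 (mem_Iio.1 h'); omega
    · have := Fin.lt_def.1 (mem_Ioi.1 h'); omega
  -- The initial and the final segment are disjoint in the first case and overlap in the second.
  -- Either way `e` lies only in the initial and `f` only in the final one.
  rcases le_or_gt (l m : ℕ) (u m' + 1) with hc | hc
  · exact key x y (Or.inl ⟨hx, hy.symm, hc⟩)
  · exact key (u m') (l m) (Or.inr ⟨rfl, rfl, hc⟩)

/-- The two ranks are at most `m` and `r - 1 - m'`. If `m' + 1 < m`, the segments cover everything
and the `m - m' - 1` indices in between can be matched inside the overlap. Otherwise the indices on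
the two sides are disjoint and are matched together inside the union. -/
theorem IntervalPresentation.rk_add_rk_le (h : IntervalPresentation A l u)
    (hf : (m' : ℕ) + 1 < m → (u m' : ℕ) + m ≤ l m + m') :
    rk (transversalMatroid A) (Iio (l m)) + rk (transversalMatroid A) (Ioi (u m')) ≤
      rk (transversalMatroid A) (Iio (l m) ∪ Ioi (u m')) +
      rk (transversalMatroid A) (Iio (l m) ∩ Ioi (u m')) := by
  have hI : rk (transversalMatroid A) (Iio (l m)) ≤ m := by
    refine ((rk_le_ncard_nbr A _).trans (ncard_le_ncard (h.nbr_Iio m))).trans ?_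
    rw [← Finset.coe_Iio, ncard_coe_finset, Fin.card_Iio]
  have hJ : rk (transversalMatroid A) (Ioi (u m')) ≤ r - 1 - m' := by
    refine ((rk_le_ncard_nbr A _).trans (ncard_le_ncard (h.nbr_Ioi m'))).trans ?_
    rw [← Finset.coe_Ioi, ncard_coe_finset, Fin.card_Ioi]
  by_cases hm : (m' : ℕ) + 1 < m
  · have hf := hf hm
    have hU : r ≤ rk (transversalMatroid A) (Iio (l m) ∪ Ioi (u m')) := by
      have := ncard_le_rk_of_injOn (A := A) (S := univ) (w := l) (X := Iio (l m) ∪ Ioi (u m'))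
        h.left_mono.injective.injOn (fun k _ => h.left_mem k) (fun k _ => ?_)
      · rwa [ncard_univ, Nat.card_fin] at this
      · simp only [mem_union, mem_Iio, mem_Ioi, Fin.lt_def]; omega
    have hM : (m : ℕ) - m' - 1 ≤ rk (transversalMatroid A) (Iio (l m) ∩ Ioi (u m')) := by
      have hc1 : (Ioo m' m).ncard = m - m' - 1 := by
        rw [← Fin.card_Ioo, ← Finset.coe_Ioo, ncard_coe_finset]
      -- A greedy matching after `u m'`: the index `k`, the `(k - m')`-th in line, takes `u m' + (k
      -- - m')`, or `l k` if that comes later. By `hf` this stays before `l m`. Other indices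
      -- receive a filler.
      have hw : ∀ k : Fin r, ∃ z : Fin n, k ∈ Ioo m' m →
          (z : ℕ) = max (l k : ℕ) (u m' + (k - m')) := by
        intro k
        by_cases hk : k ∈ Ioo m' m
        · have := add_le_of_strictMono h.right_mono hk.1.le
          have := hk.1
          rw [Fin.lt_def] at this
          exact ⟨⟨max (l k : ℕ) (u m' + (k - m')), by omega⟩, fun _ => rfl⟩
        · exact ⟨l k, fun h' => absurd h' hk⟩
      choose w hw using hw
      rw [← hc1]
      refine ncard_le_rk_of_injOn (w := w) (StrictMonoOn.injOn ?_) (fun k hk => ?_)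
        fun k hk => ?_
      · intro j hj k hk hjk
        have h1 := Fin.lt_def.1 (h.left_mono hjk)
        have h2 := hw j hj
        have h3 := hw k hk
        have h4 := hj.1
        rw [Fin.lt_def] at hjk h4 ⊢
        omega
      · have h1 := hw k hk
        have h2 := add_le_of_strictMono h.right_mono hk.1.le
        have h3 := hk.1
        have h4 := Fin.le_def.1 (h.left_le_right k)
        rw [h.mem_iff, Fin.le_def, Fin.le_def]
        rw [Fin.lt_def] at h3
        omega
      · have h1 := hw k hk
        have h3 := hk.1
        have h4 := hk.2
        have h5 := Fin.lt_def.1 (h.left_mono hk.2)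
        simp only [mem_inter_iff, mem_Iio, mem_Ioi, Fin.lt_def] at h3 h4 ⊢
        omega
    omega
  · have hd : Disjoint (Iio m) (Ioi m') := disjoint_left.2 fun k hk hk' => by
      have h1 := Fin.lt_def.1 (mem_Iio.1 hk)
      have h2 := Fin.lt_def.1 (mem_Ioi.1 hk')
      omega
    obtain ⟨w, hw, hA, hX⟩ := h.exists_matching_union hd
    have h1 := ncard_le_rk_of_injOn hw hA hX
    rw [ncard_union_eq hd, ← Finset.coe_Iio, ← Finset.coe_Ioi, ncard_coe_finset, ncard_coe_finset,
      Fin.card_Iio, Fin.card_Ioi] at h1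
    omega

theorem OverlappingPresentation.configurationUnique (h : OverlappingPresentation A l u)
    (hf : ∀ m m', ¬ IsFlexiblePair l u m m') : ConfigurationUnique (transversalMatroid A) := by
  have hI : ∀ m, IsLeftCorner l m → Iio (l m) ∈ cyclicFlats (transversalMatroid A) :=
    fun m ⟨x, hx, hxr⟩ => h.Iio_mem_cyclicFlats hx hxr
  have hJ : ∀ m, IsRightCorner u m → Ioi (u m) ∈ cyclicFlats (transversalMatroid A) :=
    fun m ⟨x, hx, hxr⟩ => h.Ioi_mem_cyclicFlats hx hxr
  have h0 := h.empty_mem_cyclicFlats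
  refine configurationUnique_of_chains rfl
    (insert ∅ {I | ∃ m, IsLeftCorner l m ∧ I = Iio (l m)})
    (insert ∅ {J | ∃ m, IsRightCorner u m ∧ J = Ioi (u m)}) ?_ ?_ ?_ ?_ ?_ ?_ ?_
  · rintro _ (rfl | ⟨m, hm, rfl⟩)
    exacts [h0, hI m hm]
  · rintro _ (rfl | ⟨m, hm, rfl⟩)
    exacts [h0, hJ m hm]
  · rintro _ (rfl | ⟨m, hm, rfl⟩) _ (rfl | ⟨k, hk, rfl⟩) -
    · exact Or.inl subset_rfl
    · exact Or.inl (empty_subset _)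
    · exact Or.inr (empty_subset _)
    · exact (le_total (l m) (l k)).imp Iio_subset_Iio Iio_subset_Iio
  · rintro _ (rfl | ⟨m, hm, rfl⟩) _ (rfl | ⟨k, hk, rfl⟩) -
    · exact Or.inl subset_rfl
    · exact Or.inl (empty_subset _)
    · exact Or.inr (empty_subset _)
    · exact (le_total (u k) (u m)).imp Ioi_subset_Ioi Ioi_subset_Ioi
  · rintro _ (rfl | ⟨m, hm, rfl⟩) _ (rfl | ⟨k, hk, rfl⟩)
    · simp
    · simp [add_comm]
    · simp
    · refine h.rk_add_rk_le fun hkm => not_lt.1 fun hlt => hf m k ⟨hm, hk, hkm, hlt⟩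
  · rintro _ (rfl | ⟨m, hm, rfl⟩) _ (rfl | ⟨k, hk, rfl⟩)
    · simp
    · simp
    · simp
    · rcases le_or_gt (l m) (u k) with hc | hc
      · exact Or.inl (disjoint_left.2 fun x hx hx' => lt_asymm (lt_of_lt_of_le hx hc) hx')
      · refine Or.inr (eq_univ_of_forall fun x => ?_)
        rcases lt_or_ge x (l m) with hx | hx
        exacts [Or.inl hx, Or.inr (hc.trans_le hx)]
  · intro F hF x hx
    obtain ⟨I, hxI, hFI, hI'⟩ := h.exists_leftSegment hF hx
    obtain ⟨J, hxJ, hFJ, hJ'⟩ := h.exists_rightSegment hF hx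
    have hmem : F ⊆ I ∪ J := by
      intro z hz
      rcases lt_trichotomy z x with hzx | hzx | hzx
      exacts [Or.inl (hFI ⟨hz, hzx⟩), absurd (hzx ▸ hz) hx, Or.inr (hFJ ⟨hz, hzx⟩)]
    have hxIJ : x ∉ I ∪ J := fun h' => h'.elim hxI hxJ
    rcases hI' with rfl | ⟨m, hm, rfl, hmx, hdm, -⟩
    · rcases hJ' with rfl | ⟨k, hk, rfl, hkx, hdk, b, hb, hkb⟩
      · exact ⟨∅, mem_insert _ _, ∅, mem_insert _ _, by simpa using h0, hmem, hxIJ⟩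
      · exact ⟨∅, mem_insert _ _, _, mem_insert_of_mem _ ⟨k, hk, rfl⟩, by simpa using hJ k hk,
          hmem, hxIJ⟩
    · rcases hJ' with rfl | ⟨k, hk, rfl, hkx, hdk, b, hb, hkb⟩
      · exact ⟨_, mem_insert_of_mem _ ⟨m, hm, rfl⟩, ∅, mem_insert _ _, by simpa using hI m hm,
          hmem, hxIJ⟩
      · refine ⟨_, mem_insert_of_mem _ ⟨m, hm, rfl⟩, _, mem_insert_of_mem _ ⟨k, hk, rfl⟩, ?_,
          hmem, hxIJ⟩
        -- Otherwise `u k < u m`, and the successor `b ∈ F` of `u k` would lie in `A m`, which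
        -- avoids `F`.
        have hmk : m ≤ k := by
          rw [← h.right_mono.le_iff_le]
          by_contra hlt
          rw [not_le] at hlt
          exact disjoint_left.1 hdm ((h.mem_iff m b).2
            ⟨(hmx.trans hkx).trans hkb.1.le, not_lt.1 (hkb.2 hlt)⟩) hb
        exact mem_cyclicFlats.2 ⟨h.isFlat_Iio_union_Ioi hmk,
          (mem_cyclicFlats.1 (hI m hm)).2.union (mem_cyclicFlats.1 (hJ k hk)).2⟩

end Fin

end LPM

namespace LPM

open Set

/-! ### Circuits through two given elements -/

section Circuit

theorem exists_isCircuit_of_indep_sdiff {α : Type*} {M : Matroid α} {X : Set α} {e f : α} (hX : M.Dep X)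
    (he : M.Indep (X \ {e})) (hf : M.Indep (X \ {f})) :
    ∃ C, M.IsCircuit C ∧ e ∈ C ∧ f ∈ C := by
  obtain ⟨C, hCX, hC⟩ := hX.exists_isCircuit_subset
  refine ⟨C, hC, ?_, ?_⟩
  · by_contra h
    exact hC.not_indep (he.subset fun x hx => ⟨hCX hx, fun hxe => h (hxe ▸ hx)⟩)
  · by_contra h
    exact hC.not_indep (hf.subset fun x hx => ⟨hCX hx, fun hxe => h (hxe ▸ hx)⟩)

variable {α ι : Type*} [LinearOrder α] [LinearOrder ι] {A : ι → Set α} {l u : ι → α}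

/-- Indices below `a` keep their representative `p`, the others move on to `q`; the two groups lie
on opposite sides of `e`, which becomes free. -/
theorem indep_sdiff_of_shift [Finite α] {S : Set ι} {p q : ι → α} {X : Set α} {a : ι} {e : α}
    (hp : StrictMonoOn p S) (hq : StrictMonoOn q {k ∈ S | a ≤ k})
    (hpq : ∀ k ∈ S, a ≤ k → p k < q k) (hpA : ∀ k ∈ S, p k ∈ A k)
    (hqA : ∀ k ∈ S, a ≤ k → q k ∈ A k) (hpX : ∀ k ∈ S, p k ∈ X) (hqX : ∀ k ∈ S, a ≤ k → q k ∈ X)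
    (hX : X.ncard ≤ S.ncard + 1) (he : e ∈ X) (hpe : ∀ k ∈ S, k < a → p k < e)
    (hqe : ∀ k ∈ S, a ≤ k → e < q k) : (transversalMatroid A).Indep (X \ {e}) := by
  classical
  have hw : ∀ k ∈ S, (k < a ∧ (if k < a then p k else q k) = p k) ∨
      (a ≤ k ∧ (if k < a then p k else q k) = q k) := by
    intro k _
    rcases lt_or_ge k a with h | h
    · exact Or.inl ⟨h, if_pos h⟩
    · exact Or.inr ⟨h, if_neg (not_lt.2 h)⟩
  refine indep_of_ncard_le_rk (toFinite _) ?_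
  have h1 : (X \ {e}).ncard ≤ S.ncard := by
    rw [ncard_sdiff_singleton_of_mem he]; omega
  refine h1.trans (ncard_le_rk_of_injOn (w := fun k => if k < a then p k else q k)
    (StrictMonoOn.injOn ?_) ?_ ?_)
  · intro j hj k hk hjk
    show (if j < a then p j else q j) < (if k < a then p k else q k)
    rcases hw j hj with ⟨h1, h2⟩ | ⟨h1, h2⟩ <;> rcases hw k hk with ⟨h3, h4⟩ | ⟨h3, h4⟩ <;>
      rw [h2, h4]
    · exact hp hj hk hjk
    · exact (hp hj hk hjk).trans (hpq k hk h3)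
    · exact absurd (h1.trans_lt hjk) h3.asymm
    · exact hq ⟨hj, h1⟩ ⟨hk, h3⟩ hjk
  · intro k hk
    rcases hw k hk with ⟨h1, h2⟩ | ⟨h1, h2⟩ <;> simp only [h2]
    · exact hpA k hk
    · exact hqA k hk h1
  · intro k hk
    rcases hw k hk with ⟨h1, h2⟩ | ⟨h1, h2⟩ <;> simp only [h2]
    · exact ⟨hpX k hk, (hpe k hk h1).ne⟩
    · exact ⟨hqX k hk h1, (hqe k hk h1).ne'⟩

/-- An element between two consecutive left ends lies in the first of the two intervals. -/
theorem OverlappingPresentation.mem_of_lt [Finite ι] (h : OverlappingPresentation A l u) {k : ι} {z : α}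
    (hkz : l k < z) (hz : ∀ k', k ⋖ k' → z ≤ l k') : z ∈ A k := by
  obtain ⟨k₀, hk₀⟩ := h.cover z
  have hk₀' := (h.mem_iff k₀ z).1 hk₀
  refine (h.mem_iff k z).2 ⟨hkz.le, ?_⟩
  rcases le_or_gt k₀ k with hk | hk
  · exact hk₀'.2.trans (h.right_mono.monotone hk)
  · obtain ⟨k', hk', -⟩ := Set.exists_min_image {k' | k < k'} id (toFinite _) ⟨k₀, hk⟩
    obtain ⟨x, y, hxy, hkx, -, hx, hy⟩ := exists_covBy_mem_notMem (F := Iic k) hk le_rfl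
      (not_le.2 hk)
    obtain rfl : x = k := le_antisymm hx hkx
    exact (hz y hxy).trans (h.overlap x y hxy)

/-- Only the intervals that start before `g` meet `Iic g`, as `g` is not a left end. Representatives
of these intervals, chosen so as to include `e`, form together with `g` a set with one element too
many, which becomes independent when `e` or `f` is removed. Every circuit inside contains both. -/
theorem OverlappingPresentation.exists_isCircuit [Finite α] [Finite ι] [SuccOrder ι]
    (h : OverlappingPresentation A l u) {e f g : α} (hef : e < f) (hfg : f ≤ g) (hg : g ∉ range l)
    (hf : f = g ∨ f ∈ range l) : ∃ C, (transversalMatroid A).IsCircuit C ∧ e ∈ C ∧ f ∈ C := by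
  classical
  set S : Set ι := {k | l k < g}
  have hcov : ∀ k : ι, k < Order.succ k → k ⋖ Order.succ k := fun k hk =>
    Order.covBy_succ_of_not_isMax (not_isMax_of_lt hk)
  -- The next left end, or `g` if none comes before `g`. A maximal `k` is its own successor and is
  -- excluded by `k < Order.succ k`.
  let q : ι → α := fun k => if k < Order.succ k ∧ l (Order.succ k) < g then l (Order.succ k) else g
  have hq : ∀ k, (k ⋖ Order.succ k ∧ l (Order.succ k) < g ∧ q k = l (Order.succ k)) ∨
      ((∀ k', k ⋖ k' → g ≤ l k') ∧ q k = g) := by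
    intro k
    by_cases hk : k < Order.succ k ∧ l (Order.succ k) < g
    · exact Or.inl ⟨hcov k hk.1, hk.2, if_pos hk⟩
    · refine Or.inr ⟨fun k' hk' => not_lt.1 fun hlt => hk ?_, if_neg hk⟩
      have := hk'.succ_eq
      rw [this]
      exact ⟨hk'.1, hlt⟩
  have hqg : ∀ k, q k ≤ g := fun k => by
    rcases hq k with ⟨-, h1, h2⟩ | ⟨-, h2⟩ <;> rw [h2]
    exact h1.le
  have hqA : ∀ k ∈ S, q k ∈ A k := by
    intro k hk
    rcases hq k with ⟨h1, -, h2⟩ | ⟨h1, h2⟩ <;> rw [h2]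
    · exact (h.mem_iff _ _).2 ⟨(h.left_mono h1.1).le, h.overlap _ _ h1⟩
    · exact h.mem_of_lt hk h1
  have hlq : ∀ k ∈ S, l k < q k := by
    intro k hk
    rcases hq k with ⟨h1, -, h2⟩ | ⟨-, h2⟩ <;> rw [h2]
    · exact h.left_mono h1.1
    · exact hk
  have hql : ∀ j k, j < k → k ∈ S → q j ≤ l k := by
    intro j k hjk hk
    have hs : Order.succ j ≤ k := Order.succ_le_of_lt hjk
    have hj : j < Order.succ j := Order.lt_succ_of_not_isMax (not_isMax_of_lt hjk)
    have : q j = l (Order.succ j) :=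
      if_pos ⟨hj, (h.left_mono.monotone hs).trans_lt hk⟩
    rw [this]
    exact h.left_mono.monotone hs
  have hqmono : StrictMonoOn q S := fun j _ k hk hjk =>
    (hql j k hjk hk).trans_lt (hlq k hk)
  have hdep : ∀ X : Set α, X ⊆ Iic g → S.ncard < X.ncard → (transversalMatroid A).Dep X := by
    intro X hXg hX
    refine (Matroid.not_indep_iff (subset_univ _)).1 fun hi => ?_
    have h1 := rk_le_ncard_nbr A X
    rw [rk_indep hi] at h1
    have h2 : (nbr A X).ncard ≤ S.ncard := by
      refine ncard_le_ncard ?_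
      rintro k ⟨x, hx, hxX⟩
      exact lt_of_le_of_ne (((h.mem_iff k x).1 hx).1.trans (hXg hxX)) fun hk => hg ⟨k, hk⟩
    omega
  -- If `e` is a left end, `p = l` works. Otherwise the last `j` with `l j < e` takes `e`, earlier
  -- indices move to the next left end and later ones keep theirs.
  obtain ⟨p, j, hp, hpA, rfl, hpj, hpq⟩ : ∃ (p : ι → α) (j : ι), StrictMono p ∧
      (∀ k, p k ∈ A k) ∧ p j = e ∧ (∀ k, j < k → p k = l k) ∧ ∀ k ∈ S, j ≤ k → p k < q k := by
    by_cases he : e ∈ range l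
    · obtain ⟨j, rfl⟩ := he
      exact ⟨l, j, h.left_mono, h.left_mem, rfl, fun _ _ => rfl, fun k hk _ => hlq k hk⟩
    obtain ⟨k₀, hk₀⟩ := h.cover e
    have hk₀e := lt_of_le_of_ne ((h.mem_iff k₀ e).1 hk₀).1 fun hk => he ⟨k₀, hk⟩
    obtain ⟨j, hje, hj⟩ := Set.exists_max_image {k | l k < e} id (toFinite _) ⟨k₀, hk₀e⟩
    rw [mem_ofPred_eq] at hje
    have hej : ∀ k, j < k → e < l k := fun k hk =>
      lt_of_le_of_ne (not_lt.1 fun hlt => not_lt.2 (hj k hlt) hk) fun hek => he ⟨k, hek.symm⟩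
    have hsj : ∀ k, k < j → k ⋖ Order.succ k ∧ l (Order.succ k) ≤ l j := fun k hk =>
      ⟨Order.covBy_succ_of_not_isMax (not_isMax_of_lt hk),
        h.left_mono.monotone (Order.succ_le_of_lt hk)⟩
    let p : ι → α := fun k => if k < j then l (Order.succ k) else if k = j then e else l k
    have hp1 : ∀ k, k < j → p k = l (Order.succ k) := fun k hk => if_pos hk
    have hp2 : p j = e := by simp [p]
    have hp3 : ∀ k, j < k → p k = l k := fun k hk => by simp [p, hk.not_gt, hk.ne']
    refine ⟨p, j, ?_, ?_, hp2, hp3, ?_⟩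
    · intro i k hik
      rcases lt_trichotomy i j with hi | rfl | hi
      · rw [hp1 i hi]
        rcases lt_trichotomy k j with hk | rfl | hk
        · rw [hp1 k hk]
          exact h.left_mono ((Order.succ_le_of_lt hik).trans_lt (hsj k hk).1.1)
        · rw [hp2]
          exact (hsj i hi).2.trans_lt hje
        · rw [hp3 k hk]
          exact (hsj i hi).2.trans_lt (h.left_mono hk)
      · rw [hp2, hp3 k hik]
        exact hej k hik
      · rw [hp3 i hi, hp3 k (hi.trans hik)]
        exact h.left_mono hik
    · intro k
      rcases lt_trichotomy k j with hk | rfl | hk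
      · rw [hp1 k hk]
        exact (h.mem_iff _ _).2 ⟨(h.left_mono (hsj k hk).1.1).le, h.overlap _ _ (hsj k hk).1⟩
      · rw [hp2]
        exact h.mem_of_lt hje fun k' hk' => (hej k' hk'.1).le
      · rw [hp3 k hk]
        exact h.left_mem k
    · intro k hk hjk
      rcases hjk.eq_or_lt with rfl | hjk
      · rw [hp2]
        rcases hq j with ⟨h1, -, h2⟩ | ⟨-, h2⟩ <;> rw [h2]
        · exact hej _ h1.1
        · exact hef.trans_le hfg
      · rw [hp3 k hjk]
        exact hlq k hk
  have hpl : ∀ k, j ≤ k → l k ≤ p k := fun k _ => ((h.mem_iff _ _).1 (hpA k)).1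
  have hpg : ∀ k ∈ S, p k < g := by
    intro k hk
    rcases le_or_gt k j with hkj | hkj
    · exact (hp.monotone hkj).trans_lt (hef.trans_le hfg)
    · rw [hpj k hkj]; exact hk
  have hjS : j ∈ S := (hpl j le_rfl).trans_lt (hef.trans_le hfg)
  set X : Set α := insert g (p '' S) with hXdef
  have hgX : g ∉ p '' S := fun ⟨k, hk, hkg⟩ => (hpg k hk).ne hkg
  have hX : X.ncard = S.ncard + 1 := by
    rw [ncard_insert_of_notMem hgX, hp.injective.injOn.ncard_image]
  have hpX : ∀ k ∈ S, p k ∈ X := fun k hk => Or.inr ⟨k, hk, rfl⟩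
  have hqX : ∀ k ∈ S, j ≤ k → q k ∈ X := by
    intro k hk hjk
    rcases hq k with ⟨h1, h1', h2⟩ | ⟨h1, h2⟩ <;> rw [h2]
    · rw [← hpj _ (hjk.trans_lt h1.1)]
      exact hpX _ h1'
    · exact Or.inl rfl
  have hp' : ∀ i ∈ S, j ≤ i → (transversalMatroid A).Indep (X \ {p i}) := fun i hi hji =>
    indep_sdiff_of_shift (S := S) (p := p) (q := q) (a := i) (hp.strictMonoOn _)
      (hqmono.mono fun k hk => hk.1) (fun k hk hik => hpq k hk (hji.trans hik)) (fun k _ => hpA k)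
      (fun k hk _ => hqA k hk) hpX (fun k hk hik => hqX k hk (hji.trans hik)) hX.le (hpX i hi)
      (fun k _ hk => hp hk)
      (fun k hk hik => (hp.monotone hik).trans_lt (hpq k hk (hji.trans hik)))
  refine exists_isCircuit_of_indep_sdiff (hdep X ?_ (by omega)) (hp' j hjS le_rfl) ?_
  · rintro _ (rfl | ⟨k, hk, rfl⟩)
    exacts [le_rfl, (hpg k hk).le]
  · rcases hf with rfl | ⟨i, rfl⟩
    · rw [hXdef, insert_sdiff_of_mem _ (mem_singleton f), sdiff_singleton_eq_self hgX]
      refine indep_of_ncard_le_rk (toFinite _) ?_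
      rw [hp.injective.injOn.ncard_image]
      exact ncard_le_rk_of_injOn hp.injective.injOn (fun k _ => hpA k) fun k hk => ⟨k, hk, rfl⟩
    · have hji : j < i := h.left_mono.lt_iff_lt.1 ((hpl j le_rfl).trans_lt hef)
      have hiS : i ∈ S := lt_of_le_of_ne hfg fun hi => hg ⟨i, hi⟩
      rw [← hpj i hji]
      exact hp' i hiS hji.le

theorem OverlappingPresentation.isConnected [Finite α] [Finite ι] [SuccOrder ι]
    (h : OverlappingPresentation A l u) (hlu : ∀ k, l k < u k) : IsConnected (transversalMatroid A) := by
  have key : ∀ e f : α, e < f → ∃ C, (transversalMatroid A).IsCircuit C ∧ e ∈ C ∧ f ∈ C := by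
    intro e f hef
    by_cases hf : f ∈ range l
    · obtain ⟨g, -, hg⟩ := Set.exists_max_image (univ : Set α) id (toFinite _) ⟨f, mem_univ f⟩
      refine h.exists_isCircuit (g := g) hef (hg f (mem_univ f)) ?_ (Or.inr hf)
      rintro ⟨k, rfl⟩
      exact not_lt.2 (hg (u k) (mem_univ _)) (hlu k)
    · exact h.exists_isCircuit hef le_rfl hf (Or.inl rfl)
  intro e _ f _ hne
  rcases lt_or_gt_of_ne hne with hlt | hlt
  · exact key e f hlt
  · obtain ⟨C, hC, hf, he⟩ := key f e hlt
    exact ⟨C, hC, he, hf⟩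

end Circuit

end LPM

namespace LPM

open Set

/-! ### From paths to presentations, connectedness and recovery of the paths -/

section Height

variable {n : ℕ} {P Q : LatticePath n}

theorem mem_northSteps {i : Fin n} : i ∈ northSteps P ↔ P i = Step.north := by
  simp [northSteps]

@[simp] theorem height_zero (P : LatticePath n) : height P 0 = 0 := by simp [height]

theorem height_of_le (P : LatticePath n) {k : ℕ} (hk : n ≤ k) :
    height P k = (northSteps P).card := by
  rw [height, Finset.filter_true_of_mem fun i _ => i.2.trans_le hk]

theorem height_mono (P : LatticePath n) : Monotone (height P) := fun _ _ hij =>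
  Finset.card_le_card (Finset.monotone_filter_right _ fun _ _ h => lt_of_lt_of_le h hij)

theorem height_succ (P : LatticePath n) (i : Fin n) :
    height P (i + 1) = height P i + if P i = Step.north then 1 else 0 := by
  classical
  have h : ∀ j : Fin n, (j : ℕ) < i + 1 ↔ (j : ℕ) < i ∨ j = i := fun j => by
    rw [Fin.ext_iff]; omega
  simp only [height, h, Finset.filter_or, Finset.filter_eq', mem_northSteps]
  rw [Finset.card_union_of_disjoint]
  · split_ifs <;> simp
  · rw [Finset.disjoint_left]
    intro j hj hj'
    split_ifs at hj' with hP
    · rw [Finset.mem_singleton] at hj'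
      subst hj'
      simp at hj
    · simp at hj'

theorem height_le (P : LatticePath n) (k : ℕ) : height P k ≤ (northSteps P).card :=
  Finset.card_le_card (Finset.filter_subset _ _)

theorem height_orderEmbOfFin {r : ℕ} (hr : (northSteps P).card = r) (k : Fin r) :
    height P ((northSteps P).orderEmbOfFin hr k) = k := by
  have h : (northSteps P).filter (fun i => i < (northSteps P).orderEmbOfFin hr k) =
      (Finset.Iio k).map ((northSteps P).orderEmbOfFin hr).toEmbedding := by
    ext i
    simp only [Finset.mem_filter, Finset.mem_map, Finset.mem_Iio]
    constructor
    · rintro ⟨hi, hik⟩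
      obtain ⟨j, rfl⟩ : i ∈ Set.range ((northSteps P).orderEmbOfFin hr) := by
        rw [Finset.range_orderEmbOfFin]; exact hi
      exact ⟨j, ((northSteps P).orderEmbOfFin hr).lt_iff_lt.1 hik, rfl⟩
    · rintro ⟨j, hj, rfl⟩
      exact ⟨Finset.orderEmbOfFin_mem _ _ _, ((northSteps P).orderEmbOfFin hr).lt_iff_lt.2 hj⟩
  have := congrArg Finset.card h
  rw [Finset.card_map, Fin.card_Iio] at this
  exact this

theorem orderEmbOfFin_lt_iff {r : ℕ} (hr : (northSteps P).card = r) (k : Fin r) (t : ℕ) :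
    ((northSteps P).orderEmbOfFin hr k : ℕ) < t ↔ (k : ℕ) < height P t := by
  have h1 := height_orderEmbOfFin hr k
  constructor
  · intro h
    have h2 := height_succ P ((northSteps P).orderEmbOfFin hr k)
    rw [if_pos (mem_northSteps.1 (Finset.orderEmbOfFin_mem _ _ _))] at h2
    have h3 := height_mono P (show _ + 1 ≤ t from h)
    omega
  · intro h
    by_contra hlt
    have := height_mono P (not_lt.1 hlt)
    omega

theorem orderEmbOfFin_eq_iff {r : ℕ} (hr : (northSteps P).card = r) (k : Fin r) (i : Fin n) :
    (northSteps P).orderEmbOfFin hr k = i ↔ P i = Step.north ∧ height P i = k := by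
  constructor
  · rintro rfl
    exact ⟨mem_northSteps.1 (Finset.orderEmbOfFin_mem _ _ _), height_orderEmbOfFin hr k⟩
  · rintro ⟨h1, h2⟩
    obtain ⟨j, rfl⟩ : i ∈ Set.range ((northSteps P).orderEmbOfFin hr) := by
      rw [Finset.range_orderEmbOfFin]; exact mem_northSteps.2 h1
    rw [height_orderEmbOfFin] at h2
    rw [Fin.ext h2]

theorem mem_range_orderEmbOfFin {r : ℕ} (hr : (northSteps P).card = r) (i : Fin n) :
    i ∈ Set.range ((northSteps P).orderEmbOfFin hr) ↔ P i = Step.north := by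
  rw [Finset.range_orderEmbOfFin]; exact mem_northSteps

theorem ext_of_height (h : ∀ k ≤ n, height P k = height Q k) : P = Q := by
  funext i
  have h1 := height_succ P i
  have h2 := height_succ Q i
  rw [h _ i.2.le, h _ i.2] at h1
  rw [h1] at h2
  cases hP : P i <;> cases hQ : Q i <;> simp [hP, hQ] at h2 <;> rfl

theorem intervalPresentation (h : NeverAbove P Q) :
    IntervalPresentation (pathPresentation P Q h) ((northSteps Q).orderEmbOfFin h.same_end)
      ((northSteps P).orderEmbOfFin rfl) where
  left_mono := ((northSteps Q).orderEmbOfFin h.same_end).strictMono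
  right_mono := ((northSteps P).orderEmbOfFin rfl).strictMono
  left_le_right k := by
    refine Fin.le_def.2 (Nat.le_of_lt_succ ((orderEmbOfFin_lt_iff h.same_end k _).2 ?_))
    refine lt_of_lt_of_le ?_ (h.height_le _ ((northSteps P).orderEmbOfFin rfl k).2)
    exact (orderEmbOfFin_lt_iff rfl k _).1 (Nat.lt_succ_self _)
  mem_iff _ _ := Iff.rfl

/-- `P` has the same endpoint as `Q` and is below `Q` strictly between the ends. -/
structure StrictlyBelow {n : ℕ} (P Q : LatticePath n) : Prop where
  same_end : (northSteps Q).card = (northSteps P).card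
  height_lt : ∀ k, 0 < k → k < n → height P k < height Q k

theorem StrictlyBelow.neverAbove (h : StrictlyBelow P Q) : NeverAbove P Q where
  same_end := h.same_end
  height_le k hk := by
    rcases Nat.eq_zero_or_pos k with rfl | hk0
    · simp
    rcases hk.eq_or_lt with rfl | hkn
    · rw [height_of_le P le_rfl, height_of_le Q le_rfl, h.same_end]
    · exact (h.height_lt k hk0 hkn).le

/-- The interval with index `height P x` contains `x`, because `height P x < height Q (x + 1)`. A
gap between the intervals `j` and `j + 1` would make `P` as high as `Q` just before the north step
of `Q` with index `j + 1`. -/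
theorem StrictlyBelow.overlappingPresentation (h : StrictlyBelow P Q) (hn : 2 ≤ n) :
    OverlappingPresentation (pathPresentation P Q h.neverAbove)
      ((northSteps Q).orderEmbOfFin h.neverAbove.same_end)
      ((northSteps P).orderEmbOfFin rfl) where
  toIntervalPresentation := intervalPresentation h.neverAbove
  cover x := by
    have hx := x.2
    have hlt : height P x < height Q (x + 1) := by
      rcases Nat.eq_zero_or_pos (x : ℕ) with h0 | h0
      · rw [h0, height_zero]
        exact (Nat.zero_le _).trans_lt (h.height_lt (0 + 1) (by omega) (by omega))
      · exact (h.height_lt x h0 x.2).trans_le (height_mono Q (Nat.le_succ _))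
    have hr := height_le Q (x + 1)
    rw [h.same_end] at hr
    refine ⟨⟨height P x, hlt.trans_le hr⟩, ?_, ?_⟩
    · exact Fin.le_def.2 (Nat.le_of_lt_succ ((orderEmbOfFin_lt_iff _ _ _).2 hlt))
    · refine Fin.le_def.2 (not_lt.1 fun hlt' => ?_)
      exact lt_irrefl _ ((orderEmbOfFin_lt_iff _ _ _).1 hlt')
  overlap j k hjk := by
    refine not_lt.1 fun hlt => ?_
    have hjk' := covBy_iff_val.1 hjk
    have h1 := (orderEmbOfFin_lt_iff rfl j _).1 (Fin.lt_def.1 hlt)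
    have h2 := height_orderEmbOfFin h.neverAbove.same_end k
    have h3 := h.height_lt ((northSteps Q).orderEmbOfFin h.neverAbove.same_end k)
      ((Nat.zero_le _).trans_lt hlt) (Fin.is_lt _)
    omega

/-- If the north steps with index `k` coincided, the paths would share both ends of this step, one
of which is interior as `n ≥ 2`. -/
theorem StrictlyBelow.left_lt_right (h : StrictlyBelow P Q) (hn : 2 ≤ n)
    (k : Fin (northSteps P).card) : (northSteps Q).orderEmbOfFin h.neverAbove.same_end k <
      (northSteps P).orderEmbOfFin rfl k := by
  refine lt_of_le_of_ne ((intervalPresentation h.neverAbove).left_le_right k) fun heq => ?_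
  obtain ⟨h1, h2⟩ := (orderEmbOfFin_eq_iff h.neverAbove.same_end k _).1 heq
  obtain ⟨h3, h4⟩ := (orderEmbOfFin_eq_iff rfl k _).1
    (rfl : (northSteps P).orderEmbOfFin rfl k = _)
  set t := (northSteps P).orderEmbOfFin rfl k
  have h5 := height_succ P t
  have h6 := height_succ Q t
  rw [if_pos h3] at h5
  rw [if_pos h1] at h6
  have ht := t.2
  by_cases h0 : (t : ℕ) = 0
  · have := h.height_lt (t + 1) (by omega) (by omega)
    omega
  · have := h.height_lt t (by omega) ht
    omega

theorem StrictlyBelow.isConnected (h : StrictlyBelow P Q) (hn : 2 ≤ n) :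
    IsConnected (pathMatroid P Q h.neverAbove) :=
  (h.overlappingPresentation hn).isConnected (h.left_lt_right hn)

/-- If the paths meet after `t` steps, every interval lies on one side of `t`. A circuit through the
elements `t - 1` and `t` splits there into two proper, hence independent, parts; their matchings use
different indices and combine, which is absurd. -/
theorem NeverAbove.strictlyBelow_of_isConnected (h : NeverAbove P Q)
    (hc : IsConnected (pathMatroid P Q h)) : StrictlyBelow P Q where
  same_end := h.same_end
  height_lt t ht htn := by
    classical
    refine lt_of_le_of_ne (h.height_le t htn.le) fun heq => ?_
    have hI := intervalPresentation h
    have hside : ∀ k x y, x ∈ pathPresentation P Q h k → y ∈ pathPresentation P Q h k →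
        (x : ℕ) < t → (y : ℕ) < t := by
      intro k x y hx hy hxt
      have h1 := (orderEmbOfFin_lt_iff h.same_end k t).1
        (lt_of_le_of_lt (Fin.le_def.1 ((hI.mem_iff k x).1 hx).1) hxt)
      rw [← heq] at h1
      exact lt_of_le_of_lt (Fin.le_def.1 ((hI.mem_iff k y).1 hy).2)
        ((orderEmbOfFin_lt_iff rfl k t).2 h1)
    obtain ⟨C, hC, he, hf⟩ := hc ⟨t - 1, by omega⟩ (mem_univ _) ⟨t, htn⟩ (mem_univ _)
      (fun h' => by simp only [Fin.mk.injEq] at h'; omega)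
    obtain ⟨f, hf1, hf2⟩ : (pathMatroid P Q h).Indep {x ∈ C | (x : ℕ) < t} :=
      hC.ssubset_indep ((ssubset_iff_of_subset fun x hx => hx.1).2
        ⟨_, hf, fun h' => lt_irrefl _ h'.2⟩)
    obtain ⟨g, hg1, hg2⟩ : (pathMatroid P Q h).Indep {x ∈ C | ¬ (x : ℕ) < t} :=
      hC.ssubset_indep ((ssubset_iff_of_subset fun x hx => hx.1).2
        ⟨_, he, fun h' => h'.2 (by simp only; omega)⟩)
    refine hC.not_indep ⟨fun x => if hx : (x : ℕ) < t then f ⟨x, x.2, hx⟩ else g ⟨x, x.2, hx⟩,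
      fun x y hxy => ?_, fun x => ?_⟩
    · simp only at hxy
      split_ifs at hxy with hx hy hy
      · have := hf1 hxy
        exact Subtype.ext (Subtype.mk.inj this)
      · have h1 := hf2 ⟨x, x.2, hx⟩
        have h2 := hg2 ⟨y, y.2, hy⟩
        rw [hxy] at h1
        exact absurd (hside _ _ _ h1 h2 hx) hy
      · have h1 := hg2 ⟨x, x.2, hx⟩
        have h2 := hf2 ⟨y, y.2, hy⟩
        rw [hxy] at h1
        exact absurd (hside _ _ _ h2 h1 hy) hx
      · have := hg1 hxy
        exact Subtype.ext (Subtype.mk.inj this)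
    · simp only
      split_ifs with hx
      · exact hf2 ⟨x, x.2, hx⟩
      · exact hg2 ⟨x, x.2, hx⟩

theorem rk_pathMatroid_initial (h : NeverAbove P Q) (t : ℕ) :
    rk (pathMatroid P Q h) {x | (x : ℕ) < t} = height Q t := by
  have hI := intervalPresentation h
  have hc : {k : Fin (northSteps P).card |
      ((northSteps Q).orderEmbOfFin h.same_end k : ℕ) < t}.ncard = height Q t := by
    have hr := height_le Q t
    rw [h.same_end] at hr
    have : {k : Fin (northSteps P).card |
        ((northSteps Q).orderEmbOfFin h.same_end k : ℕ) < t} =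
        ((Finset.univ.filter fun k : Fin (northSteps P).card => (k : ℕ) < height Q t :
          Finset _) : Set (Fin (northSteps P).card)) := by
      ext k
      simp [orderEmbOfFin_lt_iff]
    rw [this, ncard_coe_finset, Fin.card_filter_val_lt, min_eq_right hr]
  rw [← hc]
  refine le_antisymm ((rk_le_ncard_nbr _ _).trans (ncard_le_ncard ?_)) ?_
  · rintro k ⟨x, hx, hxt⟩
    exact lt_of_le_of_lt (Fin.le_def.1 ((hI.mem_iff k x).1 hx).1) hxt
  · exact ncard_le_rk_of_injOn hI.left_mono.injective.injOn (fun k _ => hI.left_mem k)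
      fun k hk => hk

theorem rk_pathMatroid_final (h : NeverAbove P Q) (t : ℕ) :
    rk (pathMatroid P Q h) {x | t ≤ (x : ℕ)} + height P t = (northSteps P).card := by
  have hI := intervalPresentation h
  have hc : {k : Fin (northSteps P).card |
      t ≤ ((northSteps P).orderEmbOfFin rfl k : ℕ)}.ncard + height P t = (northSteps P).card := by
    have hr := height_le P t
    have : {k : Fin (northSteps P).card |
        t ≤ ((northSteps P).orderEmbOfFin rfl k : ℕ)}ᶜ =
        ((Finset.univ.filter fun k : Fin (northSteps P).card => (k : ℕ) < height P t :
          Finset _) : Set (Fin (northSteps P).card)) := by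
      ext k
      simp [orderEmbOfFin_lt_iff]
    have h2 := ncard_add_ncard_compl {k : Fin (northSteps P).card |
      t ≤ ((northSteps P).orderEmbOfFin rfl k : ℕ)}
    rw [this, ncard_coe_finset, Fin.card_filter_val_lt, min_eq_right hr, Nat.card_fin] at h2
    exact h2
  rw [← hc]
  congr 1
  refine le_antisymm ((rk_le_ncard_nbr _ _).trans (ncard_le_ncard ?_)) ?_
  · rintro k ⟨x, hx, hxt⟩
    exact le_trans hxt (Fin.le_def.1 ((hI.mem_iff k x).1 hx).2)
  · exact ncard_le_rk_of_injOn hI.right_mono.injective.injOn (fun k _ => hI.right_mem k)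
      fun k hk => hk

/-- Ranks of initial segments are the heights of `Q`, and ranks of final segments are what `P` still
has to climb. -/
theorem pathMatroid_injective {P' Q' : LatticePath n} (h : NeverAbove P Q)
    (h' : NeverAbove P' Q') (heq : pathMatroid P Q h = pathMatroid P' Q' h') :
    P = P' ∧ Q = Q' := by
  have hQ : Q = Q' := ext_of_height fun k _ => by
    rw [← rk_pathMatroid_initial h, heq, rk_pathMatroid_initial h']
  refine ⟨ext_of_height fun k _ => ?_, hQ⟩
  have h1 := rk_pathMatroid_final h k
  have h2 := rk_pathMatroid_final h' k
  have h3 := h.same_end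
  have h4 := h'.same_end
  rw [← hQ] at h4
  rw [heq] at h1
  omega

theorem StrictlyBelow.configurationUnique_iff (h : StrictlyBelow P Q) (hn : 2 ≤ n) :
    ConfigurationUnique (pathMatroid P Q h.neverAbove) ↔ ∀ m m', ¬ IsFlexiblePair
      ((northSteps Q).orderEmbOfFin h.neverAbove.same_end) ((northSteps P).orderEmbOfFin rfl)
      m m' :=
  ⟨fun hu _ _ hf => (h.overlappingPresentation hn).not_configurationUnique hf hu,
    fun hf => (h.overlappingPresentation hn).configurationUnique hf⟩

theorem ncard_connectedLpms_eq (hn : 2 ≤ n) : (connectedLpms n).ncard =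
    {p : LatticePath n × LatticePath n | StrictlyBelow p.1 p.2}.ncard := by
  refine (ncard_congr (s := {p : LatticePath n × LatticePath n | StrictlyBelow p.1 p.2})
    (fun p hp => pathMatroid p.1 p.2 (StrictlyBelow.neverAbove hp)) ?_ ?_ ?_).symm
  · exact fun p hp => ⟨⟨_, _, _, rfl⟩, StrictlyBelow.isConnected hp hn⟩
  · intro p q hp hq h
    obtain ⟨h1, h2⟩ := pathMatroid_injective _ _ h
    exact Prod.ext h1 h2
  · rintro M ⟨⟨P, Q, h, rfl⟩, hc⟩
    exact ⟨(P, Q), h.strictlyBelow_of_isConnected hc, rfl⟩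

theorem ncard_uniqueConnectedLpms_eq (hn : 2 ≤ n) : (uniqueConnectedLpms n).ncard =
    {p : LatticePath n × LatticePath n | ∃ h : StrictlyBelow p.1 p.2, ∀ m m', ¬ IsFlexiblePair
      ((northSteps p.2).orderEmbOfFin h.neverAbove.same_end)
      ((northSteps p.1).orderEmbOfFin rfl) m m'}.ncard := by
  refine (ncard_congr
    (s := {p : LatticePath n × LatticePath n | ∃ h : StrictlyBelow p.1 p.2, ∀ m m',
      ¬ IsFlexiblePair ((northSteps p.2).orderEmbOfFin h.neverAbove.same_end)
        ((northSteps p.1).orderEmbOfFin rfl) m m'})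
    (fun p hp => pathMatroid p.1 p.2 (StrictlyBelow.neverAbove hp.fst)) ?_ ?_ ?_).symm
  · exact fun p hp => ⟨⟨_, _, _, rfl⟩, hp.fst.isConnected hn,
      (hp.fst.configurationUnique_iff hn).2 hp.snd⟩
  · intro p q hp hq h
    obtain ⟨h1, h2⟩ := pathMatroid_injective _ _ h
    exact Prod.ext h1 h2
  · rintro M ⟨⟨P, Q, h, rfl⟩, hc, hu⟩
    have hs := h.strictlyBelow_of_isConnected hc
    exact ⟨(P, Q), ⟨hs, (hs.configurationUnique_iff hn).1 hu⟩, rfl⟩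

end Height

end LPM

namespace LPM

open Set

/-! ### Words and the coordinates of corners -/

section Lists

/-- The list `w` passes the corner `(x, y)` between a north step and an east step. -/
def NECorner (w : List Step) (x y : ℕ) : Prop :=
  ∃ a b, w = a ++ Step.north :: Step.east :: b ∧ a.count Step.east = x ∧ a.count Step.north + 1 = y

/-- The list `w` passes the corner `(x, y)` between an east step and a north step. -/
def ENCorner (w : List Step) (x y : ℕ) : Prop :=
  ∃ a b, w = a ++ Step.east :: Step.north :: b ∧ a.count Step.east + 1 = x ∧ a.count Step.north = y

theorem count_north_add_count_east (w : List Step) :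
    w.count Step.north + w.count Step.east = w.length := by
  induction w with
  | nil => rfl
  | cons s w ih => cases s <;> simp <;> omega

variable {n : ℕ} {P Q : LatticePath n}

theorem count_take_ofFn (P : LatticePath n) (t : ℕ) :
    ((List.ofFn P).take t).count Step.north = height P t := by
  induction t with
  | zero => simp
  | succ t ih =>
    rw [List.take_add_one, List.count_append, ih]
    rcases lt_or_ge t n with ht | ht
    · rw [height_succ P ⟨t, ht⟩]
      simp only [List.getElem?_ofFn, ht, dite_true, Option.toList_some]
      cases P ⟨t, ht⟩ <;> simp
    · rw [height_of_le P ht, height_of_le P (ht.trans t.le_succ)]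
      simp [ht.not_gt]

theorem count_ofFn (P : LatticePath n) :
    (List.ofFn P).count Step.north = (northSteps P).card := by
  rw [← height_of_le P le_rfl, ← count_take_ofFn, List.take_of_length_le (by simp)]

theorem ofFn_eq_append_iff (P : LatticePath n) (c d : Step) (x y : ℕ) :
    (∃ a b, List.ofFn P = a ++ c :: d :: b ∧ a.count Step.east = x ∧ a.count Step.north = y) ↔
      ∃ i j : Fin n, i ⋖ j ∧ P i = c ∧ P j = d ∧ height P i = y ∧ (i : ℕ) = x + y := by
  constructor
  · rintro ⟨a, b, h, hx, hy⟩
    have hlen := congrArg List.length h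
    have hc := count_north_add_count_east a
    simp only [List.length_ofFn, List.length_append, List.length_cons] at hlen
    refine ⟨⟨a.length, by omega⟩, ⟨a.length + 1, by omega⟩, covBy_iff_val.2 rfl, ?_, ?_, ?_, ?_⟩
    · have : (List.ofFn P)[a.length]? = some c := by simp [h]
      simpa [List.getElem?_ofFn, show a.length < n by omega] using this
    · have : (List.ofFn P)[a.length + 1]? = some d := by simp [h]
      simpa [List.getElem?_ofFn, show a.length + 1 < n by omega] using this
    · rw [← count_take_ofFn, h]; simpa using hy
    · simp only; omega
  · rintro ⟨i, j, hij, hc, hd, hy, hi⟩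
    have hij' := covBy_iff_val.1 hij
    have hc' := count_north_add_count_east ((List.ofFn P).take i)
    have hi2 := i.2
    have hj2 := j.2
    rw [count_take_ofFn, List.length_take, List.length_ofFn, min_eq_left hi2.le] at hc'
    refine ⟨(List.ofFn P).take i, (List.ofFn P).drop (i + 2), ?_, by omega, by
      rw [count_take_ofFn, hy]⟩
    have h1 : (List.ofFn P)[(i : ℕ)]'(by simp) = c := by simpa using hc
    have h2 : (List.ofFn P)[(i : ℕ) + 1]'(by simp; omega) = d := by
      simp only [List.getElem_ofFn]
      rw [← hd]; congr 1; exact Fin.ext hij'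
    rw [← h1, ← h2, List.getElem_cons_drop, List.getElem_cons_drop, List.take_append_drop]

theorem isLeftCorner_iff {r : ℕ} (hr : (northSteps Q).card = r) (m : Fin r) (x : ℕ) :
    (IsLeftCorner ((northSteps Q).orderEmbOfFin hr) m ∧
      ((northSteps Q).orderEmbOfFin hr m : ℕ) = x + m) ↔ ENCorner (List.ofFn Q) x m := by
  have h : ENCorner (List.ofFn Q) x m ↔ ∃ x', x = x' + 1 ∧ ∃ a b, List.ofFn Q =
      a ++ Step.east :: Step.north :: b ∧ a.count Step.east = x' ∧ a.count Step.north = m := by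
    constructor
    · rintro ⟨a, b, h1, rfl, h3⟩
      exact ⟨_, rfl, a, b, h1, rfl, h3⟩
    · rintro ⟨_, rfl, a, b, h1, rfl, h3⟩
      exact ⟨a, b, h1, rfl, h3⟩
  simp only [h, ofFn_eq_append_iff]
  constructor
  · rintro ⟨⟨i, hi, hir⟩, hx⟩
    obtain ⟨h1, h2⟩ := (orderEmbOfFin_eq_iff hr m _).1 rfl
    have hi' := covBy_iff_val.1 hi
    have hiE : Q i = Step.east := by
      rw [mem_range_orderEmbOfFin] at hir
      cases hQ : Q i
      · exact absurd hQ hir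
      · rfl
    have h3 := height_succ Q i
    rw [hiE, hi', h2] at h3
    simp only [reduceCtorEq, if_false, add_zero] at h3
    have h4 : height Q i ≤ i := by
      have := count_north_add_count_east ((List.ofFn Q).take i)
      rw [count_take_ofFn, List.length_take] at this
      omega
    exact ⟨x - 1, by omega, i, _, hi, hiE, h1, h3.symm, by omega⟩
  · rintro ⟨x', rfl, i, j, hij, h1, h2, h3, h4⟩
    have hi' := covBy_iff_val.1 hij
    have h5 := height_succ Q i
    rw [h1, h3, hi'] at h5
    simp only [reduceCtorEq, if_false, add_zero] at h5
    rw [(orderEmbOfFin_eq_iff hr m j).2 ⟨h2, h5⟩]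
    refine ⟨⟨i, ?_, ?_⟩, by omega⟩
    · rwa [(orderEmbOfFin_eq_iff hr m j).2 ⟨h2, h5⟩]
    · rw [mem_range_orderEmbOfFin, h1]; simp

theorem isRightCorner_iff {r : ℕ} (hr : (northSteps P).card = r) (m : Fin r) (x : ℕ) :
    (IsRightCorner ((northSteps P).orderEmbOfFin hr) m ∧
      ((northSteps P).orderEmbOfFin hr m : ℕ) = x + m) ↔ NECorner (List.ofFn P) x (m + 1) := by
  simp only [NECorner, add_left_inj, ofFn_eq_append_iff]
  constructor
  · rintro ⟨⟨j, hj, hjr⟩, hx⟩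
    obtain ⟨h1, h2⟩ := (orderEmbOfFin_eq_iff hr m _).1 rfl
    have hjE : P j = Step.east := by
      rw [mem_range_orderEmbOfFin] at hjr
      cases hP : P j
      · exact absurd hP hjr
      · rfl
    exact ⟨_, j, hj, h1, hjE, h2, hx⟩
  · rintro ⟨i, j, hij, h1, h2, h3, h4⟩
    have h := (orderEmbOfFin_eq_iff hr m i).2 ⟨h1, h3⟩
    refine ⟨⟨j, by rwa [h], ?_⟩, by rw [h, h4]⟩
    rw [mem_range_orderEmbOfFin, h2]; simp

/-- In coordinates `l m = x + m` with `y = m`, and `u m' = x' + m'` with `y' = m' + 1`, since a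
lower corner is at the end of its north step. So a flexible pair means `x < x'` and `y' < y`. -/
theorem forall_not_isFlexiblePair_iff (h : (northSteps Q).card = (northSteps P).card) :
    (∀ m m', ¬ IsFlexiblePair ((northSteps Q).orderEmbOfFin h)
      ((northSteps P).orderEmbOfFin rfl) m m') ↔
    ∀ x y x' y', ENCorner (List.ofFn Q) x y → NECorner (List.ofFn P) x' y' → x < x' → y ≤ y' := by
  constructor
  · intro hf x y x' y' hc hd hx
    have hy : y < (northSteps P).card := by
      obtain ⟨a, b, hw, -, rfl⟩ := hc
      rw [← h, ← count_ofFn, hw]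
      simp
    have hy' : 1 ≤ y' ∧ y' ≤ (northSteps P).card := by
      obtain ⟨a, b, hw, -, rfl⟩ := hd
      rw [← count_ofFn, hw]
      simp
    by_contra! hlt
    obtain ⟨y', rfl⟩ : ∃ k, y' = k + 1 := ⟨y' - 1, by omega⟩
    obtain ⟨h1, h2⟩ := (isLeftCorner_iff h ⟨y, hy⟩ x).2 hc
    obtain ⟨h3, h4⟩ := (isRightCorner_iff rfl ⟨y', by omega⟩ x').2 hd
    refine hf _ _ ⟨h1, h3, hlt, ?_⟩
    rw [h2, h4]
    simp only
    omega
  · intro hf m m' hfl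
    have hle : ∀ (R : LatticePath n) (r : ℕ) (hr : (northSteps R).card = r) (k : Fin r),
        (k : ℕ) ≤ (northSteps R).orderEmbOfFin hr k := by
      intro R r hr k
      rw [← height_orderEmbOfFin hr k]
      have := count_north_add_count_east ((List.ofFn R).take ((northSteps R).orderEmbOfFin hr k))
      rw [count_take_ofFn, List.length_take] at this
      omega
    have h1 := hle Q _ h m
    have h2 := hle P _ rfl m'
    have h3 := (isLeftCorner_iff h m ((northSteps Q).orderEmbOfFin h m - m)).1
      ⟨hfl.left_corner, by omega⟩
    have h4 := (isRightCorner_iff rfl m' ((northSteps P).orderEmbOfFin rfl m' - m')).1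
      ⟨hfl.right_corner, by omega⟩
    have h5 := hfl.lt
    have h6 := hfl.add_lt
    have := hf _ _ _ _ h3 h4 (by omega)
    omega

/-- Two words of the same length with equally many north steps, the first strictly below the
second strictly between the ends. -/
def StrictlyBelowList (P Q : List Step) : Prop :=
  P.count Step.north = Q.count Step.north ∧
    ∀ t, 0 < t → t < P.length → (P.take t).count Step.north < (Q.take t).count Step.north

theorem strictlyBelow_iff : StrictlyBelow P Q ↔ StrictlyBelowList (List.ofFn P) (List.ofFn Q) := by
  simp only [StrictlyBelowList, count_take_ofFn, count_ofFn, List.length_ofFn]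
  exact ⟨fun h => ⟨h.1.symm, h.2⟩, fun h => ⟨h.1.symm, h.2⟩⟩

theorem ncard_ofFn (n : ℕ) (R : List Step → List Step → Prop) :
    {p : LatticePath n × LatticePath n | R (List.ofFn p.1) (List.ofFn p.2)}.ncard =
      {p : List Step × List Step | p.1.length = n ∧ p.2.length = n ∧ R p.1 p.2}.ncard := by
  rw [← ncard_image_of_injective (f := Prod.map List.ofFn List.ofFn) _
    (List.ofFn_injective.prodMap List.ofFn_injective)]
  congr 1
  ext ⟨P, Q⟩
  constructor
  · rintro ⟨⟨p, q⟩, hpq, h⟩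
    obtain ⟨rfl, rfl⟩ := Prod.mk.inj h
    exact ⟨by simp, by simp, hpq⟩
  · rintro ⟨rfl, h2, h3⟩
    have hP : List.ofFn P.get = P := List.ofFn_get P
    have hQ : List.ofFn (fun i : Fin P.length => Q.get (Fin.cast h2.symm i)) = Q := by
      have := List.ofFn_get Q
      rw [List.ofFn_congr h2] at this
      exact this
    exact ⟨(P.get, fun i => Q.get (Fin.cast h2.symm i)), by
      simp only [mem_ofPred_eq]; rw [hP, hQ]; exact h3, Prod.ext hP hQ⟩

end Lists

end LPM

namespace LPM

open Set

/-! ### Strictly separated pairs as Dyck words -/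

section Dyck

/-- The letter that raises the distance between two paths when it is a step of the lower one. -/
def Step.toDyckLower : Step → DyckStep
  | .north => .D
  | .east => .U

/-- The letter that raises the distance between two paths when it is a step of the upper one. -/
def Step.toDyckUpper : Step → DyckStep
  | .north => .U
  | .east => .D

/-- The steps of two words, alternately, starting with the first. -/
def interleave : List Step → List Step → List DyckStep
  | p :: P, q :: Q => p.toDyckLower :: q.toDyckUpper :: interleave P Q
  | _, _ => []

theorem length_interleave (P Q : List Step) (h : P.length = Q.length) :
    (interleave P Q).length = 2 * P.length := by
  induction P generalizing Q with
  | nil => simp [interleave]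
  | cons p P ih =>
    cases Q with
    | nil => simp at h
    | cons q Q =>
      simp only [List.length_cons, add_left_inj] at h
      simp only [interleave, List.length_cons, ih Q h]
      ring

theorem interleave_injective {P Q P' Q' : List Step} (h : P.length = Q.length)
    (h' : P'.length = Q'.length) (heq : interleave P Q = interleave P' Q') : P = P' ∧ Q = Q' := by
  induction P generalizing Q P' Q' with
  | nil =>
    obtain rfl : Q = [] := List.length_eq_zero_iff.1 h.symm
    have hl := congrArg List.length heq
    rw [length_interleave _ _ rfl, length_interleave _ _ h'] at hl
    obtain rfl : P' = [] := List.length_eq_zero_iff.1 (by simp at hl; simpa using hl.symm)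
    obtain rfl : Q' = [] := List.length_eq_zero_iff.1 h'.symm
    exact ⟨rfl, rfl⟩
  | cons p P ih =>
    cases Q with
    | nil => simp at h
    | cons q Q =>
      cases P' with
      | nil => simp [interleave] at heq
      | cons p' P' =>
        cases Q' with
        | nil => simp at h'
        | cons q' Q' =>
          simp only [interleave, List.cons.injEq] at heq
          simp only [List.length_cons, add_left_inj] at h h'
          obtain ⟨rfl, rfl⟩ := ih h h' heq.2.2
          refine ⟨congrArg (· :: _) ?_, congrArg (· :: _) ?_⟩
          · cases p <;> cases p' <;> simp_all [Step.toDyckLower]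
          · cases q <;> cases q' <;> simp_all [Step.toDyckUpper]

theorem exists_interleave (k : ℕ) (w : List DyckStep) (hw : w.length = 2 * k) :
    ∃ P Q : List Step, P.length = k ∧ Q.length = k ∧ interleave P Q = w := by
  induction k generalizing w with
  | zero => exact ⟨[], [], rfl, rfl, (List.length_eq_zero_iff.1 hw).symm⟩
  | succ k ih =>
    match w, hw with
    | a :: b :: w, hw =>
      obtain ⟨P, Q, hP, hQ, rfl⟩ := ih w (by simp only [List.length_cons] at hw; omega)
      have ha : ∃ p : Step, p.toDyckLower = a := by
        cases a
        exacts [⟨.east, rfl⟩, ⟨.north, rfl⟩]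
      have hb : ∃ q : Step, q.toDyckUpper = b := by
        cases b
        exacts [⟨.north, rfl⟩, ⟨.east, rfl⟩]
      obtain ⟨p, rfl⟩ := ha
      obtain ⟨q, rfl⟩ := hb
      exact ⟨p :: P, q :: Q, by simp [hP], by simp [hQ], rfl⟩

theorem count_take_even_interleave (P Q : List Step) (h : P.length = Q.length) (t : ℕ) :
    ((interleave P Q).take (2 * t)).count .U =
        (P.take t).count .east + (Q.take t).count .north ∧
      ((interleave P Q).take (2 * t)).count .D =
        (P.take t).count .north + (Q.take t).count .east := by
  induction P generalizing Q t with
  | nil =>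
    obtain rfl : Q = [] := List.length_eq_zero_iff.1 h.symm
    simp [interleave]
  | cons p P ih =>
    cases Q with
    | nil => simp at h
    | cons q Q =>
      cases t with
      | zero => simp
      | succ t =>
        simp only [List.length_cons, add_left_inj] at h
        obtain ⟨h1, h2⟩ := ih Q h t
        simp only [interleave, Nat.mul_succ, List.take_succ_cons, List.count_cons, h1, h2]
        cases p <;> cases q <;> simp [Step.toDyckLower, Step.toDyckUpper] <;> omega

theorem count_take_odd_interleave (P Q : List Step) (h : P.length = Q.length) (t : ℕ)
    (ht : t < P.length) :
    ((interleave P Q).take (2 * t + 1)).count .U =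
        (P.take (t + 1)).count .east + (Q.take t).count .north ∧
      ((interleave P Q).take (2 * t + 1)).count .D =
        (P.take (t + 1)).count .north + (Q.take t).count .east := by
  induction P generalizing Q t with
  | nil => simp at ht
  | cons p P ih =>
    cases Q with
    | nil => simp at h
    | cons q Q =>
      cases t with
      | zero => cases p <;> simp [interleave, Step.toDyckLower]
      | succ t =>
        simp only [List.length_cons, add_left_inj, add_lt_add_iff_right] at h ht
        obtain ⟨h1, h2⟩ := ih Q h t ht
        rw [show 2 * (t + 1) + 1 = 2 * t + 1 + 1 + 1 by ring, interleave, List.take_succ_cons,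
          List.take_succ_cons, List.take_succ_cons, List.take_succ_cons (as := Q)]
        simp only [List.count_cons, h1, h2]
        cases p <;> cases q <;> simp [Step.toDyckLower, Step.toDyckUpper] <;> omega

theorem count_take_north_add {w : List Step} {t : ℕ} (ht : t ≤ w.length) :
    (w.take t).count Step.north + (w.take t).count Step.east = t := by
  rw [count_north_add_count_east, List.length_take, min_eq_left ht]

/-- The added north steps shift `Q` against `P` by one place and make the inequality weak. A prefix
of length `2 * t + 1` has excess one plus twice the lead of `Q.take t` over `P.take (t + 1)` in
north steps, so the odd prefixes express the separation; the even ones follow. -/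
theorem strictlyBelowList_iff (P Q : List Step) (h : P.length = Q.length) :
    StrictlyBelowList (P ++ [Step.north]) (Step.north :: Q) ↔
      (interleave P Q).count .U = (interleave P Q).count .D ∧
      ∀ i, ((interleave P Q).take i).count .D ≤ ((interleave P Q).take i).count .U := by
  have hl := length_interleave P Q h
  have hfull : (interleave P Q).take (2 * P.length) = interleave P Q :=
    List.take_of_length_le hl.le
  have heven := count_take_even_interleave P Q h
  have hodd := count_take_odd_interleave P Q h
  have hend := heven P.length
  rw [hfull, List.take_length, h, List.take_length] at hend
  have hcP := count_north_add_count_east P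
  have hcQ := count_north_add_count_east Q
  have hP : ∀ t, t ≤ P.length → (P.take t).count Step.north + (P.take t).count Step.east = t :=
    fun t ht => count_take_north_add ht
  have hQ : ∀ t, t ≤ P.length → (Q.take t).count Step.north + (Q.take t).count Step.east = t :=
    fun t ht => count_take_north_add (h ▸ ht)
  have hsucc : ∀ t, (P.take (t + 1)).count Step.north ≤ (P.take t).count Step.north + 1 ∧
      (Q.take t).count Step.north ≤ (Q.take (t + 1)).count Step.north := by
    intro t
    constructor
    · rw [List.take_add_one, List.count_append]
      have : (P[t]?.toList).count Step.north ≤ 1 := by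
        refine List.count_le_length.trans ?_
        cases P[t]? <;> simp
      omega
    · exact (List.take_sublist_take_left t.le_succ).count_le _
  have hsb : StrictlyBelowList (P ++ [Step.north]) (Step.north :: Q) ↔
      P.count Step.north = Q.count Step.north ∧ ∀ t, t < P.length →
        (P.take (t + 1)).count Step.north ≤ (Q.take t).count Step.north := by
    simp only [StrictlyBelowList, List.count_append, List.count_cons, List.length_append]
    constructor
    · rintro ⟨h1, h2⟩
      refine ⟨by simpa using h1, fun t ht => ?_⟩
      have := h2 (t + 1) (by omega) (by simp; omega)
      rw [List.take_append_of_le_length (by omega), List.take_succ_cons] at this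
      simp at this
      omega
    · rintro ⟨h1, h2⟩
      refine ⟨by simpa using h1, fun t ht0 ht => ?_⟩
      obtain ⟨t, rfl⟩ : ∃ s, t = s + 1 := ⟨t - 1, by omega⟩
      simp at ht
      have := h2 t (by omega)
      rw [List.take_append_of_le_length (by omega), List.take_succ_cons]
      simp
      omega
  rw [hsb]
  constructor
  · rintro ⟨h1, h2⟩
    refine ⟨by omega, fun i => ?_⟩
    rcases le_or_gt (2 * P.length) i with hi | hi
    · rw [List.take_of_length_le (by omega)]
      omega
    rcases Nat.even_or_odd' i with ⟨t, rfl | rfl⟩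
    · have h3 := heven t
      have h4 := hP t (by omega)
      have h5 := hQ t (by omega)
      rcases Nat.eq_zero_or_pos t with rfl | ht
      · simp
      · obtain ⟨t, rfl⟩ : ∃ s, t = s + 1 := ⟨t - 1, by omega⟩
        have h6 := h2 t (by omega)
        have h7 := hsucc t
        omega
    · have h3 := hodd t (by omega)
      have h4 := hP (t + 1) (by omega)
      have h5 := hQ t (by omega)
      have h6 := h2 t (by omega)
      omega
  · rintro ⟨h1, h2⟩
    refine ⟨by omega, fun t ht => ?_⟩
    have h3 := hodd t ht
    have h4 := hP (t + 1) (by omega)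
    have h5 := hQ t (by omega)
    have h6 := h2 (2 * t + 1)
    omega

/-- Separation just before the common end forces the last step of `P` to be north, and separation
after one step forces the first step of `Q`. -/
theorem StrictlyBelowList.exists_eq {P Q : List Step} {k : ℕ} (h : StrictlyBelowList P Q)
    (hP : P.length = k + 2) (hQ : Q.length = k + 2) : ∃ P' Q' : List Step, P'.length = k + 1 ∧
      Q'.length = k + 1 ∧ P = P' ++ [Step.north] ∧ Q = Step.north :: Q' := by
  obtain ⟨h1, h2⟩ := h
  obtain ⟨q, Q', rfl⟩ := List.exists_cons_of_length_eq_add_one hQ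
  have hPne : P ≠ [] := by rintro rfl; simp at hP
  obtain ⟨P', p, rfl⟩ : ∃ P' p, P = P' ++ [p] := ⟨_, _, (List.dropLast_append_getLast hPne).symm⟩
  simp only [List.length_append, List.length_cons, List.length_nil] at hP hQ
  refine ⟨P', Q', by omega, by omega, ?_, ?_⟩
  · cases p
    · rfl
    · have h3 := h2 (k + 1) (by omega) (by simp; omega)
      rw [List.take_append_of_le_length (by omega), List.take_of_length_le (by omega)] at h3
      have h4 := ((q :: Q').take_sublist (k + 1)).count_le Step.north
      simp only [List.count_append, List.count_singleton] at h1
      simp at h1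
      omega
  · cases q
    · rfl
    · have h3 := h2 1 (by omega) (by simp; omega)
      simp at h3

theorem ncard_strictlyBelowList (k : ℕ) : {p : List Step × List Step |
    p.1.length = k + 2 ∧ p.2.length = k + 2 ∧ StrictlyBelowList p.1 p.2}.ncard =
    catalan (k + 1) := by
  set U : Set (List Step × List Step) := {p | p.1.length = k + 1 ∧ p.2.length = k + 1 ∧
    StrictlyBelowList (p.1 ++ [Step.north]) (Step.north :: p.2)} with hU
  have h1 : {p : List Step × List Step |
      p.1.length = k + 2 ∧ p.2.length = k + 2 ∧ StrictlyBelowList p.1 p.2} =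
      (fun p => (p.1 ++ [Step.north], Step.north :: p.2)) '' U := by
    ext ⟨P, Q⟩
    constructor
    · rintro ⟨hP, hQ, h⟩
      obtain ⟨P', Q', hP', hQ', rfl, rfl⟩ := h.exists_eq hP hQ
      exact ⟨(P', Q'), ⟨hP', hQ', h⟩, rfl⟩
    · rintro ⟨⟨P', Q'⟩, ⟨hP', hQ', h⟩, heq⟩
      obtain ⟨rfl, rfl⟩ := Prod.mk.inj heq
      exact ⟨by simpa using hP', by simpa using hQ', h⟩
  have h2 : DyckWord.toList '' {w | w.semilength = k + 1} = (fun p => interleave p.1 p.2) '' U := by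
    ext w
    constructor
    · rintro ⟨w, hw, rfl⟩
      obtain ⟨P, Q, hP, hQ, hPQ⟩ := exists_interleave (k + 1) w.toList
        (by rw [← w.two_mul_semilength_eq_length, hw])
      refine ⟨(P, Q), ⟨hP, hQ, (strictlyBelowList_iff P Q (hP.trans hQ.symm)).2 ?_⟩, hPQ⟩
      rw [hPQ]
      exact ⟨w.count_U_eq_count_D, w.count_D_le_count_U⟩
    · rintro ⟨⟨P, Q⟩, ⟨hP, hQ, h⟩, rfl⟩
      obtain ⟨h3, h4⟩ := (strictlyBelowList_iff P Q (hP.trans hQ.symm)).1 h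
      refine ⟨⟨_, h3, h4⟩, ?_, rfl⟩
      have h5 := (⟨_, h3, h4⟩ : DyckWord).two_mul_semilength_eq_length
      rw [length_interleave P Q (hP.trans hQ.symm), hP] at h5
      exact Nat.eq_of_mul_eq_mul_left two_pos h5
  have h3 : InjOn (fun p : List Step × List Step => interleave p.1 p.2) U := by
    rintro ⟨P, Q⟩ ⟨hP, hQ, -⟩ ⟨P', Q'⟩ ⟨hP', hQ', -⟩ h
    obtain ⟨rfl, rfl⟩ := interleave_injective (hP.trans hQ.symm) (hP'.trans hQ'.symm) h
    rfl
  have h4 :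
      (fun p : List Step × List Step => (p.1 ++ [Step.north], Step.north :: p.2)).Injective := by
    rintro ⟨P, Q⟩ ⟨P', Q'⟩ h
    simpa using h
  rw [← DyckWord.card_dyckWord_semilength_eq_catalan, ← Nat.card_eq_fintype_card, h1,
    ncard_image_of_injective _ h4, ← h3.ncard_image, ← h2,
    ncard_image_of_injective _ fun _ _ => DyckWord.ext, ← Nat.card_coe_set_eq]
  rfl

theorem ncard_connectedLpms {n : ℕ} (hn : 2 ≤ n) :
    (connectedLpms n).ncard = catalan (n - 1) := by
  obtain ⟨k, rfl⟩ : ∃ k, n = k + 2 := ⟨n - 2, by omega⟩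
  rw [ncard_connectedLpms_eq hn]
  simp only [strictlyBelow_iff]
  rw [ncard_ofFn, ncard_strictlyBelowList]
  rfl

end Dyck

end LPM

namespace LPM

open Set

/-! ### Corners under elementary changes of a word -/

section Corners

variable {P Q w : List Step} {x y : ℕ}

theorem enCorner_nil : ¬ ENCorner [] x y := by
  rintro ⟨a, b, h, -⟩
  simp at h

theorem neCorner_nil : ¬ NECorner [] x y := by
  rintro ⟨a, b, h, -⟩
  simp at h

theorem enCorner_north_cons :
    ENCorner (.north :: w) x y ↔ ∃ y', y = y' + 1 ∧ ENCorner w x y' := by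
  constructor
  · rintro ⟨a, b, h, rfl, rfl⟩
    cases a with
    | nil => simp at h
    | cons s a =>
      simp only [List.cons_append, List.cons.injEq] at h
      obtain ⟨rfl, rfl⟩ := h
      exact ⟨a.count .north, by simp, a, b, rfl, by simp, rfl⟩
  · rintro ⟨_, rfl, a, b, rfl, rfl, rfl⟩
    exact ⟨.north :: a, b, rfl, by simp, by simp⟩

theorem enCorner_east_cons : ENCorner (.east :: w) x y ↔
    ((∃ v, w = .north :: v) ∧ x = 1 ∧ y = 0) ∨ ∃ x', x = x' + 1 ∧ ENCorner w x' y := by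
  constructor
  · rintro ⟨a, b, h, rfl, rfl⟩
    cases a with
    | nil =>
      simp only [List.nil_append, List.cons.injEq, true_and] at h
      exact Or.inl ⟨⟨b, h⟩, rfl, rfl⟩
    | cons s a =>
      simp only [List.cons_append, List.cons.injEq] at h
      obtain ⟨rfl, rfl⟩ := h
      exact Or.inr ⟨a.count .east + 1, by simp, a, b, rfl, rfl, by simp⟩
  · rintro (⟨⟨v, rfl⟩, rfl, rfl⟩ | ⟨_, rfl, a, b, rfl, rfl, rfl⟩)
    · exact ⟨[], v, rfl, rfl, rfl⟩
    · exact ⟨.east :: a, b, rfl, by simp, by simp⟩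

/-- The word with the two letters exchanged. -/
def Step.swap : Step → Step
  | .north => .east
  | .east => .north

theorem Step.swap_involutive : Function.Involutive Step.swap := fun s => by cases s <;> rfl

theorem count_map_swap (w : List Step) : (w.map Step.swap).count .north = w.count .east ∧
    (w.map Step.swap).count .east = w.count .north := by
  induction w with
  | nil => simp
  | cons s w ih => cases s <;> simp [Step.swap, ih.1, ih.2]

theorem map_swap_map_swap (w : List Step) : (w.map Step.swap).map Step.swap = w := by
  rw [List.map_map, Step.swap_involutive.comp_self, List.map_id]

theorem enCorner_map_swap : ENCorner (w.map Step.swap) x y ↔ NECorner w y x := by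
  constructor
  · rintro ⟨a, b, h, rfl, rfl⟩
    refine ⟨a.map Step.swap, b.map Step.swap, ?_, (count_map_swap a).2, ?_⟩
    · rw [← map_swap_map_swap w, h]
      simp [Step.swap]
    · rw [(count_map_swap a).1]
  · rintro ⟨a, b, rfl, rfl, rfl⟩
    refine ⟨a.map Step.swap, b.map Step.swap, by simp [Step.swap], ?_, (count_map_swap a).1⟩
    rw [(count_map_swap a).2]

theorem neCorner_map_swap : NECorner (w.map Step.swap) x y ↔ ENCorner w y x := by
  rw [← enCorner_map_swap, map_swap_map_swap]

theorem neCorner_east_cons :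
    NECorner (.east :: w) x y ↔ ∃ x', x = x' + 1 ∧ NECorner w x' y := by
  simp only [← enCorner_map_swap, List.map_cons, Step.swap, enCorner_north_cons]

theorem neCorner_north_cons : NECorner (.north :: w) x y ↔
    ((∃ v, w = .east :: v) ∧ x = 0 ∧ y = 1) ∨ ∃ y', y = y' + 1 ∧ NECorner w x y' := by
  have h : (∃ v, w.map Step.swap = .north :: v) ↔ ∃ v, w = .east :: v := by
    cases w with
    | nil => simp
    | cons s w => cases s <;> simp [Step.swap]
  simp only [← enCorner_map_swap, List.map_cons, Step.swap, enCorner_east_cons, h]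
  tauto

theorem ENCorner.pos (h : ENCorner w x y) : 1 ≤ x := by
  obtain ⟨a, b, -, rfl, -⟩ := h
  omega

theorem NECorner.pos (h : NECorner w x y) : 1 ≤ y := by
  obtain ⟨a, b, -, -, rfl⟩ := h
  omega

/-- The run of east steps through the marked one ends in a corner, because a north step still
follows. -/
theorem exists_enCorner (a : List Step) {b : List Step} (h : .north ∈ b) :
    ∃ x, ENCorner (a ++ .east :: b) x (a.count .north) ∧ a.count .east + 1 ≤ x := by
  induction b generalizing a with
  | nil => simp at h
  | cons s b ih =>
    cases s
    · exact ⟨_, ⟨a, b, rfl, rfl, rfl⟩, le_rfl⟩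
    · obtain ⟨x, hx, hle⟩ := ih (a ++ [.east]) (by simpa using h)
      simp only [List.count_append, List.count_singleton] at hx hle
      refine ⟨x, by simpa using hx, ?_⟩
      simp at hle
      omega

theorem exists_neCorner (a : List Step) {b : List Step} (h : .east ∈ b) :
    ∃ y, NECorner (a ++ .north :: b) (a.count .east) y ∧ a.count .north + 1 ≤ y := by
  have h' : Step.north ∈ b.map Step.swap := List.mem_map.2 ⟨.east, h, rfl⟩
  obtain ⟨x, hx, hle⟩ := exists_enCorner (a.map Step.swap) h'
  rw [(count_map_swap a).2] at hle
  rw [(count_map_swap a).1] at hx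
  refine ⟨x, ?_, hle⟩
  rw [← enCorner_map_swap]
  simpa [Step.swap] using hx

/-- The word in which the first occurrence of the letter `s` is doubled. -/
def dupFirst (s : Step) : List Step → List Step
  | [] => []
  | a :: w => if a = s then a :: a :: w else a :: dupFirst s w

theorem dupFirst_cons_self (s : Step) (w : List Step) : dupFirst s (s :: w) = s :: s :: w := by
  simp [dupFirst]

theorem dupFirst_cons_of_ne {s a : Step} (h : a ≠ s) (w : List Step) :
    dupFirst s (a :: w) = a :: dupFirst s w := by
  simp [dupFirst, h]

theorem dupFirst_injective (s : Step) : Function.Injective (dupFirst s) := by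
  intro v w h
  induction v generalizing w with
  | nil =>
    cases w with
    | nil => rfl
    | cons b w => by_cases hb : b = s <;> simp [dupFirst, hb] at h
  | cons a v ih =>
    cases w with
    | nil => by_cases ha : a = s <;> simp [dupFirst, ha] at h
    | cons b w =>
      by_cases ha : a = s <;> by_cases hb : b = s
      · simpa [dupFirst, ha, hb] using h
      · simp only [dupFirst, ha, hb, if_true, if_false, List.cons.injEq] at h
        exact absurd h.1.symm hb
      · simp only [dupFirst, ha, hb, if_true, if_false, List.cons.injEq] at h
        exact h.1.elim
      · simp only [dupFirst, ha, hb, if_false, List.cons.injEq] at h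
        rw [h.1, ih h.2]

theorem count_dupFirst {s : Step} (h : s ∈ w) (t : Step) :
    (dupFirst s w).count t = w.count t + if s = t then 1 else 0 := by
  induction w with
  | nil => simp at h
  | cons a w ih =>
    by_cases ha : a = s
    · subst ha
      rw [dupFirst_cons_self, List.count_cons]
      simp
    · rw [dupFirst_cons_of_ne ha, List.count_cons, List.count_cons, ih (by
        simpa [Ne.symm ha] using h)]
      omega

theorem length_dupFirst {s : Step} (h : s ∈ w) : (dupFirst s w).length = w.length + 1 := by
  rw [← count_north_add_count_east, ← count_north_add_count_east, count_dupFirst h,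
    count_dupFirst h]
  cases s <;> simp <;> omega

theorem getLast?_dupFirst (s : Step) (w : List Step) :
    (dupFirst s w).getLast? = w.getLast? := by
  induction w with
  | nil => rfl
  | cons a w ih =>
    by_cases ha : a = s
    · simp [dupFirst, ha]
    · simp [dupFirst, ha, List.getLast?_cons, ih]

/-- Every such corner comes after the first east step, so doubling this step moves all of them and
creates none. -/
theorem enCorner_dupFirst :
    ENCorner (dupFirst .east w) x y ↔ ∃ x', x = x' + 1 ∧ ENCorner w x' y := by
  induction w generalizing x y with
  | nil => simp [dupFirst, enCorner_nil]
  | cons s w ih =>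
    cases s
    · rw [dupFirst_cons_of_ne (by simp)]
      simp only [enCorner_north_cons, ih]
      grind
    · rw [dupFirst_cons_self, enCorner_east_cons]
      simp

theorem neCorner_dupFirst :
    NECorner (dupFirst .north w) x y ↔ ∃ y', y = y' + 1 ∧ NECorner w x y' := by
  induction w generalizing x y with
  | nil => simp [dupFirst, neCorner_nil]
  | cons s w ih =>
    cases s
    · rw [dupFirst_cons_self, neCorner_north_cons]
      simp
    · rw [dupFirst_cons_of_ne (by simp)]
      simp only [neCorner_east_cons, ih]
      grind

/-- The first occurrence of `s` is followed by another `s`. -/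
def FirstDoubled (s : Step) (w : List Step) : Prop := ∃ v, s ∈ v ∧ w = dupFirst s v

theorem firstDoubled_cons_of_ne {s a : Step} (h : a ≠ s) :
    FirstDoubled s (a :: w) ↔ FirstDoubled s w := by
  constructor
  · rintro ⟨v, hv, hw⟩
    cases v with
    | nil => simp at hv
    | cons b v =>
      by_cases hb : b = s
      · rw [hb, dupFirst_cons_self, List.cons.injEq] at hw
        exact absurd hw.1 h
      · rw [dupFirst_cons_of_ne hb, List.cons.injEq] at hw
        exact ⟨v, by simpa [Ne.symm hb] using hv, hw.2⟩
  · rintro ⟨v, hv, rfl⟩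
    exact ⟨a :: v, List.mem_cons_of_mem a hv, (dupFirst_cons_of_ne h v).symm⟩

theorem firstDoubled_cons_self {s : Step} : FirstDoubled s (s :: w) ↔ ∃ v, w = s :: v := by
  constructor
  · rintro ⟨v, hv, hw⟩
    cases v with
    | nil => simp at hv
    | cons b v =>
      by_cases hb : b = s
      · rw [hb, dupFirst_cons_self, List.cons.injEq] at hw
        exact ⟨v, hw.2⟩
      · rw [dupFirst_cons_of_ne hb, List.cons.injEq] at hw
        exact absurd hw.1.symm hb
  · rintro ⟨v, rfl⟩
    exact ⟨s :: v, by simp, (dupFirst_cons_self s v).symm⟩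

theorem exists_enCorner_one (h : .east ∈ w) (hw : ¬ FirstDoubled .east w)
    (hc : w.count .east ≠ 1) : ∃ y, ENCorner w 1 y := by
  induction w with
  | nil => simp at h
  | cons s w ih =>
    cases s
    · rw [firstDoubled_cons_of_ne (by simp)] at hw
      obtain ⟨y, hy⟩ := ih (by simpa using h) hw (by simpa using hc)
      exact ⟨y + 1, enCorner_north_cons.2 ⟨y, rfl, hy⟩⟩
    · rw [firstDoubled_cons_self] at hw
      refine ⟨0, enCorner_east_cons.2 (Or.inl ⟨?_, rfl, rfl⟩)⟩
      cases w with
      | nil => simp at hc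
      | cons t w =>
        cases t
        · exact ⟨w, rfl⟩
        · exact absurd ⟨w, rfl⟩ hw

theorem exists_neCorner_one (h : .north ∈ w) (hw : ¬ FirstDoubled .north w)
    (hc : w.count .north ≠ 1) : ∃ x, NECorner w x 1 := by
  induction w with
  | nil => simp at h
  | cons s w ih =>
    cases s
    · rw [firstDoubled_cons_self] at hw
      refine ⟨0, neCorner_north_cons.2 (Or.inl ⟨?_, rfl, rfl⟩)⟩
      cases w with
      | nil => simp at hc
      | cons t w =>
        cases t
        · exact absurd ⟨w, rfl⟩ hw
        · exact ⟨w, rfl⟩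
    · rw [firstDoubled_cons_of_ne (by simp)] at hw
      obtain ⟨x, hx⟩ := ih (by simpa using h) hw (by simpa using hc)
      exact ⟨x + 1, neCorner_east_cons.2 ⟨x, rfl, hx⟩⟩

end Corners

/-! ### Rigid pairs and their reductions near the origin -/

section Rigid

variable {P Q P' Q' : List Step}

/-- Of a corner of the upper path and a corner of the lower path, one is north-east of the
other. -/
def CornersComparable (P Q : List Step) : Prop :=
  ∀ x y x' y', ENCorner Q x y → NECorner P x' y' → (y ≤ y' ↔ x < x')

/-- A pair of a lower path and an upper path without flexible pairs of corners. -/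
structure RigidPair (P Q : List Step) : Prop where
  head_lower : P.head? = some .east
  last_lower : P.getLast? = some .north
  head_upper : Q.head? = some .north
  last_upper : Q.getLast? = some .east
  length_eq : P.length = Q.length
  count_eq : P.count .north = Q.count .north
  comparable : CornersComparable P Q

/-- Apart from a possible new corner `(1, 1)` of the upper path, all corners move east by one. The
new one is harmless, as the lower corners now have `x ≥ 2` and `y ≥ 1`. -/
theorem cornersComparable_shift_east {e : Prop}
    (hP : ∀ x y, NECorner P' x y ↔ ∃ x', x = x' + 1 ∧ NECorner P x' y)
    (hQ : ∀ x y, ENCorner Q' x y ↔ (e ∧ x = 1 ∧ y = 1) ∨ ∃ x', x = x' + 1 ∧ ENCorner Q x' y)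
    (hP1 : ∀ x y, NECorner P x y → 1 ≤ x) :
    CornersComparable P' Q' ↔ CornersComparable P Q := by
  constructor
  · intro h x y x' y' hc hd
    have := h (x + 1) y (x' + 1) y' ((hQ _ _).2 (Or.inr ⟨x, rfl, hc⟩)) ((hP _ _).2 ⟨x', rfl, hd⟩)
    omega
  · intro h x y x' y' hc hd
    obtain ⟨x', rfl, hd'⟩ := (hP _ _).1 hd
    rcases (hQ _ _).1 hc with ⟨-, rfl, rfl⟩ | ⟨x, rfl, hc'⟩
    · have := hP1 _ _ hd'
      have := hd'.pos
      omega
    · have := h _ _ _ _ hc' hd'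
      omega

/-- Here the possible new corner `(1, 1)` belongs to the lower path; the upper corners now have `y ≥
2` and `x ≥ 1`, so both sides of the equivalence fail for it. -/
theorem cornersComparable_shift_north {e : Prop}
    (hP : ∀ x y, NECorner P' x y ↔ (e ∧ x = 1 ∧ y = 1) ∨ ∃ y', y = y' + 1 ∧ NECorner P x y')
    (hQ : ∀ x y, ENCorner Q' x y ↔ ∃ y', y = y' + 1 ∧ ENCorner Q x y')
    (hQ1 : ∀ x y, ENCorner Q x y → 1 ≤ y) :
    CornersComparable P' Q' ↔ CornersComparable P Q := by
  constructor
  · intro h x y x' y' hc hd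
    have := h x (y + 1) x' (y' + 1) ((hQ _ _).2 ⟨y, rfl, hc⟩) ((hP _ _).2 (Or.inr ⟨y', rfl, hd⟩))
    omega
  · intro h x y x' y' hc hd
    obtain ⟨y, rfl, hc'⟩ := (hQ _ _).1 hc
    rcases (hP _ _).1 hd with ⟨-, rfl, rfl⟩ | ⟨y', rfl, hd'⟩
    · have := hQ1 _ _ hc'
      have := hc'.pos
      omega
    · have := h _ _ _ _ hc' hd'
      omega

theorem NECorner.pos_of_east {v : List Step} {x y : ℕ} (h : NECorner (.east :: v) x y) :
    1 ≤ x := by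
  obtain ⟨x', rfl, -⟩ := neCorner_east_cons.1 h
  omega

theorem ENCorner.pos_of_north {w : List Step} {x y : ℕ} (h : ENCorner (.north :: w) x y) :
    1 ≤ y := by
  obtain ⟨x', rfl, -⟩ := enCorner_north_cons.1 h
  omega

theorem RigidPair.swap (h : RigidPair P Q) : RigidPair (Q.map Step.swap) (P.map Step.swap) where
  head_lower := by simp [h.head_upper, Step.swap]
  last_lower := by simp [h.last_upper, Step.swap]
  head_upper := by simp [h.head_lower, Step.swap]
  last_upper := by simp [h.last_lower, Step.swap]
  length_eq := by simp [h.length_eq]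
  count_eq := by
    rw [(count_map_swap _).1, (count_map_swap _).1]
    have h1 := count_north_add_count_east P
    have h2 := count_north_add_count_east Q
    have h3 := h.length_eq
    have h4 := h.count_eq
    omega
  comparable x y x' y' hc hd := by
    have := h.comparable _ _ _ _ (neCorner_map_swap.1 hd) (enCorner_map_swap.1 hc)
    omega

theorem RigidPair.exists_cons (h : RigidPair P Q) :
    ∃ v w, P = .east :: v ∧ Q = .north :: w ∧ v ≠ [] ∧ w ≠ [] := by
  obtain ⟨v, rfl⟩ := List.head?_eq_some_iff.1 h.head_lower
  obtain ⟨w, rfl⟩ := List.head?_eq_some_iff.1 h.head_upper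
  refine ⟨v, w, rfl, rfl, ?_, ?_⟩
  · rintro rfl
    simpa using h.last_lower
  · rintro rfl
    simpa using h.last_upper

theorem rigidPair_east_cons_iff {v w : List Step} (hv : v ≠ []) (hw : w ≠ []) :
    RigidPair (.east :: .east :: v) (.north :: .east :: w) ↔
      RigidPair (.east :: v) (.north :: w) := by
  have hc : CornersComparable (.east :: .east :: v) (.north :: .east :: w) ↔
      CornersComparable (.east :: v) (.north :: w) := by
    refine cornersComparable_shift_east (e := ∃ w', w = .north :: w') (fun x y => neCorner_east_cons)
      (fun x y => ?_) fun x y h => h.pos_of_east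
    simp only [enCorner_north_cons, enCorner_east_cons]
    grind
  have h1 : (Step.east :: v).getLast? = v.getLast? := by
    rw [List.getLast?_cons_of_ne_nil hv]
  have h2 : ∀ s : Step, (s :: w).getLast? = w.getLast? := fun s => by
    rw [List.getLast?_cons_of_ne_nil hw]
  constructor
  · rintro ⟨-, a2, -, a4, a5, a6, a7⟩
    exact ⟨rfl, by simpa [h1] using a2, rfl, by simpa [h2] using a4, by simpa using a5,
      by simpa using a6, hc.1 a7⟩
  · rintro ⟨-, a2, -, a4, a5, a6, a7⟩
    exact ⟨rfl, by simpa [h1] using a2, rfl, by simpa [h2] using a4, by simpa using a5,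
      by simpa using a6, hc.2 a7⟩

theorem rigidPair_east_north_east_iff {v w : List Step} :
    RigidPair (.east :: .north :: .east :: v) (.north :: .north :: w) ↔
      RigidPair (.east :: .east :: v) (.north :: w) := by
  have hc : CornersComparable (.east :: .north :: .east :: v) (.north :: .north :: w) ↔
      CornersComparable (.east :: .east :: v) (.north :: w) := by
    refine cornersComparable_shift_north (e := True) (fun x y => ?_)
      (fun x y => enCorner_north_cons) fun x y h => h.pos_of_north
    simp only [neCorner_north_cons, neCorner_east_cons]
    grind
  constructor
  · rintro ⟨-, a2, -, a4, a5, a6, a7⟩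
    exact ⟨rfl, by simpa using a2, rfl, by simpa using a4, by simpa using a5,
      by simpa using a6, hc.1 a7⟩
  · rintro ⟨-, a2, -, a4, a5, a6, a7⟩
    exact ⟨rfl, by simpa using a2, rfl, by simpa using a4, by simpa using a5,
      by simpa using a6, hc.2 a7⟩

theorem rigidPair_dupFirst_north_iff {v w : List Step} (hv : .north ∈ v) :
    RigidPair (.east :: dupFirst .north v) (.north :: .north :: w) ↔
      RigidPair (.east :: v) (.north :: w) := by
  have hd := dupFirst_cons_of_ne (show Step.east ≠ Step.north by simp) v
  have hc : CornersComparable (.east :: dupFirst .north v) (.north :: .north :: w) ↔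
      CornersComparable (.east :: v) (.north :: w) := by
    rw [← hd]
    refine cornersComparable_shift_north (e := False) (fun x y => ?_)
      (fun x y => enCorner_north_cons) fun x y h => h.pos_of_north
    rw [neCorner_dupFirst]
    simp
  have hl : (Step.east :: dupFirst .north v).getLast? = (Step.east :: v).getLast? := by
    rw [← hd, getLast?_dupFirst]
  have hn := count_dupFirst hv .north
  have hlen := length_dupFirst hv
  constructor
  · rintro ⟨-, a2, -, a4, a5, a6, a7⟩
    exact ⟨rfl, hl ▸ a2, rfl, by simpa using a4, by simpa [hlen] using a5,
      by simpa [hn] using a6, hc.1 a7⟩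
  · rintro ⟨-, a2, -, a4, a5, a6, a7⟩
    exact ⟨rfl, hl.trans a2, rfl, by simpa using a4, by simpa [hlen] using a5,
      by simpa [hn] using a6, hc.2 a7⟩

theorem rigidPair_dupFirst_east_iff {v w : List Step} (hv : v ≠ []) (hw : .east ∈ w) :
    RigidPair (.east :: .east :: v) (.north :: dupFirst .east w) ↔
      RigidPair (.east :: v) (.north :: w) := by
  have hd := dupFirst_cons_of_ne (show Step.north ≠ Step.east by simp) w
  have hc : CornersComparable (.east :: .east :: v) (.north :: dupFirst .east w) ↔
      CornersComparable (.east :: v) (.north :: w) := by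
    rw [← hd]
    refine cornersComparable_shift_east (e := False) (fun x y => neCorner_east_cons)
      (fun x y => ?_) fun x y h => h.pos_of_east
    rw [enCorner_dupFirst]
    simp
  have h1 : (Step.east :: v).getLast? = v.getLast? := by
    rw [List.getLast?_cons_of_ne_nil hv]
  have hl : (Step.north :: dupFirst .east w).getLast? = (Step.north :: w).getLast? := by
    rw [← hd, getLast?_dupFirst]
  have hn := count_dupFirst hw .north
  have hlen := length_dupFirst hw
  constructor
  · rintro ⟨-, a2, -, a4, a5, a6, a7⟩
    exact ⟨rfl, by simpa [h1] using a2, rfl, hl ▸ a4, by simpa [hlen] using a5,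
      by simpa [hn] using a6, hc.1 a7⟩
  · rintro ⟨-, a2, -, a4, a5, a6, a7⟩
    exact ⟨rfl, by simpa [h1] using a2, rfl, hl.trans a4, by simpa [hlen] using a5,
      by simpa [hn] using a6, hc.2 a7⟩

/-- The paths would touch at `(1, 1)`. Then `Q` has a corner at height one and `P` has a corner
after one east step, and these two are not comparable. -/
theorem not_rigidPair_of_east_north {v w : List Step} (hv : v ≠ []) :
    ¬ RigidPair (.east :: .north :: v) (.north :: .east :: w) := by
  intro h
  have hlen := h.length_eq
  simp only [List.length_cons, add_left_inj] at hlen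
  have hw : w ≠ [] := by
    rintro rfl
    exact hv (List.length_eq_zero_iff.1 hlen)
  have hlv : v.getLast? = some .north := by
    have := h.last_lower
    rwa [List.getLast?_cons_of_ne_nil (by simp), List.getLast?_cons_of_ne_nil hv] at this
  have hlw : w.getLast? = some .east := by
    have := h.last_upper
    rwa [List.getLast?_cons_of_ne_nil (by simp), List.getLast?_cons_of_ne_nil hw] at this
  have hcount := h.count_eq
  simp at hcount
  have hn : Step.north ∈ w := by
    rw [← List.one_le_count_iff, ← hcount, List.one_le_count_iff]
    exact List.mem_of_getLast? hlv
  have he : Step.east ∈ v := by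
    have h1 := count_north_add_count_east v
    have h2 := count_north_add_count_east w
    have h3 := List.one_le_count_iff.2 (List.mem_of_getLast? hlw)
    rw [← List.one_le_count_iff]
    omega
  obtain ⟨x, hx, hx1⟩ := exists_enCorner [.north] hn
  obtain ⟨y, hy, hy1⟩ := exists_neCorner [.east] he
  have := h.comparable _ _ _ _ hx hy
  simp at this hx1 hy1
  omega

end Rigid

end LPM

namespace LPM

open Set

/-! ### Rigidity means strict separation without flexible corners -/

section RigidIff

variable {P Q : List Step}

theorem ENCorner.take {w : List Step} {x y : ℕ} (h : ENCorner w x y) :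
    0 < x + y ∧ x + y < w.length ∧ (w.take (x + y)).count .north = y := by
  obtain ⟨a, b, rfl, rfl, rfl⟩ := h
  have := count_north_add_count_east a
  rw [show a.count .east + 1 + a.count .north = a.length + 1 by omega, List.take_length_add_append]
  refine ⟨by omega, by simp, by simp⟩

theorem NECorner.take {w : List Step} {x y : ℕ} (h : NECorner w x y) :
    0 < x + y ∧ x + y < w.length ∧ (w.take (x + y)).count .north = y := by
  obtain ⟨a, b, rfl, rfl, rfl⟩ := h
  have := count_north_add_count_east a
  rw [show a.count .east + (a.count .north + 1) = a.length + 1 by omega,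
    List.take_length_add_append]
  refine ⟨by omega, by simp, by simp⟩

theorem count_take_mono (w : List Step) (s : Step) {i j : ℕ} (h : i ≤ j) :
    (w.take i).count s ≤ (w.take j).count s :=
  (List.take_sublist_take_left h).count_le _

/-- If `y ≤ y'` but `x' ≤ x`, the corner of `P` would be weakly north-west of the corner of `Q`,
which strict separation forbids. -/
theorem StrictlyBelowList.cornersComparable (h : StrictlyBelowList P Q)
    (hlen : P.length = Q.length)
    (hf : ∀ x y x' y', ENCorner Q x y → NECorner P x' y' → x < x' → y ≤ y') :
    CornersComparable P Q := by
  intro x y x' y' hc hd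
  refine ⟨fun hy => ?_, hf x y x' y' hc hd⟩
  by_contra hx
  obtain ⟨h1, h2, h3⟩ := hc.take
  obtain ⟨h4, h5, h6⟩ := hd.take
  rcases le_total (x' + y') (x + y) with hle | hle
  · have h7 := count_take_mono P .north hle
    have h8 := h.2 (x + y) h1 (by omega)
    omega
  · have h7 := count_take_mono Q .east hle
    have h8 := h.2 (x' + y') h4 (by omega)
    have h9 := count_take_north_add (w := Q) (t := x + y) (by omega)
    have h10 := count_take_north_add (w := Q) (t := x' + y') (by omega)
    omega

theorem count_take_lt {w : List Step} {s : Step} (hw : w.getLast? = some s) {t : ℕ}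
    (ht : t < w.length) : (w.take t).count s < w.count s := by
  obtain ⟨v, rfl⟩ := List.getLast?_eq_some_iff.1 hw
  simp only [List.length_append, List.length_singleton] at ht
  rw [List.take_append_of_le_length (by omega), List.count_append, List.count_singleton_self]
  exact Nat.lt_succ_of_le ((v.take_sublist t).count_le s)

/-- At the first meeting point `P` arrives by a north step and `Q` by an east step. Since `Q` ends
with east and `P` with north, counting shows that `Q` still has a north step and `P` an east step
ahead. This yields a corner of `Q` in the row of the meeting point, not west of it, and a corner of
`P` in its column, not south of it; these are not comparable. -/
theorem RigidPair.strictlyBelowList (h : RigidPair P Q) : StrictlyBelowList P Q := by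
  classical
  refine ⟨h.count_eq, ?_⟩
  by_contra hcon
  push Not at hcon
  obtain ⟨ht0, htn, ht⟩ := Nat.find_spec hcon
  have hmin := fun m => Nat.find_min hcon (m := m)
  set t := Nat.find hcon with htdef
  have hlen := h.length_eq
  have ht1 : t ≠ 1 := by
    intro h1
    obtain ⟨v, w, rfl, rfl, -, -⟩ := h.exists_cons
    rw [h1] at ht
    simp at ht
  obtain ⟨s, hs⟩ : ∃ s, t = s + 1 := ⟨t - 1, by omega⟩
  rw [hs] at htn ht
  have hlt : (P.take s).count .north < (Q.take s).count .north := by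
    by_contra hle
    exact hmin s (by omega) ⟨by omega, by omega, not_lt.1 hle⟩
  have hPs : s < P.length := by omega
  have hQs : s < Q.length := by omega
  rw [List.take_add_one, List.take_add_one, List.count_append, List.count_append,
    List.getElem?_eq_getElem hPs, List.getElem?_eq_getElem hQs] at ht
  have hPN : P[s] = .north := by
    cases hp : P[s]
    · rfl
    · rw [hp] at ht; simp at ht; omega
  have hQE : Q[s] = .east := by
    cases hq : Q[s]
    · rw [hPN, hq] at ht; simp at ht; omega
    · rfl
  rw [hPN, hQE] at ht
  simp at ht
  have hP : P.take s ++ .north :: P.drop (s + 1) = P := by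
    rw [← hPN, List.getElem_cons_drop, List.take_append_drop]
  have hQ : Q.take s ++ .east :: Q.drop (s + 1) = Q := by
    rw [← hQE, List.getElem_cons_drop, List.take_append_drop]
  have hPc := fun c : Step => congrArg (List.count c) hP
  have hQc := fun c : Step => congrArg (List.count c) hQ
  simp only [List.count_append, List.count_cons] at hPc hQc
  have hPc1 := hPc .north
  have hPc2 := hPc .east
  have hQc1 := hQc .north
  have hQc2 := hQc .east
  simp at hPc1 hPc2 hQc1 hQc2
  have hPt := count_take_north_add (w := P) (t := s) (by omega)
  have hQt := count_take_north_add (w := Q) (t := s) (by omega)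
  have hPl := count_take_lt h.last_lower htn
  have hQl := count_take_lt h.last_upper (hlen ▸ htn)
  rw [List.take_add_one, List.count_append, List.getElem?_eq_getElem hPs, hPN] at hPl
  rw [List.take_add_one, List.count_append, List.getElem?_eq_getElem hQs, hQE] at hQl
  simp at hPl hQl
  have hcount := h.count_eq
  have hPa := count_north_add_count_east P
  have hQa := count_north_add_count_east Q
  obtain ⟨x, hx, hxle⟩ := exists_enCorner (Q.take s) (b := Q.drop (s + 1))
    (List.one_le_count_iff.1 (by omega))
  obtain ⟨y, hy, hyle⟩ := exists_neCorner (P.take s) (b := P.drop (s + 1))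
    (List.one_le_count_iff.1 (by omega))
  rw [hQ] at hx
  rw [hP] at hy
  have := h.comparable _ _ _ _ hx hy
  omega

theorem rigidPair_iff {k : ℕ} (hP : P.length = k + 2) (hQ : Q.length = k + 2) :
    RigidPair P Q ↔ StrictlyBelowList P Q ∧
      ∀ x y x' y', ENCorner Q x y → NECorner P x' y' → x < x' → y ≤ y' := by
  constructor
  · intro h
    exact ⟨h.strictlyBelowList, fun x y x' y' hc hd => (h.comparable x y x' y' hc hd).2⟩
  · rintro ⟨h, hf⟩
    have hcomp := h.cornersComparable (hP.trans hQ.symm) hf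
    obtain ⟨P', Q', hP', hQ', hPe, hQe⟩ := h.exists_eq hP hQ
    obtain ⟨h1, h2⟩ := h
    refine ⟨?_, by rw [hPe]; simp, by rw [hQe]; simp, ?_, hP.trans hQ.symm, h1, hcomp⟩
    · have h3 := h2 1 (by omega) (by omega)
      obtain ⟨p, v, rfl⟩ := List.exists_cons_of_length_eq_add_one hP
      cases p
      · rw [hQe] at h3; simp at h3
      · rfl
    · have h3 := h2 (k + 1) (by omega) (by omega)
      obtain ⟨v, q, hv⟩ : ∃ v q, Q = v ++ [q] := by
        have hne : Q ≠ [] := by rintro rfl; simp at hQ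
        exact ⟨_, _, (List.dropLast_append_getLast hne).symm⟩
      have hvl : v.length = k + 1 := by
        rw [hv] at hQ; simpa using hQ
      rw [hPe, hv, List.take_append_of_le_length (by omega), List.take_of_length_le (by omega),
        List.take_append_of_le_length (by omega), List.take_of_length_le (by omega)] at h3
      rw [hPe, hv] at h1
      cases q
      · simp at h1; omega
      · rw [hv]; simp

end RigidIff

/-! ### Recursions for the number of rigid pairs -/

section Count

instance : Finite Step := Finite.of_injective (fun s : Step => decide (s = .north)) fun s t h => by
  cases s <;> cases t <;> simp_all

/-- The rigid pairs of words of length `n`. -/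
def rigidPairs (n : ℕ) : Set (List Step × List Step) := {p | p.1.length = n ∧ RigidPair p.1 p.2}

theorem ncard_uniqueConnectedLpms_eq_rigidPairs {n : ℕ} (hn : 2 ≤ n) :
    (uniqueConnectedLpms n).ncard = (rigidPairs n).ncard := by
  obtain ⟨k, rfl⟩ : ∃ k, n = k + 2 := ⟨n - 2, by omega⟩
  rw [ncard_uniqueConnectedLpms_eq hn]
  have h1 : {p : LatticePath (k + 2) × LatticePath (k + 2) | ∃ h : StrictlyBelow p.1 p.2,
      ∀ m m', ¬ IsFlexiblePair ((northSteps p.2).orderEmbOfFin h.neverAbove.same_end)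
        ((northSteps p.1).orderEmbOfFin rfl) m m'} =
      {p | RigidPair (List.ofFn p.1) (List.ofFn p.2)} := by
    ext ⟨P, Q⟩
    simp only [mem_ofPred_eq, forall_not_isFlexiblePair_iff, exists_prop, strictlyBelow_iff]
    exact (rigidPair_iff (k := k) (by simp) (by simp)).symm
  rw [h1, ncard_ofFn]
  congr 1
  ext ⟨P, Q⟩
  exact ⟨fun h => ⟨h.1, h.2.2⟩, fun h => ⟨h.1, h.2.length_eq.symm.trans h.1, h.2⟩⟩

theorem finite_rigidPairs (n : ℕ) : (rigidPairs n).Finite :=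
  ((List.finite_length_eq Step n).prod (List.finite_length_eq Step n)).subset fun _ hp =>
    ⟨hp.1, hp.2.length_eq.symm.trans hp.1⟩

/-- The rigid pairs whose lower path starts with two east steps. -/
def rigidPairsEE (n : ℕ) : Set (List Step × List Step) :=
  {p ∈ rigidPairs n | ∃ v, p.1 = .east :: .east :: v}

/-- The rigid pairs whose lower path starts with an east and a north step. -/
def rigidPairsEN (n : ℕ) : Set (List Step × List Step) :=
  {p ∈ rigidPairs n | ∃ v, p.1 = .east :: .north :: v}

/-- The rigid pairs whose upper path starts with a north and an east step. -/
def rigidPairsNE (n : ℕ) : Set (List Step × List Step) :=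
  {p ∈ rigidPairs n | ∃ w, p.2 = .north :: .east :: w}

/-- The rigid pairs whose lower path starts with an east, a north and an east step. -/
def rigidPairsENE (n : ℕ) : Set (List Step × List Step) :=
  {p ∈ rigidPairs n | ∃ v, p.1 = .east :: .north :: .east :: v}

/-- The rigid pairs that start with two equal steps, where the first north step of the lower path
is followed by another one. -/
def rigidPairsDoubled (n : ℕ) : Set (List Step × List Step) :=
  {p ∈ rigidPairs n | (∃ v, p.1 = .east :: .east :: v) ∧ (∃ w, p.2 = .north :: .north :: w) ∧
    FirstDoubled .north p.1}

/-- The rigid pairs that start with two equal steps, where the first north step of the lower path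
is not followed by another one. -/
def rigidPairsUndoubled (n : ℕ) : Set (List Step × List Step) :=
  {p ∈ rigidPairs n | (∃ v, p.1 = .east :: .east :: v) ∧ (∃ w, p.2 = .north :: .north :: w) ∧
    ¬ FirstDoubled .north p.1}

/-- The second step of `P` is east too, as the paths would touch otherwise; this common east step is
removed. -/
theorem ncard_rigidPairsNE_succ {n : ℕ} (hn : 2 ≤ n) :
    (rigidPairsNE (n + 1)).ncard = (rigidPairs n).ncard := by
  have h : rigidPairsNE (n + 1) =
      (fun p => (.east :: p.1, .north :: .east :: p.2.tail)) '' rigidPairs n := by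
    ext ⟨P, Q⟩
    constructor
    · rintro ⟨⟨hl, h⟩, w, hw⟩
      simp only at hl h hw
      subst hw
      obtain ⟨v, w', rfl, hw', hv, -⟩ := h.exists_cons
      have hwl := h.length_eq
      simp only [List.length_cons] at hwl hl
      obtain ⟨s, v, rfl⟩ := List.exists_cons_of_ne_nil hv
      simp only [List.length_cons] at hwl hl
      have hw0 : w ≠ [] := by rintro rfl; simp at hwl; subst hwl; simp at hl; omega
      have hv0 : v ≠ [] := by rintro rfl; simp at hl; omega
      cases s
      · exact absurd h (not_rigidPair_of_east_north hv0)
      · exact ⟨(.east :: v, .north :: w), ⟨by simp only [List.length_cons]; omega,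
          (rigidPair_east_cons_iff hv0 hw0).1 h⟩, rfl⟩
    · rintro ⟨⟨P', Q'⟩, ⟨hl, h⟩, heq⟩
      obtain ⟨rfl, rfl⟩ := Prod.mk.inj heq
      simp only at hl h ⊢
      obtain ⟨v, w, rfl, rfl, hv, hw⟩ := h.exists_cons
      exact ⟨⟨by simpa using hl, (rigidPair_east_cons_iff hv hw).2 h⟩, w, rfl⟩
  rw [h, InjOn.ncard_image]
  rintro ⟨P, Q⟩ ⟨-, h⟩ ⟨P', Q'⟩ ⟨-, h'⟩ heq
  obtain ⟨v, w, rfl, rfl, -, -⟩ := RigidPair.exists_cons h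
  obtain ⟨v', w', rfl, rfl, -, -⟩ := RigidPair.exists_cons h'
  simpa using heq

/-- Reflection in the diagonal is the bijection. -/
theorem ncard_rigidPairsEN (n : ℕ) : (rigidPairsEN n).ncard = (rigidPairsNE n).ncard := by
  have h : rigidPairsEN n =
      (fun p => (p.2.map Step.swap, p.1.map Step.swap)) '' rigidPairsNE n := by
    ext ⟨P, Q⟩
    constructor
    · rintro ⟨⟨hl, h⟩, v, hv⟩
      simp only at hl h hv
      subst hv
      refine ⟨(Q.map Step.swap, (Step.east :: Step.north :: v).map Step.swap),
        ⟨⟨by simpa [← h.length_eq] using hl, h.swap⟩, v.map Step.swap, rfl⟩, ?_⟩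
      simp only [map_swap_map_swap]
    · rintro ⟨⟨P', Q'⟩, ⟨⟨hl, h⟩, w, hw⟩, heq⟩
      obtain ⟨rfl, rfl⟩ := Prod.mk.inj heq
      simp only at hl h hw ⊢
      subst hw
      exact ⟨⟨by simpa [h.length_eq] using hl, h.swap⟩, w.map Step.swap, rfl⟩
  rw [h, ncard_image_of_injective]
  rintro ⟨P, Q⟩ ⟨P', Q'⟩ heq
  obtain ⟨h1, h2⟩ := Prod.mk.inj heq
  have hinj := List.map_injective_iff.2 Step.swap_involutive.injective
  exact Prod.ext (hinj h2) (hinj h1)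

theorem RigidPair.exists_cons_cons {P Q : List Step} (h : RigidPair P Q) : ∃ s t v w,
    P = .east :: s :: v ∧ Q = .north :: t :: w := by
  obtain ⟨v, w, rfl, rfl, hv, hw⟩ := h.exists_cons
  obtain ⟨s, v, rfl⟩ := List.exists_cons_of_ne_nil hv
  obtain ⟨t, w, rfl⟩ := List.exists_cons_of_ne_nil hw
  exact ⟨s, t, v, w, rfl, rfl⟩

theorem ncard_rigidPairs_eq (n : ℕ) :
    (rigidPairs n).ncard = (rigidPairsEE n).ncard + (rigidPairsEN n).ncard := by
  have hfin := finite_rigidPairs n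
  rw [← ncard_union_eq _ (hfin.subset fun _ h => h.1) (hfin.subset fun _ h => h.1)]
  · congr 1
    ext ⟨P, Q⟩
    constructor
    · intro h
      obtain ⟨s, t, v, w, hP, hQ⟩ := RigidPair.exists_cons_cons h.2
      cases s
      exacts [Or.inr ⟨h, v, hP⟩, Or.inl ⟨h, v, hP⟩]
    · rintro (h | h) <;> exact h.1
  · rw [disjoint_left]
    rintro ⟨P, Q⟩ ⟨-, v, rfl⟩ ⟨-, w, hw⟩
    simp at hw

theorem RigidPair.not_north_east {P Q v w : List Step} (h : RigidPair P Q) (hl : 3 ≤ P.length)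
    (hP : P = .east :: .north :: v) (hQ : Q = .north :: .east :: w) : False := by
  subst hP hQ
  refine not_rigidPair_of_east_north (v := v) ?_ h
  rintro rfl
  simp at hl

theorem ncard_rigidPairsEE_eq {n : ℕ} (hn : 3 ≤ n) : (rigidPairsEE n).ncard =
    (rigidPairsNE n).ncard + ((rigidPairsDoubled n).ncard + (rigidPairsUndoubled n).ncard) := by
  have hfin := finite_rigidPairs n
  rw [← ncard_union_eq _ (hfin.subset fun _ h => h.1) (hfin.subset fun _ h => h.1),
    ← ncard_union_eq _ (hfin.subset fun _ h => h.1)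
      ((hfin.subset fun _ h => h.1).union (hfin.subset fun _ h => h.1))]
  · congr 1
    ext ⟨P, Q⟩
    constructor
    · rintro ⟨h, v, hv⟩
      obtain ⟨s, t, -, w, -, hQ⟩ := RigidPair.exists_cons_cons h.2
      cases t
      · by_cases hd : FirstDoubled .north P
        exacts [Or.inr (Or.inl ⟨h, ⟨v, hv⟩, ⟨w, hQ⟩, hd⟩), Or.inr (Or.inr ⟨h, ⟨v, hv⟩, ⟨w, hQ⟩, hd⟩)]
      · exact Or.inl ⟨h, w, hQ⟩
    · rintro (⟨h, w, hw⟩ | h | h)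
      · obtain ⟨s, t, v, -, hP, -⟩ := RigidPair.exists_cons_cons h.2
        cases s
        · exact (RigidPair.not_north_east h.2 (hn.trans h.1.ge) hP hw).elim
        · exact ⟨h, v, hP⟩
      · exact ⟨h.1, h.2.1⟩
      · exact ⟨h.1, h.2.1⟩
  · rw [disjoint_left]
    rintro ⟨P, Q⟩ ⟨-, v, rfl⟩ (⟨-, -, ⟨w, hw⟩, -⟩ | ⟨-, -, ⟨w, hw⟩, -⟩) <;> simp at hw
  · rw [disjoint_left]
    exact fun p h h' => h'.2.2.2 h.2.2.2

/-- One of the doubled north steps of `P` and one of the two initial north steps of `Q` are removed.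
-/
theorem ncard_rigidPairsDoubled_succ (n : ℕ) :
    (rigidPairsDoubled (n + 1)).ncard = (rigidPairsEE n).ncard := by
  have h : rigidPairsDoubled (n + 1) =
      (fun p => (dupFirst .north p.1, .north :: p.2)) '' rigidPairsEE n := by
    ext ⟨P, Q⟩
    constructor
    · rintro ⟨⟨hl, h⟩, ⟨v, rfl⟩, ⟨w, rfl⟩, hd⟩
      simp only at hl h hd
      rw [firstDoubled_cons_of_ne (by simp), firstDoubled_cons_of_ne (by simp)] at hd
      obtain ⟨v, hv, rfl⟩ := hd
      have hlen := length_dupFirst hv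
      rw [← dupFirst_cons_of_ne (by simp), rigidPair_dupFirst_north_iff (by simpa using hv)] at h
      refine ⟨(.east :: .east :: v, .north :: w), ⟨⟨?_, h⟩, v, rfl⟩, ?_⟩
      · simp only [List.length_cons, hlen] at hl ⊢
        omega
      · simp [dupFirst]
    · rintro ⟨⟨P', Q'⟩, ⟨⟨hl, h⟩, v, hv⟩, heq⟩
      obtain ⟨rfl, rfl⟩ := Prod.mk.inj heq
      simp only at hl h hv ⊢
      subst hv
      have hmem : Step.north ∈ Step.east :: v := by
        simpa using List.mem_of_getLast? h.last_lower
      obtain ⟨-, w, -, rfl, -, -⟩ := h.exists_cons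
      have hd := dupFirst_cons_of_ne (show Step.east ≠ Step.north by simp)
      refine ⟨⟨?_, ?_⟩, ⟨dupFirst .north v, by simp [hd]⟩, ⟨w, rfl⟩,
        ⟨_, List.mem_of_getLast? h.last_lower, rfl⟩⟩
      · simp only
        rw [length_dupFirst (List.mem_of_getLast? h.last_lower), hl]
      · simp only
        rw [hd, rigidPair_dupFirst_north_iff hmem]
        exact h
  rw [h, ncard_image_of_injective]
  rintro ⟨P, Q⟩ ⟨P', Q'⟩ heq
  obtain ⟨h1, h2⟩ := Prod.mk.inj heq
  exact Prod.ext (dupFirst_injective _ h1) (List.cons.inj h2).2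

theorem ncard_rigidPairsENE_succ {n : ℕ} (hn : 2 ≤ n) :
    (rigidPairsENE (n + 1)).ncard = (rigidPairsEE n).ncard := by
  have h : rigidPairsENE (n + 1) =
      (fun p => (.east :: .north :: p.1.tail, .north :: p.2)) '' rigidPairsEE n := by
    ext ⟨P, Q⟩
    constructor
    · rintro ⟨⟨hl, h⟩, v, rfl⟩
      obtain ⟨-, t, -, w, -, rfl⟩ := RigidPair.exists_cons_cons h
      simp only at hl h
      cases t
      · exact ⟨(.east :: .east :: v, .north :: w), ⟨⟨by simpa using hl,
          rigidPair_east_north_east_iff.1 h⟩, v, rfl⟩, rfl⟩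
      · exact (h.not_north_east (by omega) rfl rfl).elim
    · rintro ⟨⟨P', Q'⟩, ⟨⟨hl, h⟩, v, hv⟩, heq⟩
      obtain ⟨rfl, rfl⟩ := Prod.mk.inj heq
      simp only at hl h hv ⊢
      subst hv
      obtain ⟨-, w, -, rfl, -, -⟩ := h.exists_cons
      exact ⟨⟨by simpa using hl, rigidPair_east_north_east_iff.2 h⟩, v, rfl⟩
  rw [h, InjOn.ncard_image]
  rintro ⟨P, Q⟩ ⟨-, v, hv⟩ ⟨P', Q'⟩ ⟨-, v', hv'⟩ heq
  simp only at hv hv'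
  subst hv hv'
  simpa using heq

/-- The first east step of `Q` turns out to be doubled, so an east step can be removed from both
paths. The shorter lower path need not start with two east steps any more, so its second letter is
left free. -/
theorem ncard_rigidPairsUndoubled_succ (n : ℕ) : (rigidPairsUndoubled (n + 1)).ncard =
    {p ∈ rigidPairs n | (∃ w, p.2 = .north :: .north :: w) ∧
      ¬ FirstDoubled .north p.1}.ncard := by
  have h : rigidPairsUndoubled (n + 1) =
      (fun p => (.east :: p.1, dupFirst .east p.2)) '' {p ∈ rigidPairs n |
        (∃ w, p.2 = .north :: .north :: w) ∧ ¬ FirstDoubled .north p.1} := by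
    ext ⟨P, Q⟩
    constructor
    · rintro ⟨⟨hl, h⟩, ⟨v, rfl⟩, ⟨w, rfl⟩, hd⟩
      simp only at hl h hd
      have hv : v ≠ [] := by
        rintro rfl
        simpa using h.last_lower
      have hQE := List.mem_of_getLast? h.last_upper
      have hPN := List.mem_of_getLast? h.last_lower
      have hcount := h.count_eq
      have hlen := h.length_eq
      have hcP := count_north_add_count_east (.east :: .east :: v)
      have hcQ := count_north_add_count_east (.north :: .north :: w)
      have hc1 : 2 ≤ (Step.north :: .north :: w).count .north := by simp
      have hc2 : 2 ≤ (Step.east :: .east :: v).count .east := by simp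
      -- Otherwise `Q` has a corner `(1, y)` with `y ≥ 2` and `P` a corner `(x, 1)` with `x ≥ 2`, a
      -- flexible pair.
      have hdQ : FirstDoubled .east (.north :: .north :: w) := by
        by_contra hdQ
        obtain ⟨y, hy⟩ := exists_enCorner_one hQE hdQ (by omega)
        obtain ⟨x, hx⟩ := exists_neCorner_one hPN hd (by omega)
        have h1 := h.comparable _ _ _ _ hy hx
        obtain ⟨y', rfl, hy'⟩ := enCorner_north_cons.1 hy
        obtain ⟨x', rfl, hx'⟩ := neCorner_east_cons.1 hx
        have h2 := hy'.pos_of_north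
        have h3 := hx'.pos_of_east
        omega
      rw [firstDoubled_cons_of_ne (by simp), firstDoubled_cons_of_ne (by simp)] at hdQ
      obtain ⟨w, hw, rfl⟩ := hdQ
      rw [firstDoubled_cons_of_ne (by simp)] at hd
      rw [← dupFirst_cons_of_ne (by simp), rigidPair_dupFirst_east_iff hv (by simpa using hw)] at h
      exact ⟨(.east :: v, .north :: .north :: w), ⟨⟨by simpa using hl, h⟩, ⟨w, rfl⟩, hd⟩,
        by simp [dupFirst]⟩
    · rintro ⟨⟨P', Q'⟩, ⟨⟨hl, h⟩, ⟨w, hw⟩, hd⟩, heq⟩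
      obtain ⟨rfl, rfl⟩ := Prod.mk.inj heq
      simp only at hl h hw hd ⊢
      subst hw
      obtain ⟨v, -, rfl, -, hv, -⟩ := h.exists_cons
      have hmem : Step.east ∈ Step.north :: w := by
        simpa using List.mem_of_getLast? h.last_upper
      have hdup := dupFirst_cons_of_ne (show Step.north ≠ Step.east by simp)
      refine ⟨⟨by simpa using hl, ?_⟩, ⟨v, rfl⟩, ⟨dupFirst .east w, by simp [hdup]⟩, ?_⟩
      · simp only
        rw [hdup, rigidPair_dupFirst_east_iff hv hmem]
        exact h
      · simp only
        rwa [firstDoubled_cons_of_ne (by simp)]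
  rw [h, ncard_image_of_injective]
  rintro ⟨P, Q⟩ ⟨P', Q'⟩ heq
  obtain ⟨h1, h2⟩ := Prod.mk.inj heq
  exact Prod.ext (List.cons.inj h1).2 (dupFirst_injective _ h2)

theorem ncard_rigidPairsUndoubled_succ' {n : ℕ} (hn : 3 ≤ n) :
    (rigidPairsUndoubled (n + 1)).ncard =
      (rigidPairsUndoubled n).ncard + (rigidPairsENE n).ncard := by
  have hfin := finite_rigidPairs n
  rw [ncard_rigidPairsUndoubled_succ,
    ← ncard_union_eq _ (hfin.subset fun _ h => h.1) (hfin.subset fun _ h => h.1)]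
  · congr 1
    ext ⟨P, Q⟩
    constructor
    · rintro ⟨h, hw, hd⟩
      obtain ⟨s, -, v, -, hP, -⟩ := RigidPair.exists_cons_cons h.2
      simp only at hP
      subst hP
      cases s
      · have hl : (Step.east :: Step.north :: v).length = n := h.1
        simp only at hd
        rw [firstDoubled_cons_of_ne (by simp), firstDoubled_cons_self] at hd
        match v with
        | [] => simp at hl; omega
        | .north :: v => exact absurd ⟨v, rfl⟩ hd
        | .east :: v => exact Or.inr ⟨h, v, rfl⟩
      · exact Or.inl ⟨h, ⟨v, rfl⟩, hw, hd⟩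
    · rintro (⟨h, h1, h2, h3⟩ | ⟨h, v, hv⟩)
      · exact ⟨h, h2, h3⟩
      · obtain ⟨-, t, -, w, -, hQ⟩ := RigidPair.exists_cons_cons h.2
        cases t
        · refine ⟨h, ⟨w, hQ⟩, ?_⟩
          rw [hv, firstDoubled_cons_of_ne (by simp), firstDoubled_cons_self]
          simp
        · exact (RigidPair.not_north_east h.2 (hn.trans h.1.ge) hv hQ).elim
  · rw [disjoint_left]
    rintro ⟨P, Q⟩ ⟨-, ⟨v, rfl⟩, -⟩ ⟨-, w, hw⟩
    simp at hw

theorem rigidPairs_two : rigidPairs 2 = {([.east, .north], [.north, .east])} := by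
  ext ⟨P, Q⟩
  constructor
  · rintro ⟨hl, h⟩
    obtain ⟨s, t, v, w, rfl, rfl⟩ := RigidPair.exists_cons_cons h
    have h1 := RigidPair.length_eq h
    have h2 := RigidPair.last_lower h
    have h3 := RigidPair.last_upper h
    simp only [List.length_cons] at hl h1
    obtain rfl : v = [] := List.length_eq_zero_iff.1 (by omega)
    obtain rfl : w = [] := List.length_eq_zero_iff.1 (by simp at hl h1; simpa using h1.symm)
    simp at h2 h3
    subst h2 h3
    rfl
  · rintro h
    obtain ⟨rfl, rfl⟩ := Prod.mk.inj h
    refine ⟨rfl, rfl, rfl, rfl, rfl, rfl, rfl, fun x y x' y' hc hd => ?_⟩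
    simp [enCorner_north_cons, enCorner_east_cons, enCorner_nil] at hc

theorem rigidPairsEE_two : rigidPairsEE 2 = ∅ := by
  rw [rigidPairsEE, rigidPairs_two]
  ext p
  simp only [mem_ofPred_eq, mem_singleton_iff, mem_empty_iff_false, iff_false, not_and]
  rintro rfl
  simp

theorem ncard_rigidPairsUndoubled_three : (rigidPairsUndoubled 3).ncard = 0 := by
  rw [ncard_rigidPairsUndoubled_succ, rigidPairs_two]
  convert ncard_empty (List Step × List Step)
  ext p
  simp only [mem_ofPred_eq, mem_singleton_iff, mem_empty_iff_false, iff_false, not_and]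
  rintro rfl
  simp

/-- Let `a n`, `b n`, `d n` be the numbers of all rigid pairs, of those in `rigidPairsEE` and of
those in `rigidPairsUndoubled`. The bijections give `a (n+1) = b (n+1) + a n`, `b (n+1) = a n + b n
+ d (n+1)` and `d (n+2) = d (n+1) + b n` for `n ≥ 2`. As `d` lags by one, it enters the induction
one index ahead. -/
theorem two_mul_ncard_rigidPairs (m : ℕ) :
    2 * (rigidPairs (m + 3)).ncard = 3 ^ (m + 1) + 1 ∧
      (rigidPairsEE (m + 3)).ncard = 3 ^ m ∧
      2 * (rigidPairsUndoubled (m + 4)).ncard + 1 = 3 ^ m := by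
  have hrec : ∀ n, 2 ≤ n →
      (rigidPairs (n + 1)).ncard = (rigidPairsEE (n + 1)).ncard + (rigidPairs n).ncard ∧
      (rigidPairsEE (n + 1)).ncard = (rigidPairs n).ncard + ((rigidPairsEE n).ncard +
        (rigidPairsUndoubled (n + 1)).ncard) := by
    intro n hn
    have h1 := ncard_rigidPairs_eq (n + 1)
    rw [ncard_rigidPairsEN, ncard_rigidPairsNE_succ hn] at h1
    have h2 := ncard_rigidPairsEE_eq (n := n + 1) (by omega)
    rw [ncard_rigidPairsNE_succ hn, ncard_rigidPairsDoubled_succ] at h2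
    exact ⟨h1, h2⟩
  induction m with
  | zero =>
    obtain ⟨h1, h2⟩ := hrec 2 le_rfl
    have h3 := ncard_rigidPairsUndoubled_succ' (n := 3) le_rfl
    have h4 := ncard_rigidPairsENE_succ (n := 2) le_rfl
    rw [rigidPairsEE_two, ncard_empty] at h2 h4
    rw [ncard_rigidPairsUndoubled_three] at h2 h3
    rw [rigidPairs_two, ncard_singleton] at h1 h2
    simp only [Nat.reduceAdd] at h1 h2 h3 h4 ⊢
    omega
  | succ m ih =>
    obtain ⟨h1, h2⟩ := hrec (m + 3) (by omega)
    have h3 := ncard_rigidPairsUndoubled_succ' (n := m + 4) (by omega)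
    have h4 := ncard_rigidPairsENE_succ (n := m + 3) (by omega)
    obtain ⟨h5, h6, h7⟩ := ih
    rw [show m + 1 + 3 = m + 3 + 1 by ring, show m + 1 + 4 = m + 4 + 1 by ring]
    rw [pow_succ] at h5 ⊢
    rw [pow_succ]
    simp only [add_assoc, Nat.reduceAdd] at h1 h2 h3 h4 h5 h6 h7 ⊢
    omega

theorem two_mul_ncard_uniqueConnectedLpms {n : ℕ} (hn : 2 ≤ n) :
    2 * (uniqueConnectedLpms n).ncard = 3 ^ (n - 2) + 1 := by
  rw [ncard_uniqueConnectedLpms_eq_rigidPairs hn]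
  rcases hn.eq_or_lt with rfl | hn
  · rw [rigidPairs_two, ncard_singleton]; rfl
  · obtain ⟨m, rfl⟩ : ∃ m, n = m + 3 := ⟨n - 3, by omega⟩
    exact (two_mul_ncard_rigidPairs m).1

end Count

end LPM

namespace LPM

open Set

/-! ### Words avoiding a block -/

section Avoid

variable {γ : Type*} [Finite γ]

theorem ncard_length_eq (γ : Type*) [Finite γ] (n : ℕ) :
    {w : List γ | w.length = n}.ncard = Nat.card γ ^ n := by
  have h : {w : List γ | w.length = n} = (List.ofFn (n := n)) '' univ := by
    ext w
    constructor
    · rintro rfl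
      exact ⟨w.get, mem_univ _, List.ofFn_get w⟩
    · rintro ⟨f, -, rfl⟩
      exact List.length_ofFn
  rw [h, ncard_image_of_injective _ List.ofFn_injective, ncard_univ, Nat.card_fun, Nat.card_fin]

/-- The first `p.length` letters form a word other than `p`, and the remaining word avoids `p`
again. -/
theorem ncard_avoid_add_le (p : List γ) (n : ℕ) :
    {w : List γ | w.length = n + p.length ∧ ¬ p <:+: w}.ncard ≤
      (Nat.card γ ^ p.length - 1) * {w : List γ | w.length = n ∧ ¬ p <:+: w}.ncard := by
  have h1 : ({w : List γ | w.length = p.length} \ {p}).ncard = Nat.card γ ^ p.length - 1 := by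
    rw [ncard_sdiff_singleton_of_mem (by simp), ncard_length_eq]
  rw [← h1, ← ncard_prod]
  have hfin : ∀ k, {w : List γ | w.length = k}.Finite := fun k => List.finite_length_eq γ k
  refine ncard_le_ncard_of_injOn (fun w => (w.take p.length, w.drop p.length)) ?_ ?_
    (((hfin _).subset sdiff_subset).prod ((hfin n).subset fun w hw => hw.1))
  · rintro w ⟨hl, hw⟩
    refine ⟨⟨by simp [hl], fun h => hw ?_⟩, by simp [hl], fun h => hw ?_⟩
    · rw [mem_singleton_iff] at h
      conv_lhs => rw [← h]
      exact (List.take_prefix _ _).isInfix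
    · exact h.trans (List.drop_suffix _ _).isInfix
  · intro v _ w _ h
    obtain ⟨h1, h2⟩ := Prod.mk.inj h
    rw [← List.take_append_drop p.length v, h1, h2, List.take_append_drop]

theorem ncard_avoid_le (p : List γ) (q s : ℕ) :
    {w : List γ | w.length = q * p.length + s ∧ ¬ p <:+: w}.ncard ≤
      (Nat.card γ ^ p.length - 1) ^ q * Nat.card γ ^ s := by
  induction q with
  | zero =>
    rw [zero_mul, zero_add, pow_zero, one_mul, ← ncard_length_eq γ s]
    exact ncard_le_ncard (fun w hw => hw.1) (List.finite_length_eq γ s)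
  | succ q ih =>
    rw [show (q + 1) * p.length + s = (q * p.length + s) + p.length by ring, pow_succ']
    rw [mul_assoc]
    exact (ncard_avoid_add_le p _).trans (Nat.mul_le_mul_left _ ih)

end Avoid

/-! ### A block of steps that excludes configuration uniqueness -/

section Unique

variable {n : ℕ} {P Q : LatticePath n}

/-- Steps of the upper and of the lower path that force a flexible pair of corners. -/
def flexibleBlock : List (Step × Step) :=
  [(.north, .east), (.north, .east), (.east, .north), (.north, .east)]

/-- In the block `Q` reads `NNEN` and `P` reads `EENE`. The last north step of `Q` directly follows
the north step of `P`, and both are corners. They form a flexible pair because `P` enters the block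
no higher than `Q`; connectedness plays no role. -/
theorem NeverAbove.not_configurationUnique (h : NeverAbove P Q)
    (hb : flexibleBlock <:+: List.ofFn fun i => (Q i, P i)) :
    ¬ ConfigurationUnique (pathMatroid P Q h) := by
  obtain ⟨a, b, hab⟩ := hb
  have hlen := congrArg List.length hab
  simp only [flexibleBlock, List.length_append, List.length_cons, List.length_nil,
    List.length_ofFn] at hlen
  have hget : ∀ j (hj : a.length + j < n), j < 4 →
      flexibleBlock[j]? = some (Q ⟨a.length + j, hj⟩, P ⟨a.length + j, hj⟩) := by
    intro j hj hj4
    have h1 : (List.ofFn fun i => (Q i, P i))[a.length + j]? =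
        some (Q ⟨a.length + j, hj⟩, P ⟨a.length + j, hj⟩) := by
      simp [hj]
    rw [← h1, ← hab, List.append_assoc, List.getElem?_append_right (by omega),
      List.getElem?_append_left (by simpa [flexibleBlock] using hj4)]
    simp
  have h0 := hget 0 (by omega) (by omega)
  have h1 := hget 1 (by omega) (by omega)
  have h2 := hget 2 (by omega) (by omega)
  have h3 := hget 3 (by omega) (by omega)
  simp only [flexibleBlock, List.getElem?_cons_zero, List.getElem?_cons_succ, Option.some.injEq,
    Prod.mk.injEq] at h0 h1 h2 h3
  have hQ0 := height_succ Q ⟨a.length + 0, by omega⟩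
  have hQ1 := height_succ Q ⟨a.length + 1, by omega⟩
  have hQ2 := height_succ Q ⟨a.length + 2, by omega⟩
  have hP0 := height_succ P ⟨a.length + 0, by omega⟩
  have hP1 := height_succ P ⟨a.length + 1, by omega⟩
  rw [← h0.1] at hQ0
  rw [← h1.1] at hQ1
  rw [← h2.1] at hQ2
  rw [← h0.2] at hP0
  rw [← h1.2] at hP1
  have hle := h.height_le a.length (by omega)
  simp only [reduceCtorEq, if_false, if_true, add_zero, add_assoc, Nat.reduceAdd]
    at hQ0 hQ1 hQ2 hP0 hP1
  obtain ⟨m, hm⟩ := (mem_range_orderEmbOfFin h.same_end ⟨a.length + 3, by omega⟩).2 h3.1.symm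
  obtain ⟨m', hm'⟩ := (mem_range_orderEmbOfFin rfl ⟨a.length + 2, by omega⟩).2 h2.2.symm
  have hmh := ((orderEmbOfFin_eq_iff h.same_end m _).1 hm).2
  have hmh' := ((orderEmbOfFin_eq_iff rfl m' _).1 hm').2
  simp only at hmh hmh'
  refine (intervalPresentation h).not_configurationUnique (m := m) (m' := m')
    ⟨⟨⟨a.length + 2, by omega⟩, ?_, ?_⟩, ⟨⟨a.length + 3, by omega⟩, ?_, ?_⟩, ?_, ?_⟩ ?_
  · rw [hm, covBy_iff_val]
  · rw [mem_range_orderEmbOfFin, ← h2.1]; simp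
  · rw [hm', covBy_iff_val]
  · rw [mem_range_orderEmbOfFin, ← h3.2]; simp
  · omega
  · rw [hm, hm']; simp only; omega
  · rw [hm, hm']

theorem finite_lpms (n : ℕ) : (lpms n).Finite := by
  refine (finite_range fun p : {p : LatticePath n × LatticePath n // NeverAbove p.1 p.2} =>
    pathMatroid p.1.1 p.1.2 p.2).subset ?_
  rintro M ⟨P, Q, h, rfl⟩
  exact ⟨⟨(P, Q), h⟩, rfl⟩

theorem card_step : Nat.card Step = 2 := by
  have h : (univ : Set Step) = {.north, .east} := by
    ext s
    cases s <;> simp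
  rw [← ncard_univ, h, ncard_pair (by simp)]

/-- A pair of paths is a word over four letters. Each of its `n / 4` consecutive blocks misses one
of `4 ^ 4 = 256` values, and at most three letters remain, which gives the factor `4 ^ 3`. -/
theorem ncard_uniqueLpms_le (n : ℕ) : (uniqueLpms n).ncard ≤ 255 ^ (n / 4) * 64 := by
  have h1 : (uniqueLpms n).ncard ≤
      {w : List (Step × Step) | w.length = n ∧ ¬ flexibleBlock <:+: w}.ncard := by
    let f : {p : LatticePath n × LatticePath n // NeverAbove p.1 p.2} → Matroid (Fin n) :=
      fun p => pathMatroid p.1.1 p.1.2 p.2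
    have hsub : uniqueLpms n ⊆ f '' {p | ConfigurationUnique (f p)} := by
      rintro M ⟨⟨P, Q, h, rfl⟩, hM⟩
      exact ⟨⟨(P, Q), h⟩, hM, rfl⟩
    refine (ncard_le_ncard hsub (toFinite _)).trans ((ncard_image_le (toFinite _)).trans ?_)
    refine ncard_le_ncard_of_injOn (fun p => List.ofFn fun i => (p.1.2 i, p.1.1 i)) ?_ ?_
      ((List.finite_length_eq _ n).subset fun w hw => hw.1)
    · exact fun p hp => ⟨by simp, fun hb => p.2.not_configurationUnique hb hp⟩
    · rintro ⟨⟨P, Q⟩, h⟩ _ ⟨⟨P', Q'⟩, h'⟩ _ heq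
      have heq' := List.ofFn_injective heq
      simp only [Subtype.mk.injEq, Prod.mk.injEq]
      exact ⟨funext fun i => (Prod.mk.inj (congrFun heq' i)).2,
        funext fun i => (Prod.mk.inj (congrFun heq' i)).1⟩
  have h2 := ncard_avoid_le flexibleBlock (n / 4) (n % 4)
  have hc : Nat.card (Step × Step) = 4 := by rw [Nat.card_prod, card_step]
  rw [hc, show flexibleBlock.length = 4 from rfl, Nat.div_add_mod'] at h2
  refine h1.trans (h2.trans (Nat.mul_le_mul_left _ ?_))
  exact Nat.pow_le_pow_right (by norm_num) (show n % 4 ≤ 3 by omega)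

end Unique

/-! ### The two limits -/

section Asymptotics

open Filter Topology

/-- With `n = m + 1`, this combines `4 ^ m ≤ 2 * m * centralBinom m` with `centralBinom m = (m + 1)
* catalan m`. -/
theorem four_pow_le_mul_catalan {n : ℕ} (hn : 2 ≤ n) :
    4 ^ n ≤ 8 * n ^ 2 * catalan (n - 1) := by
  obtain ⟨m, rfl⟩ : ∃ m, n = m + 1 := ⟨n - 1, by omega⟩
  have h1 := Nat.four_pow_le_two_mul_self_mul_centralBinom m (by omega)
  rw [← succ_mul_catalan_eq_centralBinom] at h1
  rw [Nat.add_sub_cancel, pow_succ]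
  nlinarith [Nat.zero_le (catalan m), Nat.zero_le (m * catalan m)]

theorem tendsto_ncard_uniqueConnectedLpms_div : Tendsto
    (fun n : ℕ => ((uniqueConnectedLpms n).ncard : ℝ) / ((connectedLpms n).ncard : ℝ))
    atTop (𝓝 0) := by
  -- The ratio is at most `8 * n ^ 2 * (3 / 4) ^ n`.
  have h := (tendsto_pow_const_mul_const_pow_of_abs_lt_one (r := (3 / 4 : ℝ)) 2
    (by rw [abs_of_pos] <;> norm_num)).const_mul 8
  rw [mul_zero] at h
  refine squeeze_zero' (Eventually.of_forall fun n => by positivity) ?_ h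
  filter_upwards [eventually_ge_atTop 2] with n hn
  rw [ncard_connectedLpms hn]
  have h1 : ((uniqueConnectedLpms n).ncard : ℝ) ≤ 3 ^ n := by
    have h2 := two_mul_ncard_uniqueConnectedLpms hn
    have h3 : 3 ^ (n - 2) ≤ 3 ^ n := Nat.pow_le_pow_right (by norm_num) (Nat.sub_le n 2)
    have h4 : 1 ≤ 3 ^ n := Nat.one_le_pow _ _ (by norm_num)
    exact_mod_cast (show (uniqueConnectedLpms n).ncard ≤ 3 ^ n by omega)
  have h5 : (4 : ℝ) ^ n ≤ 8 * n ^ 2 * catalan (n - 1) := by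
    exact_mod_cast four_pow_le_mul_catalan hn
  have h6 : (0 : ℝ) < catalan (n - 1) := by
    by_contra hle
    have : (8 : ℝ) * n ^ 2 * catalan (n - 1) ≤ 0 :=
      mul_nonpos_of_nonneg_of_nonpos (by positivity) (not_lt.1 hle)
    have : (0 : ℝ) < 4 ^ n := by positivity
    linarith
  rw [div_le_iff₀ h6, div_pow]
  have h7 : (8 : ℝ) * (n ^ 2 * (3 ^ n / 4 ^ n)) * catalan (n - 1) =
      3 ^ n * ((8 * n ^ 2 * catalan (n - 1)) / 4 ^ n) := by ring
  rw [h7]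
  refine h1.trans (le_mul_of_one_le_right (by positivity) ?_)
  rwa [one_le_div (by positivity)]

theorem tendsto_ncard_uniqueLpms_div : Tendsto
    (fun n : ℕ => ((uniqueLpms n).ncard : ℝ) / ((lpms n).ncard : ℝ)) atTop (𝓝 0) := by
  -- Any `r < 1` with `255 ≤ (4 * r) ^ 4` would do, and `0.9995` is such a number. One of the
  -- factors `64` in the constant is slack.
  have h := (tendsto_pow_const_mul_const_pow_of_abs_lt_one (r := (9995 / 10000 : ℝ)) 2
    (by rw [abs_of_pos] <;> norm_num)).const_mul (8 * 64 * 64)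
  rw [mul_zero] at h
  refine squeeze_zero' (Eventually.of_forall fun n => by positivity) ?_ h
  filter_upwards [eventually_ge_atTop 2] with n hn
  set r : ℝ := 9995 / 10000 with hr
  have h1 : ((uniqueLpms n).ncard : ℝ) ≤ 64 * 64 * (4 ^ n * r ^ n) := by
    have h2 : ((uniqueLpms n).ncard : ℝ) ≤ 255 ^ (n / 4) * 64 := by
      exact_mod_cast ncard_uniqueLpms_le n
    have h3 : (255 : ℝ) ^ (n / 4) ≤ ((4 * r) ^ 4) ^ (n / 4) :=
      pow_le_pow_left₀ (by norm_num) (by norm_num [hr]) _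
    have h4 : ((4 * r) ^ 4) ^ (n / 4) ≤ (4 * r) ^ n := by
      rw [← pow_mul]
      exact pow_le_pow_right₀ (by norm_num [hr]) (Nat.mul_div_le n 4)
    rw [mul_pow 4 r n] at h4
    have h5 : (0 : ℝ) ≤ 4 ^ n * r ^ n := by positivity
    calc ((uniqueLpms n).ncard : ℝ) ≤ 255 ^ (n / 4) * 64 := h2
      _ ≤ 4 ^ n * r ^ n * 64 := mul_le_mul_of_nonneg_right (h3.trans h4) (by norm_num)
      _ ≤ 64 * 64 * (4 ^ n * r ^ n) := by linarith
  have h5 : (4 : ℝ) ^ n ≤ 8 * n ^ 2 * (lpms n).ncard := by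
    have h6 : catalan (n - 1) ≤ (lpms n).ncard := by
      rw [← ncard_connectedLpms hn]
      exact ncard_le_ncard (fun M hM => hM.1) (finite_lpms n)
    exact_mod_cast (four_pow_le_mul_catalan hn).trans (Nat.mul_le_mul_left _ h6)
  have h6 : (0 : ℝ) < (lpms n).ncard := by
    by_contra hle
    have : (8 : ℝ) * n ^ 2 * (lpms n).ncard ≤ 0 :=
      mul_nonpos_of_nonneg_of_nonpos (by positivity) (not_lt.1 hle)
    have : (0 : ℝ) < 4 ^ n := by positivity
    linarith
  rw [div_le_iff₀ h6]
  have h7 := mul_le_mul_of_nonneg_right h5 (show (0 : ℝ) ≤ r ^ n by positivity)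
  calc ((uniqueLpms n).ncard : ℝ) ≤ 64 * 64 * (4 ^ n * r ^ n) := h1
    _ ≤ 64 * 64 * (8 * n ^ 2 * (lpms n).ncard * r ^ n) := by linarith
    _ = 8 * 64 * 64 * (n ^ 2 * r ^ n) * (lpms n).ncard := by ring

end Asymptotics

end LPM

theorem mainTheorem7 :
    (∀ n : ℕ, 2 ≤ n →
      ((LPM.uniqueConnectedLpms n).ncard : ℚ) = ((3 : ℚ) ^ (n - 2) + 1) / 2) ∧
    (∀ n : ℕ, 2 ≤ n → (LPM.connectedLpms n).ncard = catalan (n - 1)) ∧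
    Filter.Tendsto
      (fun n : ℕ => ((LPM.uniqueConnectedLpms n).ncard : ℝ) / ((LPM.connectedLpms n).ncard : ℝ))
      Filter.atTop (nhds 0) ∧
    Filter.Tendsto
      (fun n : ℕ => ((LPM.uniqueLpms n).ncard : ℝ) / ((LPM.lpms n).ncard : ℝ))
      Filter.atTop (nhds 0) := by
  refine ⟨fun n hn => ?_, fun n hn => LPM.ncard_connectedLpms hn,
    LPM.tendsto_ncard_uniqueConnectedLpms_div, LPM.tendsto_ncard_uniqueLpms_div⟩
  have h : (2 : ℚ) * (LPM.uniqueConnectedLpms n).ncard = 3 ^ (n - 2) + 1 := by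
    exact_mod_cast LPM.two_mul_ncard_uniqueConnectedLpms hn
  linarith
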